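/- Semigroups are nonempty. A *variety* is a class of finite semigroups that is closed under nonempty subsemigroups of finite direct products and under quotients (images under surjective morphisms); the *join* $\mathbf V\lor\mathbf W$ of two varieties is the smallest variety containing both. Let $\mathbf G$ be the class of all finite groups and $\mathbf{Com}$ the class of all finite commutative semigroups. For a class $\mathbf V$ of finite semigroups, $\mathrm{CSM}(\mathbf V)$ is the following problem: given the Cayley table of a semigroup $S\in\mathbf V$, a set $X\subseteq S$ and an element $t\in S$, decide whether $t$ lies in the subsemigroup of $S$ generated by $X$. If $|S|=N$, the elements of $S$ are numbered $0,\dots,N-1$ and written with $\lceil\log_2 N\rceil$ bits; the input is the word consisting of the $N^2$ entries of the table, the characteristic vector of $X$, and $t$. Only such words with $S\in\mathbf V$ are valid inputs (a promise problem): an algorithm has to be correct on valid inputs, and a reduction has to produce valid inputs. So $\mathrm{CSM}(\mathbf V)$ is in a class of languages if some language of this class gives the correct answer on all valid inputs. $\mathsf{qAC}^0$ is the class of languages decided by (nonuniform) families of Boolean circuits with unbounded fan-in AND and OR gates, of depth $O(1)$ and size $2^{O(\log^c n)}$ for some constant $c$, where NOT gates are free. $\mathsf{NL}$ is the class of languages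 accepted by nondeterministic Turing machines in space $O(\log n)$. Hardness and completeness are meant under $\mathsf{AC}^0$ many-one reductions, i.e. reductions computed by (nonuniform) circuit families of depth $O(1)$ and polynomial size. $\mathrm{Parity}$ is the language of binary words with an odd number of ones. **Corollary.** There exist two varieties, namely $\mathbf V=\mathbf G$ and $\mathbf W=\mathbf{Com}$, such that: 1. both $\mathrm{CSM}(\mathbf G)$ and $\mathrm{CSM}(\mathbf{Com})$ are in $\mathsf{qAC}^0$; 2. neither $\mathrm{CSM}(\mathbf G)$ nor $\mathrm{CSM}(\mathbf{Com})$ is hard for any class of languages containing $\mathrm{Parity}$; 3. $\mathrm{CSM}(\mathbf G\lor\mathbf{Com})$ is $\mathsf{NL}$-complete. Consequently, no class $\mathbf U$ of finite semigroups with $\mathbf G\cup\mathbf{Com}\subseteq\mathbf U$ and $\mathrm{CSM}(\mathbf U)\in\mathsf{qAC}^0$ is a variety, and no variety is inclusion-maximal among the classes $\mathbf U$ of finite semigroups with $\mathrm{CSM}(\mathbf U)\in\mathsf{qAC}^0$. -/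

import Mathlib

namespace CayleyMembership

/-! ## Finite semigroups and varieties -/

/-- A finite semigroup. Semigroups are nonempty. -/
structure FinSemigroup : Type 1 where
  Carrier : Type
  [semigroup : Semigroup Carrier]
  [finite : Finite Carrier]
  [nonempty : Nonempty Carrier]

attribute [instance] FinSemigroup.semigroup FinSemigroup.finite FinSemigroup.nonempty

/-- A variety of finite semigroups: a class of finite semigroups closed under finite subdirect
products (that is, under arbitrary nonempty subsemigroups of finite direct products) and under
quotients. -/
structure IsVariety (V : Set FinSemigroup) : Prop where
  subdirect : ∀ (n : ℕ) (S : Fin n → FinSemigroup), (∀ i, S i ∈ V) →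
    ∀ (T : Subsemigroup (∀ i, (S i).Carrier)) [Nonempty T], FinSemigroup.mk T ∈ V
  quotient : ∀ S T : FinSemigroup, S ∈ V →
    ∀ f : S.Carrier →ₙ* T.Carrier, Function.Surjective f → T ∈ V

/-- The join: the smallest variety containing both `V` and `W`. -/
def varietyJoin (V W : Set FinSemigroup) : Set FinSemigroup :=
  ⋂₀ {U | IsVariety U ∧ V ⊆ U ∧ W ⊆ U}

/-- `G`: the class of all finite groups. -/
def groups : Set FinSemigroup :=
  {S | ∃ (H : Type) (_ : Group H), Nonempty (S.Carrier ≃* H)}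

/-- `Com`: the class of all finite commutative semigroups. -/
def commutative : Set FinSemigroup :=
  {S | ∀ a b : S.Carrier, a * b = b * a}

/-! ## The Cayley semigroup membership problem -/

/-- A problem whose valid inputs are the words in `yes` (to be accepted) and the words in `no`
(to be rejected). -/
structure PromiseProblem where
  yes : Set (List Bool)
  no : Set (List Bool)

/-- The problem is decided, on its valid inputs, by some language of the class `K`. -/
def PromiseProblem.MemClass (P : PromiseProblem) (K : Set (Language Bool)) : Prop :=
  ∃ L ∈ K, (∀ w ∈ P.yes, w ∈ L) ∧ (∀ w ∈ P.no, w ∉ L)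

/-- The binary encoding, with `⌈log₂ N⌉` bits (least significant bit first), of an element of
`{0, …, N - 1}`. -/
def encodeElement {N : ℕ} (a : Fin N) : List Bool :=
  List.ofFn fun b : Fin (Nat.clog 2 N) => a.val.testBit b.val

open Classical in
/-- The encoding of an input `(S, X, t)`, where `S` has `N` elements, numbered by `e`:
the `N ^ 2` entries of the Cayley table row by row, the characteristic vector of `X`, and `t`. -/
noncomputable def encodeInstance (S : FinSemigroup) {N : ℕ} (e : S.Carrier ≃ Fin N)
    (X : Set S.Carrier) (t : S.Carrier) : List Bool :=
  ((List.finRange N).flatMap fun i => (List.finRange N).flatMap fun j =>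
      encodeElement (e (e.symm i * e.symm j)))
    ++ (List.finRange N).map (fun i => decide (e.symm i ∈ X))
    ++ encodeElement (e t)

/-- `CSM(V)`: given the Cayley table of `S ∈ V`, a subset `X` of `S` and `t ∈ S`, is `t` in the
subsemigroup of `S` generated by `X`? -/
def CSM (V : Set FinSemigroup) : PromiseProblem where
  yes := {w | ∃ S ∈ V, ∃ (N : ℕ) (e : S.Carrier ≃ Fin N) (X : Set S.Carrier) (t : S.Carrier),
    w = encodeInstance S e X t ∧ t ∈ Subsemigroup.closure X}
  no := {w | ∃ S ∈ V, ∃ (N : ℕ) (e : S.Carrier ≃ Fin N) (X : Set S.Carrier) (t : S.Carrier),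
    w = encodeInstance S e X t ∧ t ∉ Subsemigroup.closure X}

/-! ## Unbounded fan-in Boolean circuits -/

/-- The kind of a gate. -/
inductive GateKind where
  | and
  | or

/-- Boolean circuits with `n` inputs and `m` outputs, made of AND and OR gates of unbounded
fan-in. NOT gates are free: every wire carries a flag, and a wire with flag `true` negates the
value that it transports. -/
structure Circuit (n m : ℕ) where
  Gate : Type
  [fintype : Fintype Gate]
  kind : Gate → GateKind
  /-- the wires from the inputs into a gate -/
  inputWires : Gate → Set (Fin n × Bool)
  /-- the wires from the other gates into a gate -/
  gateWires : Gate → Set (Gate × Bool)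
  /-- the directed graph of the gates (which is finite) has no cycle -/
  acyclic : WellFounded fun g h : Gate => ∃ b, (g, b) ∈ gateWires h
  /-- the wires that carry the outputs -/
  output : Fin m → (Fin n ⊕ Gate) × Bool

attribute [instance] Circuit.fintype

namespace Circuit

variable {n m : ℕ} (C : Circuit n m)

open Classical in
/-- The value of a gate on the input `x`. -/
noncomputable def gateValue (x : Fin n → Bool) : C.Gate → Bool :=
  C.acyclic.fix fun h val =>
    match C.kind h with
    | .and => decide ((∀ i b, (i, b) ∈ C.inputWires h → (x i ^^ b) = true) ∧
        ∀ g b, ∀ hg : (g, b) ∈ C.gateWires h, (val g ⟨b, hg⟩ ^^ b) = true)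
    | .or => decide ((∃ i b, (i, b) ∈ C.inputWires h ∧ (x i ^^ b) = true) ∨
        ∃ g b, ∃ hg : (g, b) ∈ C.gateWires h, (val g ⟨b, hg⟩ ^^ b) = true)

/-- The values of the outputs on the input `x`. -/
noncomputable def eval (x : Fin n → Bool) (j : Fin m) : Bool :=
  Sum.elim x (C.gateValue x) (C.output j).1 ^^ (C.output j).2

open Classical in
/-- The number of gates on a longest path that ends in the given gate. -/
noncomputable def gateDepth : C.Gate → ℕ :=
  C.acyclic.fix fun h dep =>
    (Finset.univ.sup fun g => if hg : ∃ b, (g, b) ∈ C.gateWires h then dep g hg else 0) + 1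

/-- The depth: the number of AND and OR gates on a longest path. -/
noncomputable def depth : ℕ := Finset.univ.sup C.gateDepth

/-- The size: the number of AND and OR gates. -/
def size : ℕ := Fintype.card C.Gate

end Circuit

/-- The family `C`, with one circuit for every input length, decides `L`. -/
def Decides (C : ∀ n, Circuit n 1) (L : Language Bool) : Prop :=
  ∀ (n : ℕ) (x : Fin n → Bool), List.ofFn x ∈ L ↔ (C n).eval x 0 = true

/-- `qAC⁰`: the languages decidable by circuit families of depth `O(1)` and size
`2 ^ O(log ^ c n)` for a constant `c`. -/
def qAC0 : Set (Language Bool) :=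
  {L | ∃ (C : ∀ n, Circuit n 1) (d c k : ℕ),
    (∀ n, (C n).depth ≤ d ∧ (C n).size ≤ 2 ^ (k * Nat.log 2 n ^ c + k)) ∧ Decides C L}

/-- `AC⁰` many-one reductions of a language to a problem: on inputs of length `n`, an output of
length `m n` is computed by a circuit of depth `O(1)` and polynomial size. Valid inputs of the
problem are produced on all words. -/
def AC0Reducible (L : Language Bool) (P : PromiseProblem) : Prop :=
  ∃ (m : ℕ → ℕ) (C : ∀ n, Circuit n (m n)) (d c : ℕ),
    (∀ n, (C n).depth ≤ d ∧ (C n).size ≤ n ^ c + c ∧ m n ≤ n ^ c + c) ∧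
    ∀ (n : ℕ) (x : Fin n → Bool),
      (List.ofFn x ∈ L → List.ofFn ((C n).eval x) ∈ P.yes) ∧
      (List.ofFn x ∉ L → List.ofFn ((C n).eval x) ∈ P.no)

/-- The problem is hard for the class `K` under `AC⁰` many-one reductions. -/
def Hard (K : Set (Language Bool)) (P : PromiseProblem) : Prop :=
  ∀ L ∈ K, AC0Reducible L P

/-- `Parity`: the words with an odd number of ones. -/
def parity : Language Bool := {w | Odd (w.count true)}

/-! ## Nondeterministic logarithmic space -/

/-- Head movements. -/
inductive Move where
  | left
  | stay
  | right

/-- The symbols on the input tape: the input word stands between two end markers. -/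
inductive InputSymbol where
  | leftEnd
  | bit (b : Bool)
  | rightEnd

/-- Nondeterministic Turing machines with a read-only two-way input tape and `tapes` many
read-write work tapes, each infinite to the right. -/
structure NTM where
  tapes : ℕ
  State : Type
  Symbol : Type
  [finiteState : Finite State]
  [finiteSymbol : Finite Symbol]
  blank : Symbol
  start : State
  accept : Set State
  /-- the allowed transitions, depending on the state and on the symbols read: a new state, a move
  of the input head, and for every work tape a symbol to be written and a move -/
  trans : State → InputSymbol → (Fin tapes → Symbol) →
    Set (State × Move × (Fin tapes → Symbol × Move))

namespace NTM

variable (M : NTM)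

/-- Configurations. -/
structure Config where
  state : M.State
  inputHead : ℕ
  head : Fin M.tapes → ℕ
  content : Fin M.tapes → ℕ → M.Symbol

/-- The content of cell `p` of the input tape: the left end marker is in cell `0`, the word `w` in
the cells `1, …, |w|`, and the right end marker in cell `|w| + 1`. -/
def inputSymbol (w : List Bool) : ℕ → InputSymbol
  | 0 => .leftEnd
  | p + 1 => if h : p < w.length then .bit w[p] else .rightEnd

/-- A head movement; a head on cell `0` that is to move to the left does not move. -/
def move : Move → ℕ → ℕ
  | .left, p => p - 1
  | .stay, p => p
  | .right, p => p + 1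

/-- The initial configuration. -/
def initial : M.Config where
  state := M.start
  inputHead := 0
  head := fun _ => 0
  content := fun _ _ => M.blank

/-- One step on the input `w`. The input head does not move beyond the end markers. -/
def Step (w : List Bool) (c c' : M.Config) : Prop :=
  ∃ r ∈ M.trans c.state (inputSymbol w c.inputHead) (fun i => c.content i (c.head i)),
    c'.state = r.1 ∧
    c'.inputHead = min (move r.2.1 c.inputHead) (w.length + 1) ∧
    ∀ i, c'.head i = move (r.2.2 i).2 (c.head i) ∧
      c'.content i = Function.update (c.content i) (c.head i) (r.2.2 i).1

/-- The configuration `c` occurs in some computation on the input `w`. -/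
def Reaches (w : List Bool) (c : M.Config) : Prop :=
  Relation.ReflTransGen (M.Step w) M.initial c

/-- Some computation on the input `w` reaches an accepting state. -/
def Accepts (w : List Bool) : Prop :=
  ∃ c, M.Reaches w c ∧ c.state ∈ M.accept

/-- On every input of length `n`, no computation visits a work tape cell beyond `O(log n)`. -/
def LogSpace : Prop :=
  ∃ k : ℕ, ∀ (w : List Bool) (c : M.Config), M.Reaches w c →
    ∀ i, c.head i ≤ k * Nat.log 2 w.length + k

end NTM

/-- `NL`: the languages accepted by nondeterministic machines in logarithmic space. -/
def NL : Set (Language Bool) :=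
  {L | ∃ M : NTM, M.LogSpace ∧ ∀ w, w ∈ L ↔ M.Accepts w}

/-- `NL`-completeness, under `AC⁰` many-one reductions. -/
def NLComplete (P : PromiseProblem) : Prop :=
  P.MemClass NL ∧ Hard NL P

end CayleyMembership

open CayleyMembership

/-! Upper bounds. Membership has short certificates. In a finite group, every element of the
subsemigroup generated by `X` has a straight-line program of length O(log² |G|), by the reachability
lemma of Babai and Szemerédi: a cube `C` of products is doubled as long as the quotients `c₁⁻¹ * c₂`
miss a generated element, which can happen at most log₂ |G| times (`exists_cube_of_not`,
`hasProgram_of_group`). In a finite commutative semigroup, a pigeonhole argument reduces a product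
to powers of logarithmically many generators, and repeated squaring computes the powers
(`exists_short_prod_pow`, `hasProgram_of_commSemigroup`). There are only quasipolynomially many
programs of polylogarithmic length, and each one is confirmed by prescribing certain letters of the
input. A disjunction over all of them is a circuit of depth two (`programLanguage_mem_qAC0`).

No hardness for Parity. A reduction of Parity followed by a quasipolynomial circuit of constant
depth would compute Parity. Razborov's method approximates such a composition by a function of
polylogarithmic degree over the field with three elements (`exists_circuitApprox`), whereas
Smolensky's dimension argument shows that agreement with Parity on three quarters of the cube
requires degree of order √n (`le_of_approximates_parity`). The argument excludes every problem in
qAC⁰, not only the two at hand (`not_ac0Reducible_parity`).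

Hardness of the join. A path semigroup consists of zero and the matrix units that strictly increase
a rank function on the vertices. Products of edges are paths, so membership in it is reachability in
a graded acyclic graph, and configuration graphs unfolded in time are of this kind
(`single_mem_closure_iff`, `hard_NL_of_isVariety`). Path semigroups belong to every variety
containing groups and commutative semigroups: a matrix unit `E` is recovered as the leading part of
the invertible matrix `1 + E` once its degree is known. The matrix lives in a group, the degree in
the commutative semigroup of truncated naturals, and taking the leading part is multiplicative on
the pairs for which it exists (`IsLeadingPart.mul`, `pathSemigroup_mem_of_isVariety`).

Membership in NL holds for all semigroups: a machine multiplies by one guessed generator after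
another, using one pass over the input for each multiplication (`memClass_NL`). The Turing machine
is obtained in two layers of abstraction, sweep machines and register machines.

Consequences. A variety containing both classes contains their join, so its problem is hard for NL,
which contains Parity; it is therefore not in qAC⁰. For maximal classes one uses that failing to be
a group, or failing to commute, is witnessed by two entries of the Cayley table. Hence groups, and
likewise commutative semigroups, can be added to any class without leaving qAC⁰, and a maximal class
contains both. -/

namespace CayleyMembership

/-! ## Circuits: unfolding -/

namespace Circuit

variable {n m : ℕ} (C : Circuit n m)

/-- The wires into a gate. -/
def wires (h : C.Gate) : Set ((Fin n ⊕ C.Gate) × Bool) :=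
  {w | match w with
    | (.inl i, b) => (i, b) ∈ C.inputWires h
    | (.inr g, b) => (g, b) ∈ C.gateWires h}

/-- The value transported by a wire. -/
noncomputable def wireValue (x : Fin n → Bool) (w : (Fin n ⊕ C.Gate) × Bool) : Bool :=
  Sum.elim x (C.gateValue x) w.1 ^^ w.2

theorem gateValue_and (x : Fin n → Bool) (h : C.Gate) (hk : C.kind h = .and) :
    C.gateValue x h = true ↔ ∀ w ∈ C.wires h, C.wireValue x w = true := by
  rw [gateValue, WellFounded.fix_eq]
  simp only [hk, decide_eq_true_eq]
  constructor
  · rintro ⟨h1, h2⟩ ⟨i | g, b⟩ hw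
    · exact h1 i b hw
    · exact h2 g b hw
  · intro H
    exact ⟨fun i b hw => H (.inl i, b) hw, fun g b hw => H (.inr g, b) hw⟩

theorem gateValue_or (x : Fin n → Bool) (h : C.Gate) (hk : C.kind h = .or) :
    C.gateValue x h = true ↔ ∃ w ∈ C.wires h, C.wireValue x w = true := by
  rw [gateValue, WellFounded.fix_eq]
  simp only [hk, decide_eq_true_eq]
  constructor
  · rintro (⟨i, b, hw, hv⟩ | ⟨g, b, hw, hv⟩)
    · exact ⟨(.inl i, b), hw, hv⟩
    · exact ⟨(.inr g, b), hw, hv⟩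
  · rintro ⟨⟨i | g, b⟩, hw, hv⟩
    · exact .inl ⟨i, b, hw, hv⟩
    · exact .inr ⟨g, b, hw, hv⟩

open Classical in
theorem gateDepth_eq (h : C.Gate) : C.gateDepth h =
    (Finset.univ.sup fun g => if ∃ b, (g, b) ∈ C.gateWires h then C.gateDepth g else 0) + 1 := by
  rw [gateDepth, WellFounded.fix_eq]
  congr 1

theorem gateDepth_lt {g h : C.Gate} {b : Bool} (hg : (g, b) ∈ C.gateWires h) :
    C.gateDepth g < C.gateDepth h := by
  classical
  rw [gateDepth_eq C h, Nat.lt_succ_iff]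
  refine le_trans ?_ (Finset.le_sup (Finset.mem_univ g))
  rw [if_pos ⟨b, hg⟩]

theorem gateDepth_le_depth (h : C.Gate) : C.gateDepth h ≤ C.depth :=
  Finset.le_sup (f := C.gateDepth) (Finset.mem_univ h)

/-- Bounds the depth of an explicit circuit by exhibiting levels, without computing longest paths.
-/
theorem gateDepth_le_of_rank (r : C.Gate → ℕ)
    (hr : ∀ g h b, (g, b) ∈ C.gateWires h → r g < r h) (hpos : ∀ g, 1 ≤ r g) (h : C.Gate) :
    C.gateDepth h ≤ r h := by
  classical
  induction h using C.acyclic.induction with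
  | _ h ih =>
    rw [gateDepth_eq]
    have : (Finset.univ.sup fun g =>
        if ∃ b, (g, b) ∈ C.gateWires h then C.gateDepth g else 0) ≤ r h - 1 := by
      refine Finset.sup_le fun g _ => ?_
      split_ifs with hg
      · obtain ⟨b, hb⟩ := hg
        have h1 := hr g h b hb
        have h2 := ih g ⟨b, hb⟩
        omega
      · exact Nat.zero_le _
    have := hpos h
    omega

theorem depth_le_of_rank (r : C.Gate → ℕ) (d : ℕ)
    (hr : ∀ g h b, (g, b) ∈ C.gateWires h → r g < r h) (hpos : ∀ g, 1 ≤ r g)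
    (hd : ∀ g, r g ≤ d) : C.depth ≤ d :=
  Finset.sup_le fun h _ => (C.gateDepth_le_of_rank r hr hpos h).trans (hd h)

end Circuit

/-! ## Low-degree approximation over the field with three elements -/

section Approximation

variable {X : Type}

/-- Half of the subset sums of a nonzero vector are nonzero. -/
theorem two_mul_card_filter_sum_eq_zero_le {W : Type} [Fintype W] [DecidableEq W]
    (v : W → ZMod 3) (hv : ∃ w, v w ≠ 0) :
    2 * (Finset.univ.filter fun S : Finset W => ∑ w ∈ S, v w = 0).card
      ≤ Fintype.card (Finset W) := by
  obtain ⟨w₀, hw₀⟩ := hv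
  have h1 : (Finset.univ.filter fun S : Finset W => ∑ w ∈ S, v w = 0).card ≤
      (Finset.univ.filter fun S : Finset W => ¬ ∑ w ∈ S, v w = 0).card := by
    -- Toggling `w₀` changes the sum by `± v w₀ ≠ 0`, so it injects the zero sums into the nonzero
    -- ones.
    refine Finset.card_le_card_of_injOn (fun S => symmDiff S {w₀}) ?_ ?_
    · intro S hS
      simp only [Finset.coe_filter, Finset.mem_univ, true_and, Set.mem_ofPred_eq] at hS ⊢
      by_cases h : w₀ ∈ S
      · have : symmDiff S {w₀} = S.erase w₀ := by
          ext w; by_cases hw : w = w₀ <;> simp [Finset.mem_symmDiff, hw, h]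
        rw [this]
        intro h0
        have := Finset.add_sum_erase S v h
        rw [h0, hS] at this
        exact hw₀ (by simpa using this)
      · have : symmDiff S {w₀} = insert w₀ S := by
          ext w; by_cases hw : w = w₀ <;> simp [Finset.mem_symmDiff, hw, h]
        rw [this, Finset.sum_insert h, hS, add_zero]
        exact hw₀
    · intro S _ T _ h
      exact symmDiff_left_injective _ h
  have h2 := Finset.card_filter_add_card_filter_not (s := (Finset.univ : Finset (Finset W)))
    (fun S : Finset W => ∑ w ∈ S, v w = 0)
  rw [Finset.card_univ] at h2
  omega

/-- Averaging over all subsets: a random sum vanishes at each point of `B` with probability at most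
one half, so some sum vanishes on at most half of `B`. Double counting replaces expectations. -/
theorem exists_sum_ne_zero {W : Type} [Fintype W] [DecidableEq W] (v : W → X → ZMod 3)
    (B : Finset X) (hB : ∀ x ∈ B, ∃ w, v w x ≠ 0) :
    ∃ S : Finset W, 2 * (B.filter fun x => ∑ w ∈ S, v w x = 0).card ≤ B.card := by
  by_contra! H
  have h1 : ∑ S : Finset W, B.card < ∑ S : Finset W,
      2 * (B.filter fun x => ∑ w ∈ S, v w x = 0).card :=
    Finset.sum_lt_sum_of_nonempty Finset.univ_nonempty fun S _ => H S
  have h2 : ∑ S : Finset W, 2 * (B.filter fun x => ∑ w ∈ S, v w x = 0).card =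
      ∑ x ∈ B, 2 * (Finset.univ.filter fun S : Finset W => ∑ w ∈ S, v w x = 0).card := by
    rw [← Finset.mul_sum, ← Finset.mul_sum]
    congr 1
    exact Finset.sum_card_bipartiteAbove_eq_sum_card_bipartiteBelow
      (fun (S : Finset W) x => ∑ w ∈ S, v w x = 0)
  have h3 : ∑ x ∈ B, 2 * (Finset.univ.filter fun S : Finset W => ∑ w ∈ S, v w x = 0).card ≤
      ∑ x ∈ B, Fintype.card (Finset W) :=
    Finset.sum_le_sum fun x hx => two_mul_card_filter_sum_eq_zero_le _ (hB x hx)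
  rw [h2] at h1
  have h4 := h1.trans_le h3
  simp only [Finset.sum_const, smul_eq_mul, Finset.card_univ] at h4
  rw [mul_comm] at h4
  exact lt_irrefl _ h4

theorem sq_eq_one_of_ne_zero : ∀ a : ZMod 3, a ≠ 0 → a ^ 2 = 1 := by decide

variable (P : Submodule (ZMod 3) (X → ZMod 3))

/-- The product of `l` factors `1 - s²`, where `s` are sums of the given functions, equals the
indicator of the common zeros up to a fraction `2 ^ (-l)`. -/
theorem exists_norApprox [Fintype X] {W : Type} [Fintype W] [DecidableEq W] (v : W → X → ZMod 3) (l : ℕ)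
    (hP : 1 ∈ P) :
    ∃ r : X → ZMod 3, (∀ x, (∀ w, v w x = 0) → r x = 1) ∧
      2 ^ l * (Finset.univ.filter fun x => (∃ w, v w x ≠ 0) ∧ r x ≠ 0).card ≤ Fintype.card X ∧
      ∀ E, (∀ w, v w ∈ P ^ E) → r ∈ P ^ (E * (2 * l)) := by
  induction l with
  | zero =>
    refine ⟨1, fun x _ => rfl, ?_, fun E _ => ?_⟩
    · rw [pow_zero, one_mul]
      exact Finset.card_le_univ _
    · simpa using ⟨(1 : ZMod 3), map_one _⟩
  | succ l ih =>
    obtain ⟨r, hr1, hr2, hr3⟩ := ih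
    obtain ⟨S, hS⟩ := exists_sum_ne_zero v
      (Finset.univ.filter fun x => (∃ w, v w x ≠ 0) ∧ r x ≠ 0) (by
        intro x hx
        exact (Finset.mem_filter.1 hx).2.1)
    -- Nonzero squares are `1` in this field, so the new factor kills every point where the chosen
    -- sum is nonzero. By the choice of `S`, at most half of the remaining bad points survive. The
    -- factor costs degree `2 * E`.
    refine ⟨r * (1 - (∑ w ∈ S, v w) ^ 2), ?_, ?_, ?_⟩
    · intro x hx
      simp [hr1 x hx, Finset.sum_apply, hx]
    · have hsub : (Finset.univ.filter fun x => (∃ w, v w x ≠ 0) ∧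
          (r * (1 - (∑ w ∈ S, v w) ^ 2) : X → ZMod 3) x ≠ 0) ⊆
          (Finset.univ.filter fun x => (∃ w, v w x ≠ 0) ∧ r x ≠ 0).filter
            fun x => ∑ w ∈ S, v w x = 0 := by
        intro x hx
        simp only [Finset.mem_filter, Finset.mem_univ, true_and, Pi.mul_apply, Pi.sub_apply,
          Pi.one_apply, Pi.pow_apply, Finset.sum_apply] at hx ⊢
        refine ⟨⟨hx.1, left_ne_zero_of_mul hx.2⟩, ?_⟩
        by_contra h0
        apply right_ne_zero_of_mul hx.2
        rw [sq_eq_one_of_ne_zero _ h0, sub_self]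
      have hc := Finset.card_le_card hsub
      calc _ ≤ 2 ^ (l + 1) * _ := Nat.mul_le_mul_left _ hc
        _ = 2 ^ l * (2 * _) := by rw [pow_succ, mul_assoc]
        _ ≤ 2 ^ l * _ := Nat.mul_le_mul_left _ hS
        _ ≤ _ := hr2
    · intro E hE
      have hs : (∑ w ∈ S, v w) ∈ P ^ E := Submodule.sum_mem _ fun w _ => hE w
      have hs2 : (∑ w ∈ S, v w) ^ 2 ∈ P ^ (E * 2) := by
        rw [pow_mul]; exact Submodule.pow_mem_pow _ hs 2
      have h1 : (1 : X → ZMod 3) ∈ P ^ (E * 2) := by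
        have := Submodule.pow_mem_pow P hP (E * 2); rwa [one_pow] at this
      have := Submodule.mul_mem_mul (hr3 E hE) (Submodule.sub_mem _ h1 hs2)
      rw [← pow_add] at this
      convert this using 2
      ring

/-- A Boolean as an element of the field with three elements. -/
def boolToZMod (b : Bool) : ZMod 3 := if b then 1 else 0

@[simp] theorem boolToZMod_not (b : Bool) : boolToZMod (!b) = 1 - boolToZMod b := by
  cases b <;> simp [boolToZMod]

theorem pow_le_pow_of_one_mem (hP : 1 ∈ P) {a b : ℕ} (h : a ≤ b) : P ^ a ≤ P ^ b :=
  pow_le_pow_right₀ (Submodule.one_le.2 hP) h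

theorem one_mem_pow_of_one_mem (hP : 1 ∈ P) (a : ℕ) : (1 : X → ZMod 3) ∈ P ^ a := by
  have := Submodule.pow_mem_pow P hP a; rwa [one_pow] at this

variable [Fintype X]

/-- The function transported by a wire, if the inputs and the gates have the given functions. -/
def wireFun {I G : Type} (p : I → X → ZMod 3) (q : G → X → ZMod 3) (w : (I ⊕ G) × Bool) :
    X → ZMod 3 :=
  if w.2 then 1 - Sum.elim p q w.1 else Sum.elim p q w.1

/-- An OR is one minus a NOR, and an AND is the NOR of the negated wires. The exceptional set
depends only on the functions `p` and `q`, not on the inputs `u` they represent, and `q` is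
arbitrary, so that the statement can be fed into a recursion along the gates. -/
theorem exists_gateApprox {n m : ℕ} (C : Circuit n m) (l : ℕ) (hP : 1 ∈ P)
    (p : Fin n → X → ZMod 3) (q : C.Gate → X → ZMod 3) (h : C.Gate) :
    ∃ f : X → ZMod 3,
      (∃ B : Finset X, 2 ^ l * B.card ≤ Fintype.card X ∧
        ∀ (u : X → Fin n → Bool) (x : X), x ∉ B →
          (∀ w ∈ C.wires h, wireFun p q w x = boolToZMod (C.wireValue (u x) w)) →
          f x = boolToZMod (C.gateValue (u x) h)) ∧
      ∀ E, (∀ w ∈ C.wires h, wireFun p q w ∈ P ^ E) → f ∈ P ^ (E * (2 * l)) := by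
  classical
  cases hk : C.kind h with
  | or =>
    obtain ⟨r, hr1, hr2, hr3⟩ :=
      exists_norApprox P (fun w : C.wires h => wireFun p q w.1) l hP
    refine ⟨1 - r, ⟨_, hr2, ?_⟩, fun E hE => Submodule.sub_mem _ (one_mem_pow_of_one_mem P hP _)
      (hr3 E fun w => hE _ w.2)⟩
    intro u x hx hw
    simp only [Finset.mem_filter, Finset.mem_univ, true_and, not_and, not_not] at hx
    by_cases hv : C.gateValue (u x) h = true
    · obtain ⟨w, hwh, hw1⟩ := (C.gateValue_or _ _ hk).1 hv
      have := hx ⟨⟨w, hwh⟩, by rw [hw w hwh, hw1]; decide⟩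
      simp [this, hv, boolToZMod]
    · have h0 := mt (C.gateValue_or (u x) h hk).2 hv
      have := hr1 x (by
        rintro ⟨w, hwh⟩
        have : C.wireValue (u x) w = false := by
          by_contra hc
          exact h0 ⟨w, hwh, by simpa using hc⟩
        rw [hw w hwh, this]; rfl)
      simp [this, hv, boolToZMod]
  | and =>
    obtain ⟨r, hr1, hr2, hr3⟩ :=
      exists_norApprox P (fun w : C.wires h => 1 - wireFun p q w.1) l hP
    refine ⟨r, ⟨_, hr2, ?_⟩, fun E hE => hr3 E fun w =>
      Submodule.sub_mem _ (one_mem_pow_of_one_mem P hP _) (hE _ w.2)⟩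
    intro u x hx hw
    simp only [Finset.mem_filter, Finset.mem_univ, true_and, not_and, not_not] at hx
    by_cases hv : C.gateValue (u x) h = true
    · have := (C.gateValue_and _ _ hk).1 hv
      rw [hr1 x (by
        rintro ⟨w, hwh⟩
        simp [hw w hwh, this w hwh, boolToZMod])]
      simp [hv, boolToZMod]
    · have h0 := mt (C.gateValue_and (u x) h hk).2 hv
      push Not at h0
      obtain ⟨w, hwh, hw1⟩ := h0
      have := hx ⟨⟨w, hwh⟩, by simp [hw w hwh, hw1, boolToZMod]⟩
      simp [this, hv, boolToZMod]

/-- Razborov's approximation of circuits by functions of low degree. The functions `p` approximate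
the inputs, outside the exceptional set `B`. -/
theorem exists_circuitApprox {n m : ℕ} (C : Circuit n m) (l : ℕ) (hl : 1 ≤ l) (hP : 1 ∈ P)
    (u : X → Fin n → Bool) (p : Fin n → X → ZMod 3) (D : ℕ) (hp : ∀ i, p i ∈ P ^ D)
    (B : Finset X) (hB : ∀ x ∉ B, ∀ i, p i x = boolToZMod (u x i)) :
    ∃ (q : Fin m → X → ZMod 3) (B' : Finset X),
      2 ^ l * B'.card ≤ C.size * Fintype.card X ∧
      (∀ j, q j ∈ P ^ (D * (2 * l) ^ C.depth)) ∧
      ∀ x, x ∉ B → x ∉ B' → ∀ j, q j x = boolToZMod (C.eval (u x) j) := by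
  classical
  choose F hF using exists_gateApprox P C l hP p
  choose Bad hBad hF' using fun q h => (hF q h).1
  have hF2 := fun q h => (hF q h).2
  let g : C.Gate → X → ZMod 3 := C.acyclic.fix fun h val =>
    F (fun g => if hg : ∃ b, (g, b) ∈ C.gateWires h then val g hg else 0) h
  have hg : ∀ h, g h = F (fun g' => if ∃ b, (g', b) ∈ C.gateWires h then g g' else 0) h := by
    intro h
    change C.acyclic.fix _ h = _
    rw [WellFounded.fix_eq]
    rfl
  -- The recursion knows only the functions of the immediate predecessors of `h`; all other gates
  -- are set to zero, which no wire into `h` notices.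
  let cut : C.Gate → C.Gate → X → ZMod 3 :=
    fun h g' => if ∃ b, (g', b) ∈ C.gateWires h then g g' else 0
  have hcut : ∀ h, ∀ w ∈ C.wires h, wireFun p (cut h) w = wireFun p g w := by
    rintro h ⟨i | g', b⟩ hw
    · rfl
    · have : cut h g' = g g' := if_pos ⟨b, hw⟩
      simp [wireFun, this]
  have hdeg : ∀ h, g h ∈ P ^ (D * (2 * l) ^ C.gateDepth h) := by
    intro h
    induction h using C.acyclic.induction with
    | _ h ih =>
      -- Every level multiplies the degree by `2 * l`; the wires into `h` have degree at most that
      -- of level `k`.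
      obtain ⟨k, hk⟩ : ∃ k, C.gateDepth h = k + 1 := by
        rw [C.gateDepth_eq]; exact ⟨_, rfl⟩
      rw [hk, pow_succ, ← mul_assoc, hg]
      apply hF2
      intro w hw
      have hmem : Sum.elim p (cut h) w.1 ∈ P ^ (D * (2 * l) ^ k) := by
        obtain ⟨i | g', b⟩ := w
        · refine pow_le_pow_of_one_mem P hP ?_ (hp i)
          exact Nat.le_mul_of_pos_right _ (Nat.pow_pos (by omega))
        · have : cut h g' = g g' := if_pos ⟨b, hw⟩
          rw [Sum.elim_inr, this]
          refine pow_le_pow_of_one_mem P hP ?_ (ih g' ⟨b, hw⟩)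
          have := C.gateDepth_lt hw
          exact Nat.mul_le_mul_left _ (Nat.pow_le_pow_right (by omega) (by omega))
      change wireFun p (cut h) w ∈ _
      unfold wireFun
      split_ifs
      · exact Submodule.sub_mem _ (one_mem_pow_of_one_mem P hP _) hmem
      · exact hmem
  -- Union bound: every gate contributes a fraction of at most `2 ^ (-l)` of the points.
  let B' : Finset X := Finset.univ.biUnion fun h => Bad (cut h) h
  have hval : ∀ x, x ∉ B → x ∉ B' → ∀ h, g h x = boolToZMod (C.gateValue (u x) h) := by
    intro x hx hx' h
    induction h using C.acyclic.induction with
    | _ h ih =>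
      rw [hg]
      apply hF' (cut h) h u x
      · intro hc
        exact hx' (Finset.mem_biUnion.2 ⟨h, Finset.mem_univ _, hc⟩)
      · intro w hw
        rw [hcut h w hw]
        obtain ⟨i | g', b⟩ := w
        · cases b <;> simp [wireFun, Circuit.wireValue, hB x hx i]
        · have := ih g' ⟨b, hw⟩
          cases b <;> simp [wireFun, Circuit.wireValue, this]
  refine ⟨fun j => wireFun p g (C.output j), B', ?_, ?_, ?_⟩
  · calc 2 ^ l * B'.card ≤ 2 ^ l * ∑ h, (Bad (cut h) h).card :=
          Nat.mul_le_mul_left _ Finset.card_biUnion_le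
      _ = ∑ h, 2 ^ l * (Bad (cut h) h).card := Finset.mul_sum _ _ _
      _ ≤ ∑ _h : C.Gate, Fintype.card X := Finset.sum_le_sum fun h _ => hBad _ _
      _ = C.size * Fintype.card X := by simp [Circuit.size]
  · intro j
    have hmem : Sum.elim p g (C.output j).1 ∈ P ^ (D * (2 * l) ^ C.depth) := by
      rcases (C.output j).1 with i | h
      · refine pow_le_pow_of_one_mem P hP ?_ (hp i)
        exact Nat.le_mul_of_pos_right _ (Nat.pow_pos (by omega))
      · refine pow_le_pow_of_one_mem P hP ?_ (hdeg h)
        exact Nat.mul_le_mul_left _ (Nat.pow_le_pow_right (by omega) (C.gateDepth_le_depth h))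
    simp only [wireFun]
    split_ifs
    · exact Submodule.sub_mem _ (one_mem_pow_of_one_mem P hP _) hmem
    · exact hmem
  · intro x hx hx' j
    have hmem : Sum.elim p g (C.output j).1 x =
        boolToZMod (Sum.elim (u x) (C.gateValue (u x)) (C.output j).1) := by
      rcases (C.output j).1 with i | h
      · exact hB x hx i
      · exact hval x hx hx' h
    simp only [wireFun, Circuit.eval]
    cases (C.output j).2 <;> simp [hmem]

end Approximation

/-! ## Parity and functions of low degree -/

section Smolensky

variable {n : ℕ}

/-- A coordinate of the cube, with values `1` and `-1`. -/
def sgn (i : Fin n) : (Fin n → Bool) → ZMod 3 := fun x => if x i then -1 else 1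

/-- The product of the given coordinates. -/
def character (A : Finset (Fin n)) : (Fin n → Bool) → ZMod 3 := ∏ i ∈ A, sgn i

/-- The affine functions. -/
def affineFun (n : ℕ) : Submodule (ZMod 3) ((Fin n → Bool) → ZMod 3) :=
  Submodule.span (ZMod 3) (insert 1 (Set.range sgn))

theorem one_mem_affineFun : 1 ∈ affineFun n := Submodule.subset_span (Set.mem_insert _ _)

theorem sgn_mem_affineFun (i : Fin n) : sgn i ∈ affineFun n :=
  Submodule.subset_span (Set.mem_insert_of_mem _ ⟨i, rfl⟩)

theorem sgn_mul_self (i : Fin n) : sgn i * sgn i = 1 := by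
  funext x; simp only [sgn, Pi.mul_apply, Pi.one_apply]; split_ifs <;> decide

/-- Since `sgn i` squares to one, a repeated factor disappears instead of raising the degree. -/
theorem sgn_mul_character (i : Fin n) (A : Finset (Fin n)) :
    ∃ A' : Finset (Fin n), A'.card ≤ A.card + 1 ∧ sgn i * character A = character A' := by
  by_cases h : i ∈ A
  · refine ⟨A.erase i, (Finset.card_erase_le).trans (Nat.le_succ _), ?_⟩
    rw [character, ← Finset.mul_prod_erase A sgn h, ← mul_assoc, sgn_mul_self, one_mul]
    rfl
  · exact ⟨insert i A, Finset.card_insert_le _ _, (Finset.prod_insert h).symm⟩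

/-- Reduction to multilinear form; thus the dimension of the space of functions of degree `D` is
bounded by counting small sets. -/
theorem affineFun_pow_le (D : ℕ) : affineFun n ^ D ≤
    Submodule.span (ZMod 3) (character '' {A | A.card ≤ D}) := by
  induction D with
  | zero =>
    rw [pow_zero, Submodule.one_le]
    exact Submodule.subset_span ⟨∅, by simp, rfl⟩
  | succ D ih =>
    rw [pow_succ']
    refine (mul_le_mul_right ih _).trans ?_
    rw [affineFun, Submodule.span_mul_span, Submodule.span_le]
    rintro _ ⟨f, hf, _, ⟨A, hA, rfl⟩, rfl⟩
    change A.card ≤ D at hA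
    apply Submodule.subset_span
    rcases hf with rfl | ⟨i, rfl⟩
    · exact ⟨A, Nat.le_succ_of_le hA, (one_mul _).symm⟩
    · obtain ⟨A', hA', h⟩ := sgn_mul_character i A
      exact ⟨A', hA'.trans (Nat.succ_le_succ hA), h.symm⟩

theorem prod_mem_pow_card {ι X : Type} (P : Submodule (ZMod 3) (X → ZMod 3))
    (f : ι → X → ZMod 3) (s : Finset ι) (hf : ∀ i ∈ s, f i ∈ P) : ∏ i ∈ s, f i ∈ P ^ s.card := by
  classical
  induction s using Finset.induction_on with
  | empty => simpa using ⟨(1 : ZMod 3), map_one _⟩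
  | insert a s ha ih =>
    rw [Finset.prod_insert ha, Finset.card_insert_of_notMem ha, pow_succ']
    exact Submodule.mul_mem_mul (hf a (Finset.mem_insert_self _ _))
      (ih fun i hi => hf i (Finset.mem_insert_of_mem hi))

theorem character_mem (A : Finset (Fin n)) : character A ∈ affineFun n ^ A.card :=
  prod_mem_pow_card _ _ _ fun i _ => sgn_mem_affineFun i

theorem affineFun_pow_eq_top : affineFun n ^ n = ⊤ := by
  classical
  rw [eq_top_iff]
  rintro f -
  -- The indicator of the point `a` is a product of `n` affine functions: each factor is `-(1 + 1) =
  -- 1` where the coordinate agrees with `a`, and `-(1 - 1) = 0` where it does not.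
  have hdelta : ∀ a : Fin n → Bool, (∏ i : Fin n,
      (-1 : ZMod 3) • (1 + (if a i then -1 else 1 : ZMod 3) • sgn i)) =
      (Pi.single a 1 : (Fin n → Bool) → ZMod 3) := by
    intro a
    funext x
    rw [Finset.prod_apply]
    by_cases h : x = a
    · subst h
      rw [Pi.single_eq_same]
      refine Finset.prod_eq_one fun i _ => ?_
      simp only [sgn, Pi.smul_apply, Pi.add_apply, Pi.one_apply]
      split_ifs <;> decide
    · rw [Pi.single_eq_of_ne h]
      obtain ⟨i, hi⟩ := Function.ne_iff.1 h
      refine Finset.prod_eq_zero (Finset.mem_univ i) ?_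
      simp only [sgn, Pi.smul_apply, Pi.add_apply, Pi.one_apply]
      cases hx : x i <;> cases ha : a i <;> simp_all
  have hf : f = ∑ a, f a • (Pi.single a 1 : (Fin n → Bool) → ZMod 3) := by
    funext x
    simp [Finset.sum_apply, Pi.single_apply]
  rw [hf]
  refine Submodule.sum_mem _ fun a _ => Submodule.smul_mem _ _ ?_
  rw [← hdelta]
  have := prod_mem_pow_card (affineFun n) (fun i : Fin n =>
      (-1 : ZMod 3) • (1 + (if a i then -1 else 1 : ZMod 3) • sgn i)) Finset.univ (fun i _ =>
    Submodule.smul_mem _ _ (Submodule.add_mem _ one_mem_affineFun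
      (Submodule.smul_mem _ _ (sgn_mem_affineFun i))))
  rwa [Finset.card_univ, Fintype.card_fin] at this

/-- Smolensky's dimension bound. -/
theorem card_le_of_eq_character {m D : ℕ} (p : (Fin (2 * m + 1) → Bool) → ZMod 3)
    (hp : p ∈ affineFun (2 * m + 1) ^ D) (G : Finset (Fin (2 * m + 1) → Bool))
    (hG : ∀ x ∈ G, p x = character Finset.univ x) :
    G.card ≤ (Finset.univ.filter fun A : Finset (Fin (2 * m + 1)) => A.card ≤ m + D).card := by
  classical
  let ρ : ((Fin (2 * m + 1) → Bool) → ZMod 3) →ₗ[ZMod 3] (G → ZMod 3) :=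
    LinearMap.funLeft (ZMod 3) (ZMod 3) Subtype.val
  have hρ : Function.Surjective ρ :=
    LinearMap.funLeft_surjective_of_injective _ _ _ Subtype.val_injective
  have hle : ∀ f, ρ f ∈ (affineFun (2 * m + 1) ^ (m + D)).map ρ := by
    intro f
    have hf : f ∈ Submodule.span (ZMod 3)
        (character '' {A : Finset (Fin (2 * m + 1)) | A.card ≤ 2 * m + 1}) :=
      affineFun_pow_le _ (by rw [affineFun_pow_eq_top]; trivial)
    induction hf using Submodule.span_induction with
    | zero => simp
    | add f g _ _ hf hg => rw [map_add]; exact Submodule.add_mem _ hf hg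
    | smul c f _ hf => rw [map_smul]; exact Submodule.smul_mem _ _ hf
    | mem f hf =>
      obtain ⟨A, -, rfl⟩ := hf
      by_cases hA : A.card ≤ m
      · exact ⟨_, pow_le_pow_of_one_mem _ one_mem_affineFun (by omega) (character_mem A), rfl⟩
      -- A character of a large set is the full character times that of the complement. On `G` the
      -- full character has degree `D`, and the complement has at most `m` elements.
      · refine ⟨p * character Aᶜ, ?_, ?_⟩
        · have h1 : Aᶜ.card ≤ m := by
            rw [Finset.card_compl, Fintype.card_fin]; omega
          have := Submodule.mul_mem_mul hp
            (pow_le_pow_of_one_mem _ one_mem_affineFun h1 (character_mem Aᶜ))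
          rwa [← pow_add, add_comm D] at this
        · funext ⟨x, hx⟩
          change p x * character Aᶜ x = character A x
          rw [hG x hx]
          have h2 : character Finset.univ = character A * character Aᶜ :=
            (Finset.prod_mul_prod_compl A sgn).symm
          have h3 : character Aᶜ * character Aᶜ = 1 := by
            rw [character, ← Finset.prod_mul_distrib]
            exact Finset.prod_eq_one fun i _ => sgn_mul_self i
          have h4 := congrFun h3 x
          rw [h2, Pi.mul_apply, mul_assoc]
          rw [Pi.mul_apply] at h4
          rw [h4, Pi.one_apply, mul_one]
  -- The restrictions of the characters of sets of size at most `m + D` span all functions on `G`,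
  -- so there are at least as many of them as points of `G`.
  have htop : (⊤ : Submodule (ZMod 3) (G → ZMod 3)) ≤ Submodule.span (ZMod 3)
      (((Finset.univ.filter fun A : Finset (Fin (2 * m + 1)) => A.card ≤ m + D).image
        fun A => ρ (character A) : Finset (G → ZMod 3)) : Set (G → ZMod 3)) := by
    rintro g -
    obtain ⟨f, rfl⟩ := hρ g
    have := Submodule.map_mono (f := ρ) (affineFun_pow_le (n := 2 * m + 1) (m + D)) (hle f)
    rw [Submodule.map_span, ← Set.image_comp] at this
    convert this using 3
    ext; simp
  have h1 := finrank_span_finset_le_card (R := ZMod 3)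
    ((Finset.univ.filter fun A : Finset (Fin (2 * m + 1)) => A.card ≤ m + D).image
        fun A => ρ (character A))
  rw [Set.finrank, eq_top_iff.2 htop, finrank_top, Module.finrank_fintype_fun_eq_card,
    Fintype.card_coe] at h1
  exact h1.trans Finset.card_image_le

/-- The square-root decay of the central binomial coefficient relative to `4 ^ m`, in squared form.
The induction step amounts to `(2m + 1)(2m + 3) ≤ 4(m + 1)²`. -/
theorem centralBinom_sq_le (m : ℕ) : m.centralBinom ^ 2 * (2 * m + 1) ≤ 16 ^ m := by
  induction m with
  | zero => simp
  | succ m ih =>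
    have h := Nat.succ_mul_centralBinom_succ m
    refine Nat.le_of_mul_le_mul_left ?_ (by positivity : 0 < (m + 1) ^ 2 * (2 * m + 1))
    calc (m + 1) ^ 2 * (2 * m + 1) * ((m + 1).centralBinom ^ 2 * (2 * (m + 1) + 1))
        = ((m + 1) * (m + 1).centralBinom) ^ 2 * ((2 * m + 1) * (2 * m + 3)) := by ring
      _ = (m.centralBinom ^ 2 * (2 * m + 1)) *
            (4 * (2 * m + 1) * ((2 * m + 1) * (2 * m + 3))) := by rw [h]; ring
      _ ≤ 16 ^ m * (16 * ((m + 1) ^ 2 * (2 * m + 1))) := by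
          refine Nat.mul_le_mul ih ?_
          nlinarith [Nat.zero_le m]
      _ = (m + 1) ^ 2 * (2 * m + 1) * 16 ^ (m + 1) := by ring

/-- By symmetry the sets of size at most `m` are exactly half of all; each of the `D` further layers
is at most the central binomial coefficient for `m + 1`. -/
theorem card_filter_card_le (m D : ℕ) :
    (Finset.univ.filter fun A : Finset (Fin (2 * m + 1)) => A.card ≤ m + D).card
      ≤ 4 ^ m + D * (m + 1).centralBinom := by
  classical
  have h1 : (Finset.univ.filter fun A : Finset (Fin (2 * m + 1)) => A.card ≤ m + D).card
      ≤ ∑ i ∈ Finset.range (m + D + 1), (2 * m + 1).choose i := by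
    have : (Finset.univ.filter fun A : Finset (Fin (2 * m + 1)) => A.card ≤ m + D) ⊆
        (Finset.range (m + D + 1)).biUnion fun i => Finset.powersetCard i Finset.univ := by
      intro A hA
      simp only [Finset.mem_filter, Finset.mem_univ, true_and] at hA
      simp only [Finset.mem_biUnion, Finset.mem_range, Finset.mem_powersetCard_univ]
      exact ⟨_, by omega, rfl⟩
    refine (Finset.card_le_card this).trans (Finset.card_biUnion_le.trans (le_of_eq ?_))
    simp
  refine h1.trans ?_
  rw [show m + D + 1 = (m + 1) + D by ring, Finset.sum_range_add, Nat.sum_range_choose_halfway]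
  refine Nat.add_le_add_left ?_ _
  refine (Finset.sum_le_card_nsmul _ _ (m + 1).centralBinom fun i _ => ?_).trans (by simp)
  refine le_trans ?_ (Nat.choose_le_centralBinom (m + 1 + i) (m + 1))
  exact Nat.choose_le_choose _ (by omega)

/-- A function of degree `D` that agrees with parity on three quarters of the cube has
`D` at least of the order of the square root of the number of variables. -/
theorem le_of_approximates_parity {m D : ℕ} (p : (Fin (2 * m + 1) → Bool) → ZMod 3)
    (hp : p ∈ affineFun (2 * m + 1) ^ D) (B : Finset (Fin (2 * m + 1) → Bool))
    (hB : 4 * B.card ≤ 2 ^ (2 * m + 1))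
    (hpB : ∀ x ∉ B, p x = character Finset.univ x) : 2 * m + 3 ≤ 64 * D ^ 2 := by
  classical
  have h1 := card_le_of_eq_character p hp Bᶜ (fun x hx => hpB x (Finset.mem_compl.1 hx))
  have h2 := h1.trans (card_filter_card_le m D)
  have h3 := B.card_add_card_compl
  have h4 : Fintype.card (Fin (2 * m + 1) → Bool) = 2 * 4 ^ m := by
    rw [Fintype.card_fun, Fintype.card_bool, Fintype.card_fin, pow_succ, pow_mul]; ring
  have h5 : 2 ^ (2 * m + 1) = 2 * 4 ^ m := by rw [pow_succ, pow_mul]; ring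
  rw [h4] at h3
  rw [h5] at hB
  -- At least `3/2 * 4 ^ m` points are good, while the dimension bound allows only `4 ^ m + D *
  -- centralBinom`. Squaring and cancelling the square of the binomial coefficient yields the
  -- constant `64`.
  have h6 : 4 ^ m ≤ 2 * (D * (m + 1).centralBinom) := by omega
  have h7 := centralBinom_sq_le (m + 1)
  have h8 : (4 ^ m) ^ 2 ≤ (2 * (D * (m + 1).centralBinom)) ^ 2 := Nat.pow_le_pow_left h6 2
  have h9 : (16 : ℕ) ^ (m + 1) = 16 * (4 ^ m) ^ 2 := by
    rw [pow_succ, ← pow_mul, mul_comm m 2, pow_mul]; norm_num [mul_comm]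
  rw [h9] at h7
  have hpos : 0 < (m + 1).centralBinom := Nat.centralBinom_pos _
  refine Nat.le_of_mul_le_mul_left ?_ (pow_pos hpos 2)
  nlinarith

theorem count_true_ofFn {n : ℕ} (x : Fin n → Bool) :
    (List.ofFn x).count true = ∑ i, if x i = true then 1 else 0 := by
  induction n with
  | zero => simp
  | succ n ih =>
    rw [List.ofFn_succ, List.count_cons, ih, Fin.sum_univ_succ, add_comm]
    congr 1
    cases x 0 <;> rfl

/-- The sign of parity is an affine function of the parity bit, because `1 + 1 = -1` modulo three.
-/
theorem character_univ_eq (x : Fin n → Bool) (b : Bool)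
    (hb : b = true ↔ List.ofFn x ∈ parity) :
    character Finset.univ x = 1 + boolToZMod b := by
  have h1 : character Finset.univ x = (-1) ^ (List.ofFn x).count true := by
    rw [character, Finset.prod_apply]
    have : ∀ i, sgn i x = (-1) ^ (if x i = true then 1 else 0) := by
      intro i; simp only [sgn]; split_ifs <;> simp
    simp_rw [this]
    rw [Finset.prod_pow_eq_pow_sum]
    congr 1
    exact (count_true_ofFn x).symm
  rw [h1]
  change _ ↔ Odd _ at hb
  cases b with
  | true => rw [(hb.1 rfl).neg_one_pow]; decide
  | false =>
    have : Even ((List.ofFn x).count true) := by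
      rw [← Nat.not_odd_iff_even]; intro h; simpa using hb.2 h
    rw [this.neg_one_pow]; decide

end Smolensky

/-! ### Parity does not reduce to problems in qAC⁰. -/

theorem exists_lt_two_pow (a b e : ℕ) : ∃ j, 1 ≤ j ∧ a * (j + b) ^ e < 2 ^ j := by
  have h := tendsto_pow_const_div_const_pow_of_one_lt e (one_lt_two : (1 : ℝ) < 2)
  have h2 := h.eventually (gt_mem_nhds (by positivity : (0 : ℝ) < 1 / ((a + 1) * 2 ^ b)))
  obtain ⟨i, hi⟩ := (h2.and (Filter.eventually_ge_atTop (b + 1))).exists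
  obtain ⟨j, rfl⟩ : ∃ j, i = j + b := ⟨i - b, by omega⟩
  refine ⟨j, by omega, ?_⟩
  have h3 := hi.1
  rw [div_lt_div_iff₀ (by positivity) (by positivity), one_mul, pow_add, ← mul_assoc] at h3
  have h4 := lt_of_mul_lt_mul_right h3 (by positivity)
  push_cast at h4
  have h5 : ((a * (j + b) ^ e : ℕ) : ℝ) < ((2 ^ j : ℕ) : ℝ) := by
    push_cast
    have : (0 : ℝ) ≤ ((j : ℝ) + b) ^ e := by positivity
    nlinarith
  exact_mod_cast h5

theorem pow_add_self_le_two_pow {n j c : ℕ} (hn : n ≤ 2 ^ (j + 1)) :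
    n ^ c + c ≤ 2 ^ ((j + 2) * c) := by
  rcases Nat.eq_zero_or_pos c with rfl | hc
  · simp
  · have h1 : n ^ c ≤ 2 ^ ((j + 1) * c) := by
      rw [pow_mul]; exact Nat.pow_le_pow_left hn c
    have h2 : c ≤ 2 ^ ((j + 1) * c) :=
      Nat.lt_two_pow_self.le.trans (Nat.pow_le_pow_right (by omega) (by nlinarith))
    calc n ^ c + c ≤ 2 ^ ((j + 1) * c) * 2 := by omega
      _ = 2 ^ ((j + 1) * c + 1) := (pow_succ _ _).symm
      _ ≤ 2 ^ ((j + 2) * c) := Nat.pow_le_pow_right (by omega) (by nlinarith)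

/-- No problem in `qAC⁰` is hard for `Parity`. -/
theorem not_ac0Reducible_parity (P : PromiseProblem) (hP : P.MemClass qAC0) :
    ¬ AC0Reducible parity P := by
  classical
  rintro ⟨m, C, d₁, c₁, hC, hred⟩
  obtain ⟨L, ⟨E, d₂, c, k, hE, hdec⟩, hyes, hno⟩ := hP
  -- The number of factors per gate. The first summand bounds the logarithm of the size and of the
  -- output length of the reduction on inputs of length at most `2 ^ (j + 1)`, the second the
  -- logarithm of the size of the circuit applied to that output. The summand `3` provides a factor
  -- `8` for the union bound.
  set l : ℕ → ℕ := fun j => (j + 3) * c₁ + (k * ((j + 3) * c₁) ^ c + k) + 3 with hl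
  obtain ⟨K, e, hK⟩ : ∃ K e : ℕ, ∀ j, 64 * ((2 * l j) ^ d₁ * (2 * l j) ^ d₂) ^ 2
      ≤ K * (j + 3) ^ e := by
    refine ⟨64 * (2 * (c₁ + (k * c₁ ^ c + k) + 3)) ^ ((d₁ + d₂) * 2),
      (c + 1) * ((d₁ + d₂) * 2), fun j => ?_⟩
    have h0 : ∀ i, i ≤ c + 1 → (j + 3) ^ i ≤ (j + 3) ^ (c + 1) :=
      fun i hi => Nat.pow_le_pow_right (by omega) hi
    have h1 : l j ≤ (c₁ + (k * c₁ ^ c + k) + 3) * (j + 3) ^ (c + 1) := by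
      have ha := h0 1 (by omega)
      have hb := h0 c (by omega)
      have hc := h0 0 (by omega)
      rw [pow_one] at ha
      rw [pow_zero] at hc
      simp only [hl]
      calc (j + 3) * c₁ + (k * ((j + 3) * c₁) ^ c + k) + 3
          = c₁ * (j + 3) + (k * c₁ ^ c * (j + 3) ^ c + k * 1) + 3 * 1 := by
            rw [mul_pow]; ring
        _ ≤ c₁ * (j + 3) ^ (c + 1) + (k * c₁ ^ c * (j + 3) ^ (c + 1) + k * (j + 3) ^ (c + 1))
            + 3 * (j + 3) ^ (c + 1) := by gcongr
        _ = _ := by ring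
    calc 64 * ((2 * l j) ^ d₁ * (2 * l j) ^ d₂) ^ 2 = 64 * (2 * l j) ^ ((d₁ + d₂) * 2) := by
          rw [← pow_add, ← pow_mul]
      _ ≤ 64 * (2 * ((c₁ + (k * c₁ ^ c + k) + 3) * (j + 3) ^ (c + 1))) ^ ((d₁ + d₂) * 2) := by
          gcongr
      _ = _ := by rw [← mul_assoc 2, mul_pow, ← pow_mul]; ring
  -- The squared degree is polynomial in `j`, whereas the input length is about `2 ^ j`; a large `j`
  -- separates them. The length `N` is odd, as required by the dimension bound.
  obtain ⟨j, hj, hjlt⟩ := exists_lt_two_pow K 3 e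
  obtain ⟨i, rfl⟩ : ∃ i, j = i + 1 := ⟨j - 1, by omega⟩
  set N := 2 * 2 ^ i + 1 with hN
  have hNle : N ≤ 2 ^ (i + 1 + 1) := by
    have : 1 ≤ 2 ^ i := Nat.one_le_two_pow
    rw [pow_succ, pow_succ]; omega
  set r := l (i + 1) with hr
  have hr1 : 1 ≤ r := by simp only [hr, hl]; omega
  have hsz := pow_add_self_le_two_pow (c := c₁) hNle
  obtain ⟨hCd, hCs, hCm⟩ := hC N
  obtain ⟨hEd, hEs⟩ := hE (m N)
  -- The bit of coordinate `i` is the affine function `sgn i - 1`, as `-1 - 1 = 1` modulo three, so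
  -- the inputs of the reduction are represented exactly.
  obtain ⟨q₁, B₁, hB₁, hq₁, hv₁⟩ := exists_circuitApprox (affineFun N) (C N) r hr1
    one_mem_affineFun id (fun i => sgn i - 1) 1 (fun i => by
      rw [pow_one]; exact Submodule.sub_mem _ (sgn_mem_affineFun i) one_mem_affineFun) ∅ (by
      intro x _ i
      simp only [sgn, Pi.sub_apply, Pi.one_apply, id]
      cases x i <;> decide)
  have hq₁' : ∀ j, q₁ j ∈ affineFun N ^ ((2 * r) ^ d₁) := fun j =>
    pow_le_pow_of_one_mem _ one_mem_affineFun (by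
      rw [one_mul]; exact Nat.pow_le_pow_right (by omega) hCd) (hq₁ j)
  -- The approximated outputs of the reduction serve as inputs of the second circuit: degrees
  -- multiply and exceptional sets are united.
  obtain ⟨q₂, B₂, hB₂, hq₂, hv₂⟩ := exists_circuitApprox (affineFun N) (E (m N)) r hr1
    one_mem_affineFun (C N).eval q₁ _ hq₁' B₁ (fun x hx j => hv₁ x (by simp) hx j)
  have hq₂' : q₂ 0 ∈ affineFun N ^ ((2 * r) ^ d₁ * (2 * r) ^ d₂) :=
    pow_le_pow_of_one_mem _ one_mem_affineFun (Nat.mul_le_mul_left _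
      (Nat.pow_le_pow_right (by omega) hEd)) (hq₂ 0)
  have hfin := le_of_approximates_parity (1 + q₂ 0)
    (Submodule.add_mem _ (one_mem_pow_of_one_mem _ one_mem_affineFun _) hq₂') (B₁ ∪ B₂) ?_ ?_
  -- The approximation forces `2 * 2 ^ i + 3` to be at most the squared-degree bound, which is below
  -- `2 ^ (i + 1)`.
  · have := hK (i + 1)
    rw [← hr] at this
    have h2 : 2 ^ (i + 1) = 2 * 2 ^ i := by rw [pow_succ]; ring
    omega
  · have h1 : Fintype.card (Fin N → Bool) = 2 ^ N := by simp
    rw [h1] at hB₁ hB₂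
    have hu := Finset.card_union_le B₁ B₂
    have hs1 : (C N).size ≤ 2 ^ ((i + 1 + 3) * c₁) :=
      (hCs.trans hsz).trans (Nat.pow_le_pow_right (by omega) (Nat.mul_le_mul_right _ (by omega)))
    have hlog : Nat.log 2 (m N) ≤ (i + 1 + 3) * c₁ := by
      calc Nat.log 2 (m N) ≤ Nat.log 2 (2 ^ ((i + 1 + 2) * c₁)) :=
            Nat.log_mono_right (hCm.trans hsz)
        _ = (i + 1 + 2) * c₁ := Nat.log_pow (by omega) _
        _ ≤ _ := Nat.mul_le_mul_right _ (by omega)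
    have hs2 : (E (m N)).size ≤ 2 ^ (k * ((i + 1 + 3) * c₁) ^ c + k) := by
      refine hEs.trans (Nat.pow_le_pow_right (by omega) ?_)
      gcongr
    have hs : 4 * ((C N).size + (E (m N)).size) ≤ 2 ^ r := by
      have hr' : 2 ^ r = 2 ^ ((i + 1 + 3) * c₁) * 2 ^ (k * ((i + 1 + 3) * c₁) ^ c + k) * 8 := by
        simp only [hr, hl]; rw [pow_add, pow_add]; norm_num
      rw [hr']
      have ha : 1 ≤ 2 ^ ((i + 1 + 3) * c₁) := Nat.one_le_two_pow
      have hb : 1 ≤ 2 ^ (k * ((i + 1 + 3) * c₁) ^ c + k) := Nat.one_le_two_pow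
      nlinarith
    refine Nat.le_of_mul_le_mul_left ?_ (pow_pos (by omega : 0 < 2) r)
    calc 2 ^ r * (4 * (B₁ ∪ B₂).card) ≤ 2 ^ r * (4 * (B₁.card + B₂.card)) := by gcongr
      _ = 4 * (2 ^ r * B₁.card + 2 ^ r * B₂.card) := by ring
      _ ≤ 4 * ((C N).size * 2 ^ N + (E (m N)).size * 2 ^ N) := by gcongr
      _ = 4 * ((C N).size + (E (m N)).size) * 2 ^ N := by ring
      _ ≤ 2 ^ r * 2 ^ N := Nat.mul_le_mul_right _ hs
  · intro x hx
    rw [Finset.mem_union, not_or] at hx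
    rw [Pi.add_apply, hv₂ x hx.1 hx.2 0, Pi.one_apply]
    refine (character_univ_eq x _ ?_).symm
    rw [← hdec]
    by_cases hp : List.ofFn x ∈ parity
    · exact iff_of_true (hyes _ ((hred N x).1 hp)) hp
    · exact iff_of_false (hno _ ((hred N x).2 hp)) hp

/-! ## Building circuits -/

/-- The predicate is computed by a circuit of depth at most `d` and size at most `s`. -/
def HasCircuit (n d s : ℕ) (f : (Fin n → Bool) → Prop) : Prop :=
  ∃ C : Circuit n 1, C.depth ≤ d ∧ C.size ≤ s ∧ ∀ x, C.eval x 0 = true ↔ f x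

/-- The circuit whose output is a single OR gate, fed by the outputs of the given circuits. -/
def Circuit.iSup {n : ℕ} {ι : Type} [Fintype ι] (C : ι → Circuit n 1) : Circuit n 1 where
  Gate := (Σ i, (C i).Gate) ⊕ Unit
  kind := Sum.elim (fun g => (C g.1).kind g.2) fun _ => .or
  inputWires := Sum.elim (fun g => (C g.1).inputWires g.2)
    fun _ => {w | ∃ i, (C i).output 0 = (.inl w.1, w.2)}
  gateWires := Sum.elim
    (fun g => {w | ∃ g', w.1 = .inl ⟨g.1, g'⟩ ∧ (g', w.2) ∈ (C g.1).gateWires g.2})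
    fun _ => {w | ∃ i g', w.1 = .inl ⟨i, g'⟩ ∧ (C i).output 0 = (.inr g', w.2)}
  acyclic := by
    -- The depth inside each component, with the new gate above all of them, increases along wires.
    refine Subrelation.wf (r := InvImage (· < ·) (Sum.elim (fun g : Σ i, (C i).Gate =>
      (C g.1).gateDepth g.2) fun _ => (Finset.univ.sup fun i => (C i).depth) + 1)) ?_
      (InvImage.wf _ wellFounded_lt)
    rintro _ (⟨i, h⟩ | ⟨⟩) ⟨b, hb⟩
    · obtain ⟨g', rfl, hg⟩ := hb
      exact (C i).gateDepth_lt hg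
    · obtain ⟨i, g', rfl, -⟩ := hb
      exact Nat.lt_succ_of_le (((C i).gateDepth_le_depth g').trans
        (Finset.le_sup (f := fun i => (C i).depth) (Finset.mem_univ i)))
  output := fun _ => (.inr (.inr ()), false)

theorem Circuit.iSup_depth_le {n d : ℕ} {ι : Type} [Fintype ι] (C : ι → Circuit n 1)
    (hd : ∀ i, (C i).depth ≤ d) : (Circuit.iSup C).depth ≤ d + 1 := by
  refine (Circuit.iSup C).depth_le_of_rank (Sum.elim (fun g : Σ i, (C i).Gate =>
      (C g.1).gateDepth g.2) fun _ => d + 1) (d + 1) ?_ ?_ ?_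
  · rintro _ (⟨i, h⟩ | ⟨⟩) b hb
    · obtain ⟨g', hg1, hg⟩ := hb
      dsimp only at hg1; subst hg1
      exact (C i).gateDepth_lt hg
    · obtain ⟨i, g', hg1, -⟩ := hb
      dsimp only at hg1; subst hg1
      exact Nat.lt_succ_of_le (((C i).gateDepth_le_depth g').trans (hd i))
  · rintro (⟨i, h⟩ | ⟨⟩)
    · change 1 ≤ (C i).gateDepth h
      rw [(C i).gateDepth_eq]; omega
    · change 1 ≤ d + 1; omega
  · rintro (⟨i, h⟩ | ⟨⟩)
    · exact ((C i).gateDepth_le_depth h).trans ((hd i).trans (Nat.le_succ _))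
    · exact le_rfl

theorem Circuit.iSup_gateValue {n : ℕ} {ι : Type} [Fintype ι] (C : ι → Circuit n 1)
    (x : Fin n → Bool) (i : ι) (h : (C i).Gate) :
    (Circuit.iSup C).gateValue x (.inl ⟨i, h⟩) = (C i).gateValue x h := by
  induction h using (C i).acyclic.induction with
  | _ h ih =>
    have hin : ∀ j b, ((.inl j, b) : (Fin n ⊕ (Circuit.iSup C).Gate) × Bool) ∈
        (Circuit.iSup C).wires (.inl ⟨i, h⟩) ↔ (.inl j, b) ∈ (C i).wires h := fun j b => Iff.rfl
    have hgate : ∀ g' b, (.inr g', b) ∈ (C i).wires h →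
        ((.inr (.inl ⟨i, g'⟩), b) : (Fin n ⊕ (Circuit.iSup C).Gate) × Bool) ∈
        (Circuit.iSup C).wires (.inl ⟨i, h⟩) := fun g' b hb => ⟨g', rfl, hb⟩
    have hgate' : ∀ g b, ((.inr g, b) : (Fin n ⊕ (Circuit.iSup C).Gate) × Bool) ∈
        (Circuit.iSup C).wires (.inl ⟨i, h⟩) → ∃ g', g = .inl ⟨i, g'⟩ ∧
        (.inr g', b) ∈ (C i).wires h := fun g b hb => hb
    have hv : ∀ g' b, (.inr g', b) ∈ (C i).wires h →
        (Circuit.iSup C).wireValue x (.inr (.inl ⟨i, g'⟩), b) =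
          (C i).wireValue x (.inr g', b) := by
      intro g' b hb
      have := ih g' ⟨b, hb⟩
      change ((Circuit.iSup C).gateValue x (.inl ⟨i, g'⟩) ^^ b) = ((C i).gateValue x g' ^^ b)
      rw [this]
    rw [Bool.eq_iff_iff]
    cases hk : (C i).kind h with
    | and =>
      rw [(C i).gateValue_and x h hk, (Circuit.iSup C).gateValue_and x (.inl ⟨i, h⟩) hk]
      constructor
      · rintro H ⟨j | g', b⟩ hw
        · exact H _ ((hin j b).2 hw)
        · rw [← hv g' b hw]; exact H _ (hgate g' b hw)
      · rintro H ⟨j | g', b⟩ hw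
        · exact H _ ((hin j b).1 hw)
        · obtain ⟨g', rfl, hw'⟩ := hgate' _ _ hw
          rw [hv g' b hw']; exact H _ hw'
    | or =>
      rw [(C i).gateValue_or x h hk, (Circuit.iSup C).gateValue_or x (.inl ⟨i, h⟩) hk]
      constructor
      · rintro ⟨⟨j | g', b⟩, hw, hval⟩
        · exact ⟨_, (hin j b).1 hw, hval⟩
        · obtain ⟨g', rfl, hw'⟩ := hgate' _ _ hw
          rw [hv g' b hw'] at hval; exact ⟨_, hw', hval⟩
      · rintro ⟨⟨j | g', b⟩, hw, hval⟩
        · exact ⟨_, (hin j b).2 hw, hval⟩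
        · rw [← hv g' b hw] at hval; exact ⟨_, hgate g' b hw, hval⟩

theorem Circuit.iSup_eval {n : ℕ} {ι : Type} [Fintype ι] (C : ι → Circuit n 1)
    (x : Fin n → Bool) : (Circuit.iSup C).eval x 0 = true ↔ ∃ i, (C i).eval x 0 = true := by
  change ((Circuit.iSup C).gateValue x (.inr ()) ^^ false) = true ↔ _
  rw [Bool.xor_false, (Circuit.iSup C).gateValue_or x (.inr ()) rfl]
  constructor
  · rintro ⟨⟨j | g', b⟩, hw, hval⟩
    · obtain ⟨i, hi⟩ := hw
      refine ⟨i, ?_⟩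
      simp only [Circuit.eval, hi]
      exact hval
    · obtain ⟨i, g', rfl, hi⟩ := hw
      refine ⟨i, ?_⟩
      change ((Circuit.iSup C).gateValue x (.inl ⟨i, g'⟩) ^^ b) = true at hval
      rw [Circuit.iSup_gateValue] at hval
      simp only [Circuit.eval, hi]
      exact hval
  · rintro ⟨i, hi⟩
    rcases ho : (C i).output 0 with ⟨j | g', b⟩
    · refine ⟨(.inl j, b), ⟨i, ho⟩, ?_⟩
      simp only [Circuit.eval, ho] at hi
      exact hi
    · refine ⟨(.inr (.inl ⟨i, g'⟩), b), ⟨i, g', rfl, ho⟩, ?_⟩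
      simp only [Circuit.eval, ho] at hi
      change ((Circuit.iSup C).gateValue x (.inl ⟨i, g'⟩) ^^ b) = true
      rw [Circuit.iSup_gateValue]
      exact hi

namespace HasCircuit

variable {n d s : ℕ} {f g : (Fin n → Bool) → Prop}

theorem mono (h : HasCircuit n d s f) {d' s' : ℕ} (hd : d ≤ d') (hs : s ≤ s') :
    HasCircuit n d' s' f := by
  obtain ⟨C, h1, h2, h3⟩ := h
  exact ⟨C, h1.trans hd, h2.trans hs, h3⟩

theorem congr (h : HasCircuit n d s f) (hfg : ∀ x, f x ↔ g x) : HasCircuit n d s g := by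
  obtain ⟨C, h1, h2, h3⟩ := h
  exact ⟨C, h1, h2, fun x => (h3 x).trans (hfg x)⟩

theorem not (h : HasCircuit n d s f) : HasCircuit n d s fun x => ¬ f x := by
  obtain ⟨C, h1, h2, h3⟩ := h
  refine ⟨⟨C.Gate, C.kind, C.inputWires, C.gateWires, C.acyclic,
    fun j => ((C.output j).1, !(C.output j).2)⟩, h1, h2, fun x => ?_⟩
  change _ ↔ ¬ f x
  rw [← h3 x]
  have : (⟨C.Gate, C.kind, C.inputWires, C.gateWires, C.acyclic,
    fun j => ((C.output j).1, !(C.output j).2)⟩ : Circuit n 1).eval x 0 = !(C.eval x 0) :=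
    Bool.xor_not _ _
  rw [this]; simp

theorem exists_family {ι : Type} [Fintype ι] {s : ι → ℕ} {f : ι → (Fin n → Bool) → Prop}
    (h : ∀ i, HasCircuit n d (s i) (f i)) :
    HasCircuit n (d + 1) (∑ i, s i + 1) fun x => ∃ i, f i x := by
  choose C h1 h2 h3 using h
  refine ⟨Circuit.iSup C, Circuit.iSup_depth_le C h1, ?_, fun x => ?_⟩
  · have : (Circuit.iSup C).size = ∑ i, (C i).size + 1 := by
      change Fintype.card ((Σ i, (C i).Gate) ⊕ Unit) = _
      rw [Fintype.card_sum, Fintype.card_sigma]; rfl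
    rw [this]
    exact Nat.succ_le_succ (Finset.sum_le_sum fun i _ => h2 i)
  · rw [Circuit.iSup_eval]
    exact exists_congr fun i => h3 i x

theorem forall_family {ι : Type} [Fintype ι] {s : ι → ℕ} {f : ι → (Fin n → Bool) → Prop}
    (h : ∀ i, HasCircuit n d (s i) (f i)) :
    HasCircuit n (d + 1) (∑ i, s i + 1) fun x => ∀ i, f i x :=
  (exists_family fun i => (h i).not).not.congr fun x => by push Not; rfl

theorem or {s' : ℕ} (hf : HasCircuit n d s f) (hg : HasCircuit n d s' g) :
    HasCircuit n (d + 1) (s + s' + 1) fun x => f x ∨ g x := by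
  have := exists_family (ι := Bool) (d := d) (s := fun b => cond b s s')
    (f := fun b => cond b f g) (by rintro (_ | _) <;> assumption)
  simp only [Fintype.sum_bool, cond_true, cond_false] at this
  exact this.congr fun x => by simp [or_comm]

theorem and {s' : ℕ} (hf : HasCircuit n d s f) (hg : HasCircuit n d s' g) :
    HasCircuit n (d + 1) (s + s' + 1) fun x => f x ∧ g x :=
  (hf.not.or hg.not).not.congr fun x => by tauto

theorem literal (i : Fin n) (b : Bool) : HasCircuit n 0 0 fun x => x i = b := by
  refine ⟨⟨Empty, Empty.elim, Empty.elim, Empty.elim, ⟨Empty.rec⟩, fun _ => (.inl i, !b)⟩,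
    ?_, le_rfl, fun x => ?_⟩
  · exact Finset.sup_le fun g _ => g.elim
  · change (x i ^^ !b) = true ↔ x i = b
    cases x i <;> cases b <;> decide

theorem false (n : ℕ) : HasCircuit n 1 1 fun _ => False :=
  (exists_family (ι := Empty) (d := 0) (s := Empty.elim) (f := Empty.elim)
    fun i => i.elim).congr fun x => by simp

/-- A conjunction of conditions on the letters of the input word. -/
theorem conj (n : ℕ) (A : Set (ℕ × Bool)) :
    HasCircuit n 1 1 fun x => ∀ a ∈ A, (List.ofFn x)[a.1]? = some a.2 := by
  classical
  -- A condition on a position outside the word never holds; such a conjunction is the constant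
  -- false, given by an OR without wires.
  by_cases hA : ∀ a ∈ A, a.1 < n
  · have := forall_family (ι := {a : Fin n × Bool // (a.1.val, a.2) ∈ A}) (d := 0)
      (s := fun _ => 0) (f := fun a x => x a.1.1 = a.1.2) fun a => literal _ _
    refine (this.mono le_rfl (by simp)).congr fun x => ?_
    constructor
    · rintro H ⟨p, b⟩ ha
      have hp := hA _ ha
      have := H ⟨(⟨p, hp⟩, b), ha⟩
      simp only at this hp
      simp [hp, this]
    · rintro H ⟨⟨⟨p, hp⟩, b⟩, ha⟩
      simpa [hp] using H _ ha
  · push Not at hA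
    obtain ⟨a, ha, hn⟩ := hA
    refine (false n).congr fun x => ?_
    simp only [false_iff]
    intro H
    have := H a ha
    rw [List.getElem?_eq_none (by simpa using hn)] at this
    simp at this

/-- A disjunction of conjunctions of conditions on the letters of the input word. -/
theorem dnf (n : ℕ) {ι : Type} [Fintype ι] (A : ι → Set (ℕ × Bool)) :
    HasCircuit n 2 (Fintype.card ι + 1)
      fun x => ∃ i, ∀ a ∈ A i, (List.ofFn x)[a.1]? = some a.2 := by
  have := exists_family (fun i => conj n (A i))
  simpa using this

end HasCircuit

/-- The exponent uses `log n + 1` because its powers are at least one and increase with the exponent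
also for very short words. -/
theorem mem_qAC0_of_hasCircuit {L : Language Bool} (d K e : ℕ)
    (h : ∀ n, HasCircuit n d (2 ^ (K * (Nat.log 2 n + 1) ^ e)) fun x => List.ofFn x ∈ L) :
    L ∈ qAC0 := by
  choose C h1 h2 h3 using h
  refine ⟨C, d, e, K * 2 ^ e, fun n => ⟨h1 n, (h2 n).trans
    (Nat.pow_le_pow_right (by omega) ?_)⟩, fun n x => (h3 n x).symm⟩
  have : (Nat.log 2 n + 1) ^ e ≤ 2 ^ e * (Nat.log 2 n ^ e + 1) := by
    rcases Nat.eq_zero_or_pos (Nat.log 2 n) with h0 | h0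
    · rw [h0, zero_add, one_pow]
      exact Nat.one_le_two_pow.trans (Nat.le_mul_of_pos_right _ (Nat.succ_pos _))
    · calc (Nat.log 2 n + 1) ^ e ≤ (2 * Nat.log 2 n) ^ e := Nat.pow_le_pow_left (by omega) _
        _ = 2 ^ e * Nat.log 2 n ^ e := mul_pow _ _ _
        _ ≤ _ := Nat.mul_le_mul_left _ (Nat.le_succ _)
  calc _ ≤ K * (2 ^ e * (Nat.log 2 n ^ e + 1)) := Nat.mul_le_mul_left _ this
    _ = _ := by ring

theorem hasCircuit_of_mem_qAC0 {L : Language Bool} (h : L ∈ qAC0) :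
    ∃ d K e : ℕ, ∀ n, HasCircuit n d (2 ^ (K * (Nat.log 2 n + 1) ^ e))
      fun x => List.ofFn x ∈ L := by
  obtain ⟨C, d, c, k, h1, h2⟩ := h
  refine ⟨d, 2 * k, c, fun n => ⟨C n, (h1 n).1, (h1 n).2.trans
    (Nat.pow_le_pow_right (by omega) ?_), fun x => (h2 n x).symm⟩⟩
  have h3 : Nat.log 2 n ^ c ≤ (Nat.log 2 n + 1) ^ c := Nat.pow_le_pow_left (by omega) _
  have h4 : 1 ≤ (Nat.log 2 n + 1) ^ c := Nat.one_le_pow _ _ (by omega)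
  nlinarith

/-- Treats conjunction and disjunction at once. The summand `2` in the constant pays for `a + b + 1
≤ 4 * a * b`, valid for positive sizes. -/
theorem hasCircuit_merge {d K e d' K' e' : ℕ} {n : ℕ} {f g : (Fin n → Bool) → Prop}
    {o : Prop → Prop → Prop} (ho : ∀ d s s' : ℕ, HasCircuit n d s f → HasCircuit n d s' g →
      HasCircuit n (d + 1) (s + s' + 1) fun x => o (f x) (g x))
    (hf : HasCircuit n d (2 ^ (K * (Nat.log 2 n + 1) ^ e)) f)
    (hg : HasCircuit n d' (2 ^ (K' * (Nat.log 2 n + 1) ^ e')) g) :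
    HasCircuit n (d + d' + 1) (2 ^ ((K + K' + 2) * (Nat.log 2 n + 1) ^ (e + e')))
      fun x => o (f x) (g x) := by
  refine (ho (d + d') _ _ (hf.mono (by omega) le_rfl) (hg.mono (by omega) le_rfl)).mono le_rfl ?_
  have h1 : (Nat.log 2 n + 1) ^ e ≤ (Nat.log 2 n + 1) ^ (e + e') :=
    Nat.pow_le_pow_right (by omega) (by omega)
  have h2 : (Nat.log 2 n + 1) ^ e' ≤ (Nat.log 2 n + 1) ^ (e + e') :=
    Nat.pow_le_pow_right (by omega) (by omega)
  have h0 : 1 ≤ (Nat.log 2 n + 1) ^ (e + e') := Nat.one_le_pow _ _ (by omega)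
  generalize (Nat.log 2 n + 1) ^ (e + e') = Λ at *
  have h3 : 2 ^ (K * (Nat.log 2 n + 1) ^ e) ≤ 2 ^ (K * Λ) := by gcongr; omega
  have h4 : 2 ^ (K' * (Nat.log 2 n + 1) ^ e') ≤ 2 ^ (K' * Λ) := by gcongr; omega
  have h5 : 2 ^ ((K + K' + 2) * Λ) = 2 ^ (K * Λ) * 2 ^ (K' * Λ) * 2 ^ (2 * Λ) := by
    rw [← pow_add, ← pow_add]; ring_nf
  have h6 : 4 ≤ 2 ^ (2 * Λ) := by
    calc 4 = 2 ^ (2 * 1) := by norm_num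
      _ ≤ _ := Nat.pow_le_pow_right (by omega) (by omega)
  have h7 : 1 ≤ 2 ^ (K * Λ) := Nat.one_le_two_pow
  have h8 : 1 ≤ 2 ^ (K' * Λ) := Nat.one_le_two_pow
  rw [h5]
  have h9 : 2 ^ (K * Λ) + 2 ^ (K' * Λ) + 1 ≤ 2 ^ (K * Λ) * 2 ^ (K' * Λ) * 4 := by nlinarith
  have h10 := Nat.mul_le_mul_left (2 ^ (K * Λ) * 2 ^ (K' * Λ)) h6
  omega

theorem inter_mem_qAC0 {L L' : Language Bool} (h : L ∈ qAC0) (h' : L' ∈ qAC0) :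
    {w | w ∈ L ∧ w ∈ L'} ∈ qAC0 := by
  obtain ⟨d, K, e, hL⟩ := hasCircuit_of_mem_qAC0 h
  obtain ⟨d', K', e', hL'⟩ := hasCircuit_of_mem_qAC0 h'
  exact mem_qAC0_of_hasCircuit _ _ _ fun n =>
    hasCircuit_merge (o := And) (fun _ _ _ h h' => h.and h') (hL n) (hL' n)

theorem union_mem_qAC0 {L L' : Language Bool} (h : L ∈ qAC0) (h' : L' ∈ qAC0) :
    {w | w ∈ L ∨ w ∈ L'} ∈ qAC0 := by
  obtain ⟨d, K, e, hL⟩ := hasCircuit_of_mem_qAC0 h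
  obtain ⟨d', K', e', hL'⟩ := hasCircuit_of_mem_qAC0 h'
  exact mem_qAC0_of_hasCircuit _ _ _ fun n =>
    hasCircuit_merge (o := Or) (fun _ _ _ h h' => h.or h') (hL n) (hL' n)

/-- Languages given by certificates, each of which fixes some letters of the word. -/
theorem dnf_mem_qAC0 {ι : ℕ → Type} [∀ n, Fintype (ι n)] (A : ∀ n, ι n → Set (ℕ × Bool))
    (K e : ℕ) (hι : ∀ n, Fintype.card (ι n) ≤ 2 ^ (K * (Nat.log 2 n + 1) ^ e)) :
    {w : List Bool | ∃ i : ι w.length, ∀ a ∈ A _ i, w[a.1]? = some a.2} ∈ qAC0 := by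
  refine mem_qAC0_of_hasCircuit 2 (K + 1) e fun n =>
    ((HasCircuit.dnf n (A n)).mono le_rfl ?_).congr fun x => ?_
  · have h0 : 1 ≤ (Nat.log 2 n + 1) ^ e := Nat.one_le_pow _ _ (by omega)
    calc _ ≤ 2 ^ (K * (Nat.log 2 n + 1) ^ e) + 1 := Nat.succ_le_succ (hι n)
      _ ≤ 2 ^ (K * (Nat.log 2 n + 1) ^ e) * 2 := by
        have : 1 ≤ 2 ^ (K * (Nat.log 2 n + 1) ^ e) := Nat.one_le_two_pow
        omega
      _ = 2 ^ (K * (Nat.log 2 n + 1) ^ e + 1) := (pow_succ _ _).symm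
      _ ≤ _ := Nat.pow_le_pow_right (by omega) (by rw [add_mul]; omega)
  · change _ ↔ ∃ i : ι (List.ofFn x).length, _
    have : (List.ofFn x).length = n := List.length_ofFn
    rw [this]

/-! ## The letters of an encoded instance -/

theorem getElem?_flatMap_of_length {α β : Type} (f : α → List β) (K : ℕ)
    (hf : ∀ a, (f a).length = K) (l : List α) (i b : ℕ) (hb : b < K) :
    (l.flatMap f)[i * K + b]? = l[i]?.bind fun a => (f a)[b]? := by
  induction l generalizing i with
  | nil => simp
  | cons a l ih =>
    rw [List.flatMap_cons]
    cases i with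
    | zero =>
      rw [Nat.zero_mul, Nat.zero_add, List.getElem?_append_left (by rw [hf]; exact hb)]
      simp
    | succ i =>
      rw [List.getElem?_append_right (by rw [hf, Nat.succ_mul]; omega), hf]
      have : (i + 1) * K + b - K = i * K + b := by rw [Nat.succ_mul]; omega
      rw [this, ih]
      simp

theorem length_flatMap_of_length {α β : Type} (f : α → List β) (K : ℕ)
    (hf : ∀ a, (f a).length = K) (l : List α) : (l.flatMap f).length = l.length * K := by
  induction l with
  | nil => simp
  | cons a l ih => rw [List.flatMap_cons, List.length_append, hf, ih, List.length_cons]; ring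

/-- The length of an instance with `N` elements. -/
def instanceLength (N : ℕ) : ℕ := N * N * Nat.clog 2 N + N + Nat.clog 2 N

/-- The length of a valid input therefore determines the number of elements, which is how
certificates and the machine below check a guess of it. -/
theorem instanceLength_strictMono : StrictMono instanceLength := by
  refine strictMono_nat_of_lt_succ fun N => ?_
  have h : Nat.clog 2 N ≤ Nat.clog 2 (N + 1) := Nat.clog_mono_right 2 (Nat.le_succ N)
  have h2 : N * N * Nat.clog 2 N ≤ (N + 1) * (N + 1) * Nat.clog 2 (N + 1) := by gcongr <;> omega
  unfold instanceLength
  omega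

theorem le_instanceLength (N : ℕ) : N ≤ instanceLength N := by
  unfold instanceLength; omega

@[simp] theorem length_encodeElement {N : ℕ} (a : Fin N) :
    (encodeElement a).length = Nat.clog 2 N := List.length_ofFn

theorem getElem?_encodeElement {N : ℕ} (a : Fin N) {b : ℕ} (hb : b < Nat.clog 2 N) :
    (encodeElement a)[b]? = some (a.val.testBit b) := by
  simp [encodeElement, hb]

theorem Fin.eq_of_testBit_eq {N : ℕ} {a a' : Fin N}
    (h : ∀ b < Nat.clog 2 N, a.val.testBit b = a'.val.testBit b) : a = a' := by
  apply Fin.ext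
  have hN := Nat.le_pow_clog (b := 2) (by omega) N
  apply Nat.eq_of_testBit_eq
  intro b
  by_cases hb : b < Nat.clog 2 N
  · exact h b hb
  · have h2 : 2 ^ Nat.clog 2 N ≤ 2 ^ b := Nat.pow_le_pow_right (by omega) (by omega)
    rw [Nat.testBit_lt_two_pow (by omega), Nat.testBit_lt_two_pow (by omega)]

section Letters

variable (S : FinSemigroup) {N : ℕ} (e : S.Carrier ≃ Fin N) (X : Set S.Carrier) (t : S.Carrier)

/-- The part of the encoding that is the Cayley table. -/
def encodeTable : List Bool :=
  (List.finRange N).flatMap fun i => (List.finRange N).flatMap fun j =>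
      encodeElement (e (e.symm i * e.symm j))

theorem length_encodeTable : (encodeTable S e).length = N * N * Nat.clog 2 N := by
  unfold encodeTable
  rw [length_flatMap_of_length _ (N * Nat.clog 2 N), List.length_finRange]
  · ring
  · intro i
    rw [length_flatMap_of_length _ (Nat.clog 2 N), List.length_finRange]
    intro j
    exact length_encodeElement _

open Classical in
theorem encodeInstance_eq : encodeInstance S e X t = encodeTable S e ++
    ((List.finRange N).map (fun i => decide (e.symm i ∈ X)) ++ encodeElement (e t)) :=
  List.append_assoc _ _ _

theorem length_encodeInstance : (encodeInstance S e X t).length = instanceLength N := by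
  simp [encodeInstance_eq, length_encodeTable, instanceLength, add_assoc]

theorem getElem?_encodeInstance_table (i j : Fin N) {b : ℕ} (hb : b < Nat.clog 2 N) :
    (encodeInstance S e X t)[(i.val * N + j) * Nat.clog 2 N + b]? =
      some ((e (e.symm i * e.symm j)).val.testBit b) := by
  have h1 : j.val * Nat.clog 2 N + b < N * Nat.clog 2 N := by
    have := Nat.mul_le_mul_right (Nat.clog 2 N) (Nat.succ_le_of_lt j.2)
    rw [Nat.succ_mul] at this; omega
  have h2 : (i.val * N + j) * Nat.clog 2 N + b =
      i.val * (N * Nat.clog 2 N) + (j.val * Nat.clog 2 N + b) := by ring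
  have h3 : i.val * (N * Nat.clog 2 N) + (j.val * Nat.clog 2 N + b) <
      (encodeTable S e).length := by
    rw [length_encodeTable, mul_assoc]
    have := Nat.mul_le_mul_right (N * Nat.clog 2 N) (Nat.succ_le_of_lt i.2)
    rw [Nat.succ_mul] at this; omega
  rw [encodeInstance_eq, h2, List.getElem?_append_left h3, encodeTable,
    getElem?_flatMap_of_length _ (N * Nat.clog 2 N) _ _ _ _ h1]
  · simp only [List.getElem?_eq_getElem (show i.val < (List.finRange N).length by simp),
      Option.bind_some, List.getElem_finRange]
    rw [getElem?_flatMap_of_length _ (Nat.clog 2 N) (fun _ => length_encodeElement _) _ _ _ hb]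
    simp only [List.getElem?_eq_getElem (show j.val < (List.finRange N).length by simp),
      Option.bind_some, List.getElem_finRange]
    rw [getElem?_encodeElement _ hb]
    rfl
  · intro i
    rw [length_flatMap_of_length _ (Nat.clog 2 N) (fun _ => length_encodeElement _),
      List.length_finRange]

open Classical in
theorem getElem?_encodeInstance_gen (i : Fin N) :
    (encodeInstance S e X t)[N * N * Nat.clog 2 N + i]? = some (decide (e.symm i ∈ X)) := by
  rw [encodeInstance_eq, List.getElem?_append_right (by rw [length_encodeTable]; omega),
    length_encodeTable, Nat.add_sub_cancel_left, List.getElem?_append_left (by simp)]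
  simp

theorem getElem?_encodeInstance_target {b : ℕ} (hb : b < Nat.clog 2 N) :
    (encodeInstance S e X t)[N * N * Nat.clog 2 N + N + b]? = some ((e t).val.testBit b) := by
  rw [encodeInstance_eq, List.getElem?_append_right (by rw [length_encodeTable]; omega),
    length_encodeTable, List.getElem?_append_right (by simp; omega)]
  have : N * N * Nat.clog 2 N + N + b - N * N * Nat.clog 2 N - N = b := by omega
  simp only [List.length_map, List.length_finRange, this]
  exact getElem?_encodeElement _ hb

end Letters

/-- The letters at the given positions are the given ones. -/
def Holds (w : List Bool) (A : Set (ℕ × Bool)) : Prop := ∀ a ∈ A, w[a.1]? = some a.2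

/-- The product of the elements numbered `i` and `j` is the element numbered `k`. -/
def tableAtoms (N i j k : ℕ) : Set (ℕ × Bool) :=
  {a | ∃ b < Nat.clog 2 N, a = ((i * N + j) * Nat.clog 2 N + b, k.testBit b)}

/-- The element numbered `i` is a generator. -/
def genAtoms (N i : ℕ) : Set (ℕ × Bool) := {(N * N * Nat.clog 2 N + i, true)}

/-- The target is the element numbered `k`. -/
def targetAtoms (N k : ℕ) : Set (ℕ × Bool) :=
  {a | ∃ b < Nat.clog 2 N, a = (N * N * Nat.clog 2 N + N + b, k.testBit b)}

section Atoms

variable {S : FinSemigroup} {N : ℕ} {e : S.Carrier ≃ Fin N} {X : Set S.Carrier} {t : S.Carrier}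

theorem holds_tableAtoms {i j k : Fin N} :
    Holds (encodeInstance S e X t) (tableAtoms N i j k) ↔ e (e.symm i * e.symm j) = k := by
  constructor
  · intro h
    apply Fin.eq_of_testBit_eq
    intro b hb
    have := h _ ⟨b, hb, rfl⟩
    rw [getElem?_encodeInstance_table S e X t i j hb] at this
    exact Option.some_injective _ this
  · rintro rfl _ ⟨b, hb, rfl⟩
    exact getElem?_encodeInstance_table S e X t i j hb

theorem holds_genAtoms {i : Fin N} :
    Holds (encodeInstance S e X t) (genAtoms N i) ↔ e.symm i ∈ X := by
  classical
  constructor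
  · intro h
    have := h _ rfl
    rw [getElem?_encodeInstance_gen] at this
    simpa using this
  · rintro h _ rfl
    rw [getElem?_encodeInstance_gen]
    simpa using h

theorem holds_targetAtoms {k : Fin N} :
    Holds (encodeInstance S e X t) (targetAtoms N k) ↔ e t = k := by
  constructor
  · intro h
    apply Fin.eq_of_testBit_eq
    intro b hb
    have := h _ ⟨b, hb, rfl⟩
    rw [getElem?_encodeInstance_target S e X t hb] at this
    exact Option.some_injective _ this
  · rintro rfl _ ⟨b, hb, rfl⟩
    exact getElem?_encodeInstance_target S e X t hb

end Atoms

/-! ## Straight-line programs -/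

/-- The list, read from its end, is a straight-line program over `X`. -/
inductive Computes {S : Type} [Mul S] (X : Set S) : List S → Prop
  | nil : Computes X []
  | gen {x : S} {l : List S} : x ∈ X → Computes X l → Computes X (x :: l)
  | mul {a b : S} {l : List S} : a ∈ l → b ∈ l → Computes X l → Computes X (a * b :: l)

/-- The element is computed by a straight-line program of the given length. -/
def HasProgram {S : Type} [Mul S] (X : Set S) (t : S) (r : ℕ) : Prop :=
  ∃ l, Computes X l ∧ t ∈ l ∧ l.length ≤ r

theorem Computes.map {S T : Type} [Mul S] [Mul T] (f : S →ₙ* T) {X : Set S} {l : List S}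
    (h : Computes X l) : Computes (f '' X) (l.map f) := by
  induction h with
  | nil => exact .nil
  | gen hx _ ih => exact .gen ⟨_, hx, rfl⟩ ih
  | mul ha hb _ ih =>
    rw [List.map_cons, map_mul]
    exact .mul (List.mem_map_of_mem ha) (List.mem_map_of_mem hb) ih

/-- The positional form of a program, needed for certificates. The newest element is at the head, so
operands have larger indices. -/
theorem Computes.justified {S : Type} [Mul S] {X : Set S} {l : List S} (h : Computes X l)
    (k : Fin l.length) : l[k] ∈ X ∨ ∃ i j : Fin l.length, k < i ∧ k < j ∧ l[k] = l[i] * l[j] := by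
  induction h with
  | nil => exact k.elim0
  | gen hx _ ih =>
    refine Fin.cases ?_ (fun k => ?_) k
    · exact .inl hx
    · rcases ih k with h | ⟨i, j, hi, hj, h⟩
      · exact .inl h
      · exact .inr ⟨i.succ, j.succ, Fin.succ_lt_succ_iff.2 hi, Fin.succ_lt_succ_iff.2 hj, h⟩
  | mul ha hb _ ih =>
    refine Fin.cases ?_ (fun k => ?_) k
    · obtain ⟨i, hi⟩ := List.get_of_mem ha
      obtain ⟨j, hj⟩ := List.get_of_mem hb
      refine .inr ⟨i.succ, j.succ, Fin.succ_pos _, Fin.succ_pos _, ?_⟩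
      subst hi; subst hj; rfl
    · rcases ih k with h | ⟨i, j, hi, hj, h⟩
      · exact .inl h
      · exact .inr ⟨i.succ, j.succ, Fin.succ_lt_succ_iff.2 hi, Fin.succ_lt_succ_iff.2 hj, h⟩

/-! ## The certificates of membership -/

/-- The certificates for words of length `n`: a straight-line program of length at most `B`,
given by its elements and by the way they are obtained, and the position of the target. -/
abbrev Certificate (B n : ℕ) : Type :=
  Σ N : Fin (n + 1), Σ r : Fin (B + 1),
    (Fin r → Fin N × Option (Fin r × Fin r)) × Fin r

/-- The positions in a program refer to earlier positions. -/
def Certificate.Valid {B n : ℕ} (c : Certificate B n) : Prop :=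
  instanceLength c.1 = n ∧ ∀ k i j, (c.2.2.1 k).2 = some (i, j) → k < i ∧ k < j

open Classical in
/-- The conditions expressed by a certificate. -/
noncomputable def Certificate.atoms {B n : ℕ} (c : Certificate B n) : Set (ℕ × Bool) :=
  if c.Valid then
    targetAtoms c.1 (c.2.2.1 c.2.2.2).1 ∪ ⋃ k, match (c.2.2.1 k).2 with
      | none => genAtoms c.1 (c.2.2.1 k).1
      | some (i, j) => tableAtoms c.1 (c.2.2.1 i).1 (c.2.2.1 j).1 (c.2.2.1 k).1
  -- Position `n` lies outside a word of length `n`, so an invalid certificate is never satisfied.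
  else {(n, true)}

/-- The words with a certificate. -/
def programLanguage (B : ℕ → ℕ) : Language Bool :=
  {w | ∃ c : Certificate (B w.length) w.length, ∀ a ∈ c.atoms, w[a.1]? = some a.2}

/-- A program of length `r ≤ Q` over at most `2 ^ Q` elements is one of `(N * (r ^ 2 + 1)) ^ r`, so
polylogarithmic `Q` gives quasipolynomially many certificates. -/
theorem card_certificate_le {B n Q : ℕ} (hQ : 1 ≤ Q) (hB : B ≤ Q) (hn : Nat.log 2 n + 1 ≤ Q) :
    Fintype.card (Certificate B n) ≤ 2 ^ (6 * Q ^ 2) := by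
  have hn' : n + 1 ≤ 2 ^ Q :=
    (Nat.lt_pow_succ_log_self (by omega) n).trans_le (Nat.pow_le_pow_right (by omega) hn)
  have hQ' : Q + 1 ≤ 2 ^ Q := Nat.lt_two_pow_self
  have key : ∀ (N : Fin (n + 1)) (r : Fin (B + 1)),
      Fintype.card ((Fin r → Fin N × Option (Fin r × Fin r)) × Fin r) ≤ 2 ^ (3 * Q * Q + Q) := by
    intro N r
    have hr : r.val ≤ Q := by omega
    simp only [Fintype.card_prod, Fintype.card_fun, Fintype.card_fin, Fintype.card_option]
    have h1 : (N : ℕ) * (r * r + 1) ≤ 2 ^ (3 * Q) := by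
      calc (N : ℕ) * (r * r + 1) ≤ 2 ^ Q * ((Q + 1) * (Q + 1)) := by
            gcongr
            · omega
            · nlinarith
        _ ≤ 2 ^ Q * (2 ^ Q * 2 ^ Q) := by gcongr
        _ = _ := by rw [← pow_add, ← pow_add]; ring_nf
    calc ((N : ℕ) * (r * r + 1)) ^ (r : ℕ) * r ≤ (2 ^ (3 * Q)) ^ (r : ℕ) * 2 ^ Q := by
          gcongr; omega
      _ ≤ (2 ^ (3 * Q)) ^ Q * 2 ^ Q :=
          Nat.mul_le_mul_right _ (Nat.pow_le_pow_right (by positivity) hr)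
      _ = _ := by rw [← pow_mul, ← pow_add]
  rw [Fintype.card_sigma]
  simp only [Fintype.card_sigma]
  calc _ ≤ ∑ N : Fin (n + 1), ∑ r : Fin (B + 1), 2 ^ (3 * Q * Q + Q) :=
        Finset.sum_le_sum fun N _ => Finset.sum_le_sum fun r _ => key N r
    _ = (n + 1) * ((B + 1) * 2 ^ (3 * Q * Q + Q)) := by simp
    _ ≤ 2 ^ Q * (2 ^ Q * 2 ^ (3 * Q * Q + Q)) := by gcongr; omega
    _ = 2 ^ (3 * Q * Q + 3 * Q) := by rw [← pow_add, ← pow_add]; ring_nf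
    _ ≤ _ := Nat.pow_le_pow_right (by omega) (by nlinarith)

theorem programLanguage_mem_qAC0 (K e : ℕ) :
    programLanguage (fun n => K * (Nat.log 2 n + 1) ^ e) ∈ qAC0 := by
  refine dnf_mem_qAC0 (ι := fun n => Certificate (K * (Nat.log 2 n + 1) ^ e) n)
    (fun n c => c.atoms) (6 * (K + 1) ^ 2) ((e + 1) * 2) fun n => ?_
  refine (card_certificate_le (Q := (K + 1) * (Nat.log 2 n + 1) ^ (e + 1)) ?_ ?_ ?_).trans
    (le_of_eq ?_)
  · exact Nat.mul_pos (by omega) (Nat.pow_pos (by omega))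
  · exact Nat.mul_le_mul (by omega) (Nat.pow_le_pow_right (by omega) (by omega))
  · calc Nat.log 2 n + 1 = 1 * (Nat.log 2 n + 1) ^ 1 := by ring
      _ ≤ _ := Nat.mul_le_mul (by omega) (Nat.pow_le_pow_right (by omega) (by omega))
  · rw [mul_pow, ← pow_mul, mul_assoc]

section Programs

variable {S : FinSemigroup} {N : ℕ} {e : S.Carrier ≃ Fin N} {X : Set S.Carrier} {t : S.Carrier}

/-- Soundness holds for arbitrary semigroups; only the existence of short programs depends on the
class. The induction runs from the end of the list, where the program starts. -/
theorem mem_closure_of_mem_programLanguage {B : ℕ → ℕ}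
    (h : encodeInstance S e X t ∈ programLanguage B) : t ∈ Subsemigroup.closure X := by
  obtain ⟨⟨⟨M, hM⟩, r, p, z⟩, hc⟩ := h
  by_cases hv : Certificate.Valid (⟨⟨M, hM⟩, r, p, z⟩ :
      Certificate (B (encodeInstance S e X t).length) (encodeInstance S e X t).length)
  swap
  · rw [Certificate.atoms, if_neg hv] at hc
    have := hc _ rfl
    simp at this
  rw [Certificate.atoms, if_pos hv] at hc
  obtain ⟨hlen, hord⟩ := hv
  obtain rfl : M = N :=
    instanceLength_strictMono.injective (hlen.trans (length_encodeInstance S e X t))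
  dsimp only at hc hord p z
  have ht : e t = (p z).1 := holds_targetAtoms.1 fun a ha => hc a (.inl ha)
  have hk : ∀ k, e.symm (p k).1 ∈ Subsemigroup.closure X := by
    intro k
    induction k using WellFoundedGT.induction with
    | _ k ih =>
      have hk := fun a ha => hc a (.inr (Set.mem_iUnion.2 ⟨k, ha⟩))
      rcases hp : (p k).2 with _ | ⟨i, j⟩
      · rw [hp] at hk
        exact Subsemigroup.subset_closure (holds_genAtoms.1 hk)
      · rw [hp] at hk
        have := holds_tableAtoms.1 hk
        rw [← this, Equiv.symm_apply_apply]
        exact mul_mem (ih i (hord k i j hp).1) (ih j (hord k i j hp).2)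
  have := hk z
  rwa [← ht, Equiv.symm_apply_apply] at this

theorem mem_programLanguage_of_hasProgram {B : ℕ → ℕ}
    (h : HasProgram X t (B (instanceLength N))) : encodeInstance S e X t ∈ programLanguage B := by
  obtain ⟨l, hl, ht, hlen⟩ := h
  rw [← length_encodeInstance S e X t] at hlen
  have hN : N < (encodeInstance S e X t).length + 1 := by
    rw [length_encodeInstance]; exact Nat.lt_succ_of_le (le_instanceLength N)
  have hj := hl.justified
  have : ∀ k : Fin l.length, ∃ o : Option (Fin l.length × Fin l.length),
      (o = none → l[k] ∈ X) ∧
        ∀ i j, o = some (i, j) → k < i ∧ k < j ∧ l[k] = l[i] * l[j] := by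
    intro k
    rcases hj k with h | ⟨i, j, h1, h2, h3⟩
    · exact ⟨none, fun _ => h, by simp⟩
    · refine ⟨some (i, j), by simp, ?_⟩
      intro i' j' h
      obtain ⟨rfl, rfl⟩ := Prod.mk.inj (Option.some_injective _ h)
      exact ⟨h1, h2, h3⟩
  choose o ho1 ho2 using this
  obtain ⟨z, hz⟩ := List.get_of_mem ht
  let c : Certificate (B (encodeInstance S e X t).length) (encodeInstance S e X t).length :=
    ⟨⟨N, hN⟩, ⟨l.length, Nat.lt_succ_of_le hlen⟩, fun k => (e l[k], o k), z⟩
  refine ⟨c, ?_⟩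
  have hv : c.Valid :=
    ⟨(length_encodeInstance S e X t).symm, fun k i j h => ⟨(ho2 k i j h).1, (ho2 k i j h).2.1⟩⟩
  rw [Certificate.atoms, if_pos hv]
  rintro a (ha | ha)
  · refine holds_targetAtoms.2 ?_ a ha
    change e t = e (l.get z)
    rw [hz]
  · obtain ⟨k, hk⟩ := Set.mem_iUnion.1 ha
    have ho : (c.2.2.1 k).2 = o k := rfl
    rcases hok : o k with _ | ⟨i, j⟩
    · rw [ho, hok] at hk
      refine holds_genAtoms.2 ?_ a hk
      rw [Equiv.symm_apply_apply]
      exact ho1 k hok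
    · rw [ho, hok] at hk
      refine holds_tableAtoms.2 ?_ a hk
      rw [Equiv.symm_apply_apply, Equiv.symm_apply_apply, ← (ho2 k i j hok).2.2]

end Programs

/-! ## Properties of the Cayley table given by two entries -/

/-- The words whose Cayley table has two entries in the given relation. -/
def tablePairLanguage (Q : ∀ N, Fin N → Fin N → Fin N → Fin N → Fin N → Fin N → Prop) :
    Language Bool :=
  {w | ∃ c : Σ N : Fin (w.length + 1), Fin N × Fin N × Fin N × Fin N × Fin N × Fin N,
    ∀ a ∈ (tableAtoms c.1 c.2.1 c.2.2.1 c.2.2.2.1 ∪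
        tableAtoms c.1 c.2.2.2.2.1 c.2.2.2.2.2.1 c.2.2.2.2.2.2 ∪
        -- An unsatisfiable condition is included exactly when the guessed size or the relation is
        -- wrong.
        {a | a = (w.length, true) ∧ ¬ (instanceLength c.1 = w.length ∧
          Q c.1 c.2.1 c.2.2.1 c.2.2.2.1 c.2.2.2.2.1 c.2.2.2.2.2.1 c.2.2.2.2.2.2)} :
          Set (ℕ × Bool)), w[a.1]? = some a.2}

theorem tablePairLanguage_mem_qAC0
    (Q : ∀ N, Fin N → Fin N → Fin N → Fin N → Fin N → Fin N → Prop) :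
    tablePairLanguage Q ∈ qAC0 := by
  refine dnf_mem_qAC0
    (ι := fun n => Σ N : Fin (n + 1), Fin N × Fin N × Fin N × Fin N × Fin N × Fin N)
    (fun n c => (tableAtoms c.1 c.2.1 c.2.2.1 c.2.2.2.1 ∪
        tableAtoms c.1 c.2.2.2.2.1 c.2.2.2.2.2.1 c.2.2.2.2.2.2 ∪
        {a | a = (n, true) ∧ ¬ (instanceLength c.1 = n ∧
          Q c.1 c.2.1 c.2.2.1 c.2.2.2.1 c.2.2.2.2.1 c.2.2.2.2.2.1 c.2.2.2.2.2.2)} :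
          Set (ℕ × Bool))) 7 1 fun n => ?_
  have hn : n + 1 ≤ 2 ^ (Nat.log 2 n + 1) := Nat.lt_pow_succ_log_self (by omega) n
  rw [Fintype.card_sigma]
  simp only [Fintype.card_prod, Fintype.card_fin]
  calc _ ≤ ∑ N : Fin (n + 1), (n + 1) * ((n + 1) * ((n + 1) * ((n + 1) * ((n + 1) * (n + 1))))) :=
        Finset.sum_le_sum fun N _ => by gcongr <;> omega
    _ = (n + 1) ^ 7 := by simp; ring
    _ ≤ (2 ^ (Nat.log 2 n + 1)) ^ 7 := by gcongr
    _ = _ := by rw [← pow_mul, pow_one, mul_comm]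

theorem mem_tablePairLanguage {S : FinSemigroup} {N : ℕ} {e : S.Carrier ≃ Fin N}
    {X : Set S.Carrier} {t : S.Carrier}
    {Q : ∀ N, Fin N → Fin N → Fin N → Fin N → Fin N → Fin N → Prop} :
    encodeInstance S e X t ∈ tablePairLanguage Q ↔ ∃ a b c d : S.Carrier,
      Q N (e a) (e b) (e (a * b)) (e c) (e d) (e (c * d)) := by
  constructor
  · rintro ⟨⟨⟨M, hM⟩, i, j, k, i', j', k'⟩, hc⟩
    have hv : instanceLength M = (encodeInstance S e X t).length ∧ Q M i j k i' j' k' := by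
      by_contra hv
      have := hc _ (.inr ⟨rfl, hv⟩)
      simp at this
    obtain ⟨hlen, hQ⟩ := hv
    rw [length_encodeInstance] at hlen
    obtain rfl : M = N := instanceLength_strictMono.injective hlen
    have h1 := holds_tableAtoms.1 fun a ha => hc a (.inl (.inl ha))
    have h2 := holds_tableAtoms.1 fun a ha => hc a (.inl (.inr ha))
    refine ⟨e.symm i, e.symm j, e.symm i', e.symm j', ?_⟩
    rw [h1, h2]
    simpa using hQ
  · rintro ⟨a, b, c, d, hQ⟩
    have hN : N < (encodeInstance S e X t).length + 1 := by
      rw [length_encodeInstance]; exact Nat.lt_succ_of_le (le_instanceLength N)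
    refine ⟨⟨⟨N, hN⟩, e a, e b, e (a * b), e c, e d, e (c * d)⟩, ?_⟩
    rintro x ((hx | hx) | ⟨-, hx⟩)
    · exact holds_tableAtoms.2 (by simp) x hx
    · exact holds_tableAtoms.2 (by simp) x hx
    · exact absurd ⟨(length_encodeInstance S e X t).symm, hQ⟩ hx

/-! ## Groups and commutative semigroups -/

/-- In a finite semigroup injective translations are surjective. A solution of `a * e = a` is a left
identity by cancelling `a`, and surjectivity of right translations gives left inverses. -/
theorem mem_groups_of_cancel (S : FinSemigroup) (hl : ∀ a b c : S.Carrier, a * b = a * c → b = c)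
    (hr : ∀ a b c : S.Carrier, b * a = c * a → b = c) : S ∈ groups := by
  have hls : ∀ a : S.Carrier, Function.Surjective fun b => a * b := fun a =>
    Finite.surjective_of_injective fun b c h => hl a b c h
  have hrs : ∀ a : S.Carrier, Function.Surjective fun b => b * a := fun a =>
    Finite.surjective_of_injective fun b c h => hr a b c h
  obtain ⟨a⟩ := S.nonempty
  obtain ⟨e, he⟩ := hls a a
  have he1 : ∀ b, e * b = b := fun b => hl a _ _ (by rw [← mul_assoc]; dsimp only at he; rw [he])
  choose inv hinv using fun b => hrs b e
  let : One S.Carrier := ⟨e⟩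
  let : Inv S.Carrier := ⟨inv⟩
  exact ⟨S.Carrier, Group.ofLeftAxioms mul_assoc he1 hinv, ⟨MulEquiv.refl _⟩⟩

theorem mem_groups_iff (S : FinSemigroup) : S ∈ groups ↔
    (∀ a b c : S.Carrier, a * b = a * c → b = c) ∧
      ∀ a b c : S.Carrier, b * a = c * a → b = c := by
  refine ⟨?_, fun h => mem_groups_of_cancel S h.1 h.2⟩
  rintro ⟨H, _, ⟨f⟩⟩
  refine ⟨fun a b c h => f.injective ?_, fun a b c h => f.injective ?_⟩
  · have := congrArg f h
    rw [map_mul, map_mul] at this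
    exact mul_left_cancel this
  · have := congrArg f h
    rw [map_mul, map_mul] at this
    exact mul_right_cancel this

/-- Cancellation is inherited by subsemigroups of products, where closure under inverses need not be
checked. For quotients the identity and inverses are carried over from the group. -/
theorem isVariety_groups : IsVariety groups where
  subdirect n S hS T _ := by
    refine mem_groups_of_cancel _ (fun a b c h => ?_) fun a b c h => ?_
    · refine Subtype.ext (funext fun i => ((mem_groups_iff _).1 (hS i)).1 (a.1 i) _ _ ?_)
      exact congrFun (congrArg Subtype.val h) i
    · refine Subtype.ext (funext fun i => ((mem_groups_iff _).1 (hS i)).2 (a.1 i) _ _ ?_)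
      exact congrFun (congrArg Subtype.val h) i
  quotient S T hS f hf := by
    obtain ⟨H, _, ⟨g⟩⟩ := hS
    let k : H →ₙ* T.Carrier := f.comp g.symm.toMulHom
    have hk : Function.Surjective k := hf.comp g.symm.surjective
    let : One T.Carrier := ⟨k 1⟩
    let : Inv T.Carrier := ⟨fun b => k (Function.surjInv hk b)⁻¹⟩
    refine ⟨T.Carrier, Group.ofLeftAxioms mul_assoc (fun b => ?_) (fun b => ?_),
      ⟨MulEquiv.refl _⟩⟩
    · change k 1 * b = b
      obtain ⟨b, rfl⟩ := hk b
      rw [← map_mul, one_mul]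
    · change k (Function.surjInv hk b)⁻¹ * b = k 1
      conv_lhs => rw [← Function.surjInv_eq hk b]
      rw [← map_mul, Function.surjInv_eq hk b, inv_mul_cancel]

theorem isVariety_commutative : IsVariety commutative where
  subdirect n S hS T _ := fun a b => Subtype.ext (funext fun i => hS i (a.1 i) (b.1 i))
  quotient S T hS f hf := fun a b => by
    obtain ⟨a, rfl⟩ := hf a
    obtain ⟨b, rfl⟩ := hf b
    rw [← map_mul, ← map_mul, hS]

/-! ## Short straight-line programs -/

theorem HasProgram.mono {S : Type} [Mul S] {X : Set S} {t : S} {r r' : ℕ}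
    (h : HasProgram X t r) (hr : r ≤ r') : HasProgram X t r' := by
  obtain ⟨l, h1, h2, h3⟩ := h
  exact ⟨l, h1, h2, h3.trans hr⟩

/-- Repeated squaring. -/
theorem Computes.exists_pow {M : Type} [Monoid M] {X : Set M} {l : List M} {a : M}
    (h : Computes X l) (ha : a ∈ l) (e : ℕ) (he : 1 ≤ e) :
    ∃ l', Computes X l' ∧ l ⊆ l' ∧ a ^ e ∈ l' ∧ l'.length ≤ l.length + 2 * Nat.log 2 e := by
  induction e using Nat.strong_induction_on with
  | _ e ih =>
    rcases Nat.lt_or_ge e 2 with h2 | h2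
    · obtain rfl : e = 1 := by omega
      exact ⟨l, h, List.Subset.refl _, by rwa [pow_one], by omega⟩
    · obtain ⟨l', h1, h3, h4, h5⟩ := ih (e / 2) (by omega) (by omega)
      have hlog : Nat.log 2 e = Nat.log 2 (e / 2) + 1 := Nat.log_of_one_lt_of_le (by omega) h2
      rcases Nat.even_or_odd' e with ⟨k, rfl | rfl⟩
      · have hk : 2 * k / 2 = k := by omega
        rw [hk] at h4 h5 hlog
        refine ⟨_, .mul h4 h4 h1, fun x hx => List.mem_cons_of_mem _ (h3 hx), ?_, ?_⟩
        · rw [two_mul, pow_add]; exact List.mem_cons_self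
        · rw [List.length_cons]; omega
      · have hk : (2 * k + 1) / 2 = k := by omega
        rw [hk] at h4 h5 hlog
        refine ⟨_, .mul (List.mem_cons_self) (List.mem_cons_of_mem _ (h3 ha)) (.mul h4 h4 h1),
          fun x hx => List.mem_cons_of_mem _ (List.mem_cons_of_mem _ (h3 hx)), ?_, ?_⟩
        · rw [pow_succ, two_mul, pow_add]; exact List.mem_cons_self
        · rw [List.length_cons, List.length_cons]; omega

/-! ### Short programs in groups. -/

section Cube

variable {G : Type} [Group G]

open Classical in
/-- The products of the sublists of a list, read from its end. -/
noncomputable def cube : List G → Finset G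
  | [] => {1}
  | g :: gs => cube gs ∪ (cube gs).image (· * g)

theorem one_mem_cube (gs : List G) : 1 ∈ cube gs := by
  induction gs with
  | nil => exact Finset.mem_singleton_self _
  | cons g gs ih => classical exact Finset.mem_union_left _ ih

theorem mem_cube_cons {g c : G} {gs : List G} :
    c ∈ cube (g :: gs) ↔ c ∈ cube gs ∨ ∃ c' ∈ cube gs, c' * g = c := by
  classical rw [cube, Finset.mem_union, Finset.mem_image]

/-- If `g` is not a quotient of two elements of the cube, the cube and its translate by `g` are
disjoint. -/
theorem card_cube_cons {g : G} {gs : List G}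
    (hg : ∀ c₁ ∈ cube gs, ∀ c₂ ∈ cube gs, g ≠ c₁⁻¹ * c₂) :
    (cube (g :: gs)).card = 2 * (cube gs).card := by
  classical
  rw [cube, Finset.card_union_of_disjoint, Finset.card_image_of_injective _
    (mul_left_injective g), two_mul]
  rw [Finset.disjoint_left]
  intro c hc hc'
  obtain ⟨c', hc₁, rfl⟩ := Finset.mem_image.1 hc'
  exact hg c' hc₁ _ hc (by group)

variable {X : Set G}

/-- An element of the cube is a product of a sublist, so one multiplication per factor suffices. -/
theorem Computes.exists_cube {l gs : List G} (h : Computes X l) (h1 : 1 ∈ l)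
    (hgs : ∀ g ∈ gs, g ∈ l) {c : G} (hc : c ∈ cube gs) :
    ∃ l', Computes X l' ∧ l ⊆ l' ∧ c ∈ l' ∧ l'.length ≤ l.length + gs.length := by
  induction gs generalizing c with
  | nil =>
    obtain rfl := Finset.mem_singleton.1 hc
    exact ⟨l, h, List.Subset.refl _, h1, le_rfl⟩
  | cons g gs ih =>
    have ih' := fun {c} => ih (c := c) fun g hg => hgs g (List.mem_cons_of_mem _ hg)
    rcases mem_cube_cons.1 hc with hc | ⟨c', hc', rfl⟩
    · obtain ⟨l', h2, h3, h4, h5⟩ := ih' hc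
      exact ⟨l', h2, h3, h4, by rw [List.length_cons]; omega⟩
    · obtain ⟨l', h2, h3, h4, h5⟩ := ih' hc'
      exact ⟨_, .mul h4 (h3 (hgs g List.mem_cons_self)) h2,
        fun x hx => List.mem_cons_of_mem _ (h3 hx), List.mem_cons_self,
        by rw [List.length_cons, List.length_cons]; omega⟩

theorem Computes.exists_cube_inv {l gs : List G} (h : Computes X l) (h1 : 1 ∈ l)
    (hgs : ∀ g ∈ gs, g⁻¹ ∈ l) {c : G} (hc : c ∈ cube gs) :
    ∃ l', Computes X l' ∧ l ⊆ l' ∧ c⁻¹ ∈ l' ∧ l'.length ≤ l.length + gs.length := by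
  induction gs generalizing c with
  | nil =>
    obtain rfl := Finset.mem_singleton.1 hc
    exact ⟨l, h, List.Subset.refl _, by rwa [inv_one], le_rfl⟩
  | cons g gs ih =>
    have ih' := fun {c} => ih (c := c) fun g hg => hgs g (List.mem_cons_of_mem _ hg)
    rcases mem_cube_cons.1 hc with hc | ⟨c', hc', rfl⟩
    · obtain ⟨l', h2, h3, h4, h5⟩ := ih' hc
      exact ⟨l', h2, h3, h4, by rw [List.length_cons]; omega⟩
    · obtain ⟨l', h2, h3, h4, h5⟩ := ih' hc'
      refine ⟨_, .mul (h3 (hgs g List.mem_cons_self)) h4 h2,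
        fun x hx => List.mem_cons_of_mem _ (h3 hx), ?_,
        by rw [List.length_cons, List.length_cons]; omega⟩
      rw [mul_inv_rev]; exact List.mem_cons_self

theorem Computes.exists_cube_div {l gs : List G} (h : Computes X l) (h1 : 1 ∈ l)
    (hgs : ∀ g ∈ gs, g ∈ l ∧ g⁻¹ ∈ l) {c₁ c₂ : G} (hc₁ : c₁ ∈ cube gs) (hc₂ : c₂ ∈ cube gs) :
    ∃ l', Computes X l' ∧ l ⊆ l' ∧ c₁⁻¹ * c₂ ∈ l' ∧
      l'.length ≤ l.length + (2 * gs.length + 1) := by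
  obtain ⟨l', h2, h3, h4, h5⟩ := h.exists_cube_inv h1 (fun g hg => (hgs g hg).2) hc₁
  obtain ⟨l'', h2', h3', h4', h5'⟩ := h2.exists_cube (h3 h1) (fun g hg => h3 (hgs g hg).1) hc₂
  exact ⟨_, .mul (h3' h4) h4' h2', fun x hx => List.mem_cons_of_mem _ (h3' (h3 hx)),
    List.mem_cons_self, by rw [List.length_cons]; omega⟩

variable [Finite G]

/-- Programs have no inversion, so inverses are computed as powers. The exponent `2 * |G| - 1`,
instead of `|G| - 1`, is positive also in the trivial group. -/
theorem inv_eq_pow_card (g : G) : g⁻¹ = g ^ (2 * Nat.card G - 1) := by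
  have hpos : 0 < Nat.card G := Nat.card_pos
  rw [inv_eq_iff_mul_eq_one, ← pow_succ', show 2 * Nat.card G - 1 + 1 = Nat.card G * 2 by omega,
    pow_mul, pow_card_eq_one', one_pow]

/-- The reachability lemma of Babai and Szemerédi: the cube can be doubled until its quotients are
the whole subgroup. -/
theorem exists_cube_of_not {k L : ℕ} (hk : k ≤ Nat.log 2 (Nat.card G)) {l gs : List G}
    (h : Computes X l) (h1 : 1 ∈ l) (hgs : ∀ g ∈ gs, g ∈ l ∧ g⁻¹ ∈ l)
    (hcard : (cube gs).card = 2 ^ k) (hlen : gs.length = k) (hL : l.length ≤ L)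
    (hnot : ¬ ∀ t ∈ Subsemigroup.closure X, ∃ c₁ ∈ cube gs, ∃ c₂ ∈ cube gs, t = c₁⁻¹ * c₂) :
    ∃ l' gs' : List G, Computes X l' ∧ 1 ∈ l' ∧ (∀ g ∈ gs', g ∈ l' ∧ g⁻¹ ∈ l') ∧
      (cube gs').card = 2 ^ (k + 1) ∧ gs'.length = k + 1 ∧
      l'.length ≤ L + (4 * Nat.log 2 (Nat.card G) + 5) := by
  -- The quotients contain the identity. If they were closed under right multiplication by
  -- generators, they would contain everything generated; hence some `y * x` leaves them, and this
  -- element doubles the cube.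
  obtain ⟨y, x, hx, ⟨c₁, hc₁, c₂, hc₂, rfl⟩, hy⟩ : ∃ y, ∃ x ∈ X,
      (∃ c₁ ∈ cube gs, ∃ c₂ ∈ cube gs, y = c₁⁻¹ * c₂) ∧
      ¬ ∃ c₁ ∈ cube gs, ∃ c₂ ∈ cube gs, y * x = c₁⁻¹ * c₂ := by
    by_contra! H
    apply hnot
    intro t ht
    have ht' : t ∈ Submonoid.closure X := by
      have : Subsemigroup.closure X ≤ (Submonoid.closure X).toSubsemigroup :=
        Subsemigroup.closure_le.2 Submonoid.subset_closure
      exact this ht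
    clear ht
    induction ht' using Submonoid.closure_induction_right with
    | one => exact ⟨1, one_mem_cube _, 1, one_mem_cube _, by simp⟩
    | mul_right y _ x hx ih =>
      exact H y x hx ih
  obtain ⟨l', h2, h3, h4, h5⟩ := h.exists_cube_div h1 hgs hc₁ hc₂
  set g := c₁⁻¹ * c₂ * x with hg
  have h6 : Computes X (g :: x :: l') :=
    .mul (List.mem_cons_of_mem _ h4) List.mem_cons_self (.gen hx h2)
  obtain ⟨l'', h7, h8, h9, h10⟩ := h6.exists_pow List.mem_cons_self (2 * Nat.card G - 1)
    (by have : 0 < Nat.card G := Nat.card_pos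
        omega)
  rw [← inv_eq_pow_card] at h9
  have hsub : l ⊆ l'' := fun z hz =>
    h8 (List.mem_cons_of_mem _ (List.mem_cons_of_mem _ (h3 hz)))
  refine ⟨l'', g :: gs, h7, hsub h1, ?_, ?_, by rw [List.length_cons, hlen], ?_⟩
  · intro g' hg'
    rcases List.mem_cons.1 hg' with rfl | hg'
    · exact ⟨h8 List.mem_cons_self, h9⟩
    · exact ⟨hsub (hgs g' hg').1, hsub (hgs g' hg').2⟩
  · rw [card_cube_cons, hcard, pow_succ, mul_comm]
    intro d₁ hd₁ d₂ hd₂ hd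
    exact hy ⟨d₁, hd₁, d₂, hd₂, hd⟩
  -- The cost is `2k + 1` for `y`, two for `x` and `y * x`, and `2 log |G| + 2` for the inverse,
  -- which is at most `4 log |G| + 5`.
  · have h11 : Nat.log 2 (2 * Nat.card G - 1) ≤ Nat.log 2 (Nat.card G) + 1 := by
      calc _ ≤ Nat.log 2 (Nat.card G * 2) := Nat.log_mono_right (by omega)
        _ = _ := Nat.log_mul_base (by omega) Nat.card_pos.ne'
    simp only [List.length_cons] at h10
    omega

/-- A cube of `2 ^ k` elements fits into the group only for `k ≤ log |G|`, so the doubling stops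
within that many rounds, and then every generated element is a quotient of two cube elements. -/
theorem hasProgram_of_group {t : G} (ht : t ∈ Subsemigroup.closure X) :
    HasProgram X t (15 * (Nat.log 2 (Nat.card G) + 1) ^ 2) := by
  classical
  set s := Nat.log 2 (Nat.card G) with hs
  have hpos : 0 < Nat.card G := Nat.card_pos
  obtain ⟨x, hx⟩ : X.Nonempty := by
    rw [Set.nonempty_iff_ne_empty]
    rintro rfl
    rw [Subsemigroup.closure_empty] at ht
    exact ht
  -- The identity is obtained as the power `|G|` of any generator.
  obtain ⟨l₀, h0, -, h1, h0l⟩ := (Computes.gen hx .nil).exists_pow List.mem_cons_self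
    (Nat.card G) hpos
  rw [pow_card_eq_one'] at h1
  have key : ∀ k ≤ s + 1, (∃ l gs : List G, Computes X l ∧ 1 ∈ l ∧
      (∀ g ∈ gs, g ∈ l ∧ g⁻¹ ∈ l) ∧ (cube gs).card = 2 ^ k ∧ gs.length = k ∧
      l.length ≤ (1 + 2 * s) + k * (4 * s + 5)) ∨
      HasProgram X t (15 * (s + 1) ^ 2) := by
    intro k
    induction k with
    | zero =>
      intro _
      refine .inl ⟨l₀, [], h0, h1, by simp, by simp [cube], rfl, ?_⟩
      simpa using h0l
    | succ k ih =>
      intro hk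
      rcases ih (by omega) with ⟨l, gs, h2, h3, h4, h5, h6, h7⟩ | h
      · by_cases hnot : ∀ t ∈ Subsemigroup.closure X,
            ∃ c₁ ∈ cube gs, ∃ c₂ ∈ cube gs, t = c₁⁻¹ * c₂
        · right
          obtain ⟨c₁, hc₁, c₂, hc₂, rfl⟩ := hnot t ht
          obtain ⟨l', g1, g2, g3, g4⟩ := h2.exists_cube_div h3 h4 hc₁ hc₂
          refine ⟨l', g1, g3, ?_⟩
          have : k * (4 * s + 5) ≤ s * (4 * s + 5) := Nat.mul_le_mul_right _ (by omega)
          nlinarith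
        · left
          obtain ⟨l', gs', g1, g2, g3, g4, g5, g6⟩ :=
            exists_cube_of_not (by omega) h2 h3 h4 h5 h6 h7 hnot
          exact ⟨l', gs', g1, g2, g3, g4, g5, g6.trans (le_of_eq (by ring))⟩
      · exact .inr h
  rcases key (s + 1) le_rfl with ⟨l, gs, h2, h3, h4, h5, h6, h7⟩ | h
  · exfalso
    have : Fintype G := Fintype.ofFinite G
    have h8 : (cube gs).card ≤ Nat.card G := by
      rw [Nat.card_eq_fintype_card]; exact Finset.card_le_univ _
    have h9 : Nat.card G < 2 ^ (s + 1) := Nat.lt_pow_succ_log_self (by omega) _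
    omega
  · exact h

end Cube

/-! ### Short programs in commutative semigroups. -/

section Commutative

variable {M : Type} [CommMonoid M] [Finite M]

omit [Finite M] in
theorem exists_prod_pow_of_mem_closure {X : Set M} {t : M} (ht : t ∈ Submonoid.closure X) :
    ∃ (F : Finset M) (e : M → ℕ), ↑F ⊆ X ∧ t = ∏ x ∈ F, x ^ e x := by
  classical
  obtain ⟨m, hm, rfl⟩ := Submonoid.exists_multiset_of_mem_closure ht
  refine ⟨m.toFinset, fun x => m.count x, fun x hx => hm x (by simpa using hx), ?_⟩
  exact Finset.prod_multiset_count m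

/-- Every element of a finitely generated commutative monoid is a product of powers of
logarithmically many generators. -/
theorem exists_short_prod_pow {X : Set M} {t : M} (ht : t ∈ Submonoid.closure X) :
    ∃ (F : Finset M) (e : M → ℕ), ↑F ⊆ X ∧ t = ∏ x ∈ F, x ^ e x ∧
      F.card ≤ Nat.log 2 (Nat.card M) := by
  classical
  let P : ℕ → Prop := fun k => ∃ (F : Finset M) (e : M → ℕ), ↑F ⊆ X ∧ t = ∏ x ∈ F, x ^ e x ∧
    F.card = k
  have hP : ∃ k, P k := by
    obtain ⟨F, e, h1, h2⟩ := exists_prod_pow_of_mem_closure ht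
    exact ⟨_, F, e, h1, h2, rfl⟩
  obtain ⟨k, ⟨F, e, h1, h2, h3⟩, hmin⟩ : ∃ k, P k ∧ ∀ m < k, ¬ P m :=
    ⟨Nat.find hP, Nat.find_spec hP, fun m h => Nat.find_min hP h⟩
  refine ⟨F, e, h1, h2, ?_⟩
  by_contra! hlt
  have : Fintype M := Fintype.ofFinite M
  have hc : Fintype.card M < F.powerset.card := by
    rw [Finset.card_powerset, ← Nat.card_eq_fintype_card]
    exact Nat.lt_pow_of_log_lt (by omega) hlt
  rw [← Finset.card_univ] at hc
  -- With more than `log |M|` factors there are more subsets than elements, so two different subsets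
  -- have the same partial product.
  obtain ⟨A, hA, B, hB, hne, heq⟩ := Finset.exists_ne_map_eq_of_card_lt_of_maps_to
    (f := fun A => ∏ x ∈ A, x ^ e x) hc (fun _ _ => Finset.mem_univ _)
  have key : ∀ A B : Finset M, A ⊆ F → B ⊆ F → (∏ x ∈ A, x ^ e x) = ∏ x ∈ B, x ^ e x →
      ¬ ∃ i ∈ B, i ∉ A := by
    rintro A B hA hB heq ⟨i, hiB, hiA⟩
    -- The partial product over `B` is replaced by the one over `A`; exponents double where `A`
    -- meets the rest. The generator `i` is no longer needed, contradicting minimality.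
    have h4 : t = ∏ x ∈ A ∪ (F \ B),
        x ^ ((if x ∈ A then e x else 0) + if x ∈ F \ B then e x else 0) := by
      simp_rw [pow_add, Finset.prod_mul_distrib]
      have h5 : ∀ C ⊆ A ∪ (F \ B), (∏ x ∈ A ∪ (F \ B), x ^ (if x ∈ C then e x else 0)) =
          ∏ x ∈ C, x ^ e x := by
        intro C hC
        rw [← Finset.prod_subset hC]
        · exact Finset.prod_congr rfl fun x hx => by rw [if_pos hx]
        · intro x _ hx; rw [if_neg hx, pow_zero]
      rw [h5 A Finset.subset_union_left, h5 _ Finset.subset_union_right, heq, h2, mul_comm,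
        Finset.prod_sdiff hB]
    have h5 : A ∪ (F \ B) ⊂ F := by
      refine (Finset.ssubset_iff_of_subset (Finset.union_subset hA Finset.sdiff_subset)).2
        ⟨i, hB hiB, ?_⟩
      simp [hiA, hiB]
    have h6 := Finset.card_lt_card h5
    rw [h3] at h6
    exact hmin _ h6 ⟨_, _, fun x hx => h1 (h5.1 hx), h4, rfl⟩
  rw [Finset.mem_powerset] at hA hB
  apply hne
  apply Finset.Subset.antisymm
  · intro i hi
    by_contra hn
    exact key B A hB hA heq.symm ⟨i, hi, hn⟩
  · intro i hi
    by_contra hn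
    exact key A B hA hB heq ⟨i, hi, hn⟩

/-- A minimal exponent has pairwise different smaller powers, since a repetition could be cut out.
This makes the exponents small enough for repeated squaring. -/
theorem exists_pow_eq_lt_card {M : Type} [Monoid M] [Finite M] (a : M) (e : ℕ) :
    ∃ e', a ^ e' = a ^ e ∧ e' < Nat.card M := by
  classical
  have hP : ∃ e', a ^ e' = a ^ e := ⟨e, rfl⟩
  refine ⟨Nat.find hP, Nat.find_spec hP, ?_⟩
  by_contra! hle
  have : Fintype M := Fintype.ofFinite M
  have hc : (Finset.univ : Finset M).card < (Finset.range (Nat.find hP + 1)).card := by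
    rw [Finset.card_range, Finset.card_univ, ← Nat.card_eq_fintype_card]; omega
  obtain ⟨i, hi, j, hj, hne, heq⟩ := Finset.exists_ne_map_eq_of_card_lt_of_maps_to
    (f := fun i => a ^ i) hc (fun _ _ => Finset.mem_univ _)
  rw [Finset.mem_range] at hi hj
  have key : ∀ i j, i < j → j ≤ Nat.find hP → a ^ i = a ^ j → False := by
    intro i j hij hj heq
    refine Nat.find_min hP (m := i + (Nat.find hP - j)) (by omega) ?_
    rw [pow_add, heq, ← pow_add, show j + (Nat.find hP - j) = Nat.find hP by omega]
    exact Nat.find_spec hP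
  rcases Nat.lt_or_gt_of_ne hne with h | h
  · exact key i j h (by omega) heq
  · exact key j i h (by omega) heq.symm

theorem Computes.exists_prod_pow {X : Set M} (h1 : 1 ∈ X) (F : Finset M) (hF : ↑F ⊆ X)
    (e : M → ℕ) : ∃ l, Computes X l ∧ 1 ∈ l ∧ ∏ x ∈ F, x ^ e x ∈ l ∧
      l.length ≤ 1 + F.card * (2 + 2 * Nat.log 2 (Nat.card M)) := by
  classical
  induction F using Finset.induction_on with
  | empty => exact ⟨[1], .gen h1 .nil, by simp, by simp, by simp⟩
  | insert a F ha ih =>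
    obtain ⟨l, h2, h3, h4, h5⟩ := ih fun x hx => hF (Finset.mem_insert_of_mem hx)
    rw [Finset.prod_insert ha, Finset.card_insert_of_notMem ha]
    obtain ⟨e', he', hlt⟩ := exists_pow_eq_lt_card a (e a)
    -- Repeated squaring needs a positive exponent; a factor with exponent zero is omitted.
    rcases Nat.eq_zero_or_pos e' with rfl | hpos
    · refine ⟨l, h2, h3, ?_, h5.trans (by gcongr; omega)⟩
      rw [← he', pow_zero, one_mul]; exact h4
    · obtain ⟨l', g1, g2, g3, g4⟩ := (Computes.gen (hF (Finset.mem_insert_self _ _)) h2).exists_pow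
        List.mem_cons_self e' hpos
      have hsub : l ⊆ l' := fun x hx => g2 (List.mem_cons_of_mem _ hx)
      rw [← he']
      refine ⟨_, .mul g3 (hsub h4) g1, List.mem_cons_of_mem _ (hsub h3), List.mem_cons_self, ?_⟩
      have hlog : Nat.log 2 e' ≤ Nat.log 2 (Nat.card M) := Nat.log_mono_right hlt.le
      rw [List.length_cons] at g4 ⊢
      rw [Nat.succ_mul]
      omega

end Commutative

/-- A program with an additional identity element computes the same elements without it. -/
theorem Computes.of_withOne {S : Type} [Semigroup S] {X : Set S} {l : List (WithOne S)}
    (h : Computes (insert 1 ((↑) '' X)) l) :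
    ∃ l' : List S, Computes X l' ∧ (∀ a : S, (a : WithOne S) ∈ l → a ∈ l') ∧
      l'.length ≤ l.length := by
  induction h with
  | nil => exact ⟨[], .nil, by simp, le_rfl⟩
  | gen hx _ ih =>
    obtain ⟨l', h1, h2, h3⟩ := ih
    rcases hx with rfl | ⟨x, hx, rfl⟩
    · refine ⟨l', h1, fun a ha => ?_, by rw [List.length_cons]; omega⟩
      rcases List.mem_cons.1 ha with ha | ha
      · exact absurd ha WithOne.coe_ne_one
      · exact h2 a ha
    · refine ⟨_, .gen hx h1, fun a ha => ?_, by rw [List.length_cons, List.length_cons]; omega⟩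
      rcases List.mem_cons.1 ha with ha | ha
      · rw [WithOne.coe_inj.1 ha]; exact List.mem_cons_self
      · exact List.mem_cons_of_mem _ (h2 a ha)
  | @mul b c l hb hc _ ih =>
    obtain ⟨l', h1, h2, h3⟩ := ih
    have skip : b * c ∈ l → ∃ l' : List S, Computes X l' ∧
        (∀ a : S, (a : WithOne S) ∈ b * c :: l → a ∈ l') ∧ l'.length ≤ (b * c :: l).length := by
      intro hm
      refine ⟨l', h1, fun a ha => ?_, by rw [List.length_cons]; omega⟩
      rcases List.mem_cons.1 ha with ha | ha
      · rw [← ha] at hm; exact h2 a hm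
      · exact h2 a ha
    induction b using WithOne.recOneCoe with
    | one => exact skip (by rwa [one_mul])
    | coe b =>
      induction c using WithOne.recOneCoe with
      | one => exact skip (by rwa [mul_one])
      | coe c =>
        refine ⟨_, .mul (h2 b hb) (h2 c hc) h1, fun a ha => ?_,
          by rw [List.length_cons, List.length_cons]; omega⟩
        rcases List.mem_cons.1 ha with ha | ha
        · rw [← WithOne.coe_mul] at ha
          rw [WithOne.coe_inj.1 ha]; exact List.mem_cons_self
        · exact List.mem_cons_of_mem _ (h2 a ha)

/-- The argument on partial products needs empty products, so an identity is adjoined; afterwards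
all uses of it are deleted from the program. -/
theorem hasProgram_of_commSemigroup {S : Type} [CommSemigroup S] [Finite S] {X : Set S} {t : S}
    (ht : t ∈ Subsemigroup.closure X) :
    HasProgram X t (15 * (Nat.log 2 (Nat.card S) + 1) ^ 2) := by
  have : Finite (WithOne S) := inferInstanceAs (Finite (Option S))
  have hcard : Nat.card (WithOne S) = Nat.card S + 1 := Finite.card_option
  have ht' : (t : WithOne S) ∈ Submonoid.closure ((↑) '' X : Set (WithOne S)) := by
    induction ht using Subsemigroup.closure_induction with
    | mem x hx => exact Submonoid.subset_closure ⟨x, hx, rfl⟩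
    | mul x y _ _ hx hy => rw [WithOne.coe_mul]; exact mul_mem hx hy
  obtain ⟨F, e, h1, h2, h3⟩ := exists_short_prod_pow ht'
  obtain ⟨l, h4, -, h5, h6⟩ := Computes.exists_prod_pow (Set.mem_insert 1 _) F
    (h1.trans (Set.subset_insert _ _)) e
  obtain ⟨l', h7, h8, h9⟩ := h4.of_withOne
  refine ⟨l', h7, h8 t (by rw [h2]; exact h5), h9.trans (h6.trans ?_)⟩
  have hpos : 0 < Nat.card S := by
    have : Nonempty S := ⟨t⟩
    exact Nat.card_pos
  have hlog : Nat.log 2 (Nat.card (WithOne S)) ≤ Nat.log 2 (Nat.card S) + 1 := by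
    rw [hcard]
    calc _ ≤ Nat.log 2 (Nat.card S * 2) := Nat.log_mono_right (by omega)
      _ = _ := Nat.log_mul_base (by omega) hpos.ne'
  generalize Nat.log 2 (Nat.card (WithOne S)) = s' at *
  generalize Nat.log 2 (Nat.card S) = s at *
  calc 1 + F.card * (2 + 2 * s') ≤ 1 + (s + 1) * (2 + 2 * (s + 1)) := by gcongr; omega
    _ ≤ _ := by nlinarith

/-! ## Membership in `qAC⁰` -/

theorem hasProgram_of_mem_groups {S : FinSemigroup} (hS : S ∈ groups) {X : Set S.Carrier}
    {t : S.Carrier} (ht : t ∈ Subsemigroup.closure X) :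
    HasProgram X t (15 * (Nat.log 2 (Nat.card S.Carrier) + 1) ^ 2) := by
  obtain ⟨H, _, ⟨f⟩⟩ := hS
  have : Finite H := Finite.of_equiv _ f.toEquiv
  have ht' : f t ∈ Subsemigroup.closure (f '' X) := by
    have := Subsemigroup.mem_map_of_mem f.toMulHom ht
    rwa [MulHom.map_mclosure] at this
  obtain ⟨l, h1, h2, h3⟩ := hasProgram_of_group ht'
  rw [← Nat.card_congr f.toEquiv] at h3
  have h4 := h1.map f.symm.toMulHom
  have h5 : f.symm.toMulHom '' (f '' X) = X := by
    change f.symm '' (f '' X) = X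
    rw [Set.image_image]; simp
  rw [h5] at h4
  refine ⟨_, h4, ?_, by rwa [List.length_map]⟩
  have := List.mem_map_of_mem (f := f.symm) h2
  rwa [MulEquiv.symm_apply_apply] at this

theorem hasProgram_of_mem_commutative {S : FinSemigroup} (hS : S ∈ commutative)
    {X : Set S.Carrier} {t : S.Carrier} (ht : t ∈ Subsemigroup.closure X) :
    HasProgram X t (15 * (Nat.log 2 (Nat.card S.Carrier) + 1) ^ 2) :=
  letI : CommSemigroup S.Carrier := { S.semigroup with mul_comm := hS }
  hasProgram_of_commSemigroup ht

/-- The words with a certificate of polylogarithmic length. -/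
def shortProgramLanguage : Language Bool := programLanguage fun n => 15 * (Nat.log 2 n + 1) ^ 2

theorem mem_shortProgramLanguage_iff {S : FinSemigroup} (hS : S ∈ groups ∨ S ∈ commutative)
    {N : ℕ} {e : S.Carrier ≃ Fin N} {X : Set S.Carrier} {t : S.Carrier} :
    encodeInstance S e X t ∈ shortProgramLanguage ↔ t ∈ Subsemigroup.closure X := by
  refine ⟨mem_closure_of_mem_programLanguage, fun ht => mem_programLanguage_of_hasProgram ?_⟩
  have hcard : Nat.card S.Carrier = N := by rw [Nat.card_congr e, Nat.card_fin]
  have h : HasProgram X t (15 * (Nat.log 2 (Nat.card S.Carrier) + 1) ^ 2) :=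
    hS.elim (fun h => hasProgram_of_mem_groups h ht) fun h => hasProgram_of_mem_commutative h ht
  refine h.mono ?_
  rw [hcard]
  have := Nat.log_mono_right (b := 2) (le_instanceLength N)
  gcongr

theorem memClass_qAC0_of_subset {V : Set FinSemigroup} (hV : V ⊆ groups ∪ commutative) :
    (CSM V).MemClass qAC0 := by
  refine ⟨shortProgramLanguage, programLanguage_mem_qAC0 15 2, ?_, ?_⟩
  · rintro _ ⟨S, hS, N, e, X, t, rfl, ht⟩
    exact (mem_shortProgramLanguage_iff (hV hS)).2 ht
  · rintro _ ⟨S, hS, N, e, X, t, rfl, ht⟩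
    exact mt (mem_shortProgramLanguage_iff (hV hS)).1 ht

/-- Classes with a problem in `qAC⁰` can be enlarged by the groups or by the commutative
semigroups, as these are recognised by means of two entries of the Cayley table. -/
theorem memClass_qAC0_union {U V : Set FinSemigroup} (hU : (CSM U).MemClass qAC0)
    (hV : V ⊆ groups ∪ commutative)
    (Q : ∀ N, Fin N → Fin N → Fin N → Fin N → Fin N → Fin N → Prop)
    (hQ : ∀ (S : FinSemigroup) (N : ℕ) (e : S.Carrier ≃ Fin N), S ∉ V ↔ ∃ a b c d : S.Carrier,
      Q N (e a) (e b) (e (a * b)) (e c) (e d) (e (c * d))) :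
    (CSM (U ∪ V)).MemClass qAC0 := by
  obtain ⟨L, hL, hyes, hno⟩ := hU
  -- Outside `V` the given language decides; inside `V` short programs do. The second alternative
  -- may be tried on all inputs, because programs are always sound.
  refine ⟨_, union_mem_qAC0 (inter_mem_qAC0 (tablePairLanguage_mem_qAC0 Q) hL)
    (programLanguage_mem_qAC0 15 2), ?_, ?_⟩
  · rintro _ ⟨S, hS, N, e, X, t, rfl, ht⟩
    by_cases hSV : S ∈ V
    · exact .inr ((mem_shortProgramLanguage_iff (hV hSV)).2 ht)
    · exact .inl ⟨mem_tablePairLanguage.2 ((hQ S N e).1 hSV),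
        hyes _ ⟨S, hS.resolve_right hSV, N, e, X, t, rfl, ht⟩⟩
  · rintro _ ⟨S, hS, N, e, X, t, rfl, ht⟩ (⟨h1, h2⟩ | h)
    · have hSV := (hQ S N e).2 (mem_tablePairLanguage.1 h1)
      exact hno _ ⟨S, hS.resolve_right hSV, N, e, X, t, rfl, ht⟩ h2
    · exact ht (mem_closure_of_mem_programLanguage h)

theorem memClass_qAC0_union_commutative {U : Set FinSemigroup} (hU : (CSM U).MemClass qAC0) :
    (CSM (U ∪ commutative)).MemClass qAC0 := by
  refine memClass_qAC0_union hU Set.subset_union_right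
    (fun N i j k i' j' k' => i' = j ∧ j' = i ∧ k ≠ k') fun S N e => ?_
  constructor
  · intro h
    have h' : ¬ ∀ a b : S.Carrier, a * b = b * a := h
    push Not at h'
    obtain ⟨a, b, hab⟩ := h'
    exact ⟨a, b, b, a, rfl, rfl, fun h => hab (e.injective h)⟩
  · rintro ⟨a, b, c, d, h1, h2, h3⟩ h
    obtain rfl := e.injective h1
    obtain rfl := e.injective h2
    exact h3 (congrArg e (h d c))

theorem memClass_qAC0_union_groups {U : Set FinSemigroup} (hU : (CSM U).MemClass qAC0) :
    (CSM (U ∪ groups)).MemClass qAC0 := by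
  refine memClass_qAC0_union hU Set.subset_union_left
    -- A failure of left or right cancellation: two equal entries in one row or in one column.
    (fun N i j k i' j' k' => ((i' = i ∧ j' ≠ j) ∨ (j' = j ∧ i' ≠ i)) ∧ k = k') fun S N e => ?_
  rw [mem_groups_iff, not_and_or]
  constructor
  · rintro (h | h)
    · push Not at h
      obtain ⟨a, b, c, h, hne⟩ := h
      exact ⟨a, b, a, c, .inl ⟨rfl, fun h => hne (e.injective h).symm⟩, congrArg e h⟩
    · push Not at h
      obtain ⟨a, b, c, h, hne⟩ := h
      exact ⟨b, a, c, a, .inr ⟨rfl, fun h => hne (e.injective h).symm⟩, congrArg e h⟩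
  · rintro ⟨a, b, c, d, h, h3⟩
    have h4 := e.injective h3
    rcases h with ⟨h1, h2⟩ | ⟨h1, h2⟩
    · obtain rfl := e.injective h1
      exact .inl fun h => h2 (congrArg e (h _ _ _ h4).symm)
    · obtain rfl := e.injective h1
      exact .inr fun h => h2 (congrArg e (h _ _ _ h4).symm)

/-! ## Path semigroups -/

/-- Passage from the indexed product in the definition to a binary one: the preimage of `T` is a
subsemigroup of the former and maps onto `T`. -/
theorem IsVariety.prod {U : Set FinSemigroup} (hU : IsVariety U) {A B : FinSemigroup}
    (hA : A ∈ U) (hB : B ∈ U) (T : Subsemigroup (A.Carrier × B.Carrier)) [Nonempty T] :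
    FinSemigroup.mk T ∈ U := by
  let F : Fin 2 → FinSemigroup := ![A, B]
  let f : (∀ i, (F i).Carrier) →ₙ* A.Carrier × B.Carrier :=
    { toFun := fun a => (a 0, a 1)
      map_mul' := fun _ _ => rfl }
  have hf : Function.Surjective f := fun ⟨a, b⟩ =>
    ⟨Fin.cons a (Fin.cons b fun i => i.elim0), rfl⟩
  have hne : Nonempty (T.comap f) := by
    obtain ⟨⟨t, ht⟩⟩ := ‹Nonempty T›
    obtain ⟨a, rfl⟩ := hf t
    exact ⟨⟨a, ht⟩⟩
  have h := hU.subdirect 2 F (fun i => by fin_cases i <;> assumption) (T.comap f)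
  let g : (T.comap f) →ₙ* T :=
    { toFun := fun a => ⟨f a.1, a.2⟩
      map_mul' := fun _ _ => rfl }
  refine hU.quotient _ _ h g ?_
  rintro ⟨t, ht⟩
  obtain ⟨a, rfl⟩ := hf t
  exact ⟨⟨a, ht⟩, rfl⟩

/-- The natural numbers up to `m`, with truncated addition as multiplication. -/
def TruncatedNat (m : ℕ) : Type := Fin (m + 1)

namespace TruncatedNat

variable {m : ℕ}

/-- The truncation of a natural number. -/
def of (m d : ℕ) : TruncatedNat m := ⟨min d m, Nat.lt_succ_of_le (min_le_right _ _)⟩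

/-- The underlying natural number. -/
def val (a : TruncatedNat m) : ℕ := Fin.val a

theorem val_of (m d : ℕ) : (of m d).val = min d m := rfl

instance : CommSemigroup (TruncatedNat m) where
  mul a b := of m (a.val + b.val)
  mul_assoc a b c := by
    apply Fin.ext
    change min (min (a.val + b.val) m + c.val) m = min (a.val + min (b.val + c.val) m) m
    omega
  mul_comm a b := congrArg (of m) (Nat.add_comm _ _)

instance : Finite (TruncatedNat m) := inferInstanceAs (Finite (Fin (m + 1)))

instance : Nonempty (TruncatedNat m) := ⟨of m 0⟩

end TruncatedNat

section PathSemigroup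

variable {V : Type} [Fintype V] [DecidableEq V] (ρ : V → ℕ)

/-- The matrix units for the pairs of increasing rank, together with zero. -/
def pathSemigroup : Subsemigroup (Matrix V V (ZMod 2)) where
  carrier := {A | A = 0 ∨ ∃ u v, ρ u < ρ v ∧ A = Matrix.single u v 1}
  mul_mem' := by
    rintro A B (rfl | ⟨u, v, huv, rfl⟩) (rfl | ⟨u', v', huv', rfl⟩)
    · left; simp
    · left; simp
    · left; simp
    · by_cases h : v = u'
      · subst h
        right
        refine ⟨u, v', huv.trans huv', ?_⟩
        rw [Matrix.single_mul_single_same, one_mul]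
      · left
        rw [Matrix.single_mul_single_of_ne]
        exact h

instance : Nonempty (pathSemigroup ρ) := ⟨⟨0, .inl rfl⟩⟩

theorem single_mem_pathSemigroup {u v : V} (h : ρ u < ρ v) :
    Matrix.single u v 1 ∈ pathSemigroup ρ := .inr ⟨u, v, h, rfl⟩

theorem card_pathSemigroup_le : Nat.card (pathSemigroup ρ) ≤ Fintype.card V ^ 2 + 1 := by
  classical
  let f : Option (V × V) → pathSemigroup ρ := fun o => match o with
    | none => ⟨0, .inl rfl⟩
    | some (u, v) => if h : ρ u < ρ v then ⟨_, single_mem_pathSemigroup ρ h⟩ else ⟨0, .inl rfl⟩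
  have hf : Function.Surjective f := by
    rintro ⟨A, (rfl | ⟨u, v, h, rfl⟩)⟩
    · exact ⟨none, rfl⟩
    · exact ⟨some (u, v), dif_pos h⟩
  refine (Nat.card_le_card_of_surjective f hf).trans (le_of_eq ?_)
  rw [Nat.card_eq_fintype_card, Fintype.card_option, Fintype.card_prod, sq]

/-- The matrix `P` consists of the entries of `A` at the pairs of rank difference `d`, and the
entries at the pairs of larger rank difference vanish. -/
structure IsLeadingPart (m : ℕ) (A : Matrix V V (ZMod 2)) (d : ℕ)
    (P : Matrix V V (ZMod 2)) : Prop where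
  mem : P ∈ pathSemigroup ρ
  -- The value `m` of the truncated degree means that the degree is at least `m`; it exceeds all
  -- rank differences, so nothing is required of `A` and the leading part vanishes.
  eq_zero : d < m → ∀ u w, ρ u + d < ρ w → A u w = 0
  eq : d < m → ∀ u w, ρ u + d = ρ w → A u w = P u w
  rank_eq : ∀ u w, P u w ≠ 0 → ρ u + d = ρ w

variable {ρ} {m : ℕ}

/-- The leading part is read off from `A` at rank difference `d` and is zero elsewhere. -/
theorem IsLeadingPart.unique (hρ : ∀ v, ρ v < m) {A P Q : Matrix V V (ZMod 2)} {d : ℕ}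
    (hP : IsLeadingPart ρ m A d P) (hQ : IsLeadingPart ρ m A d Q) : P = Q := by
  ext u w
  by_cases h : ρ u + d = ρ w
  · have hd : d < m := by have := hρ w; omega
    rw [← hP.eq hd u w h, hQ.eq hd u w h]
  · rw [not_imp_comm.1 (hP.rank_eq u w) h, not_imp_comm.1 (hQ.rank_eq u w) h]

/-- As for leading terms of polynomials: an intermediate vertex contributes to an entry of rank
difference `d + d'` only if it splits the difference exactly into `d` and `d'`. If the sum is
truncated, no pair of vertices is that far apart, so `P * Q` vanishes. -/
theorem IsLeadingPart.mul {A B P Q : Matrix V V (ZMod 2)} {d d' : ℕ}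
    (hρ : ∀ v, ρ v < m) (hP : IsLeadingPart ρ m A d P) (hQ : IsLeadingPart ρ m B d' Q) :
    IsLeadingPart ρ m (A * B) (min (d + d') m) (P * Q) where
  mem := mul_mem hP.mem hQ.mem
  eq_zero h u w huw := by
    rw [Matrix.mul_apply]
    refine Finset.sum_eq_zero fun v _ => ?_
    by_cases hv : ρ u + d < ρ v
    · rw [hP.eq_zero (by omega) u v hv, zero_mul]
    · rw [hQ.eq_zero (by omega) v w (by omega), mul_zero]
  eq h u w huw := by
    rw [Matrix.mul_apply, Matrix.mul_apply]
    refine Finset.sum_congr rfl fun v _ => ?_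
    rcases lt_trichotomy (ρ u + d) (ρ v) with hv | hv | hv
    · rw [hP.eq_zero (by omega) u v hv, not_imp_comm.1 (hP.rank_eq u v) (by omega), zero_mul,
        zero_mul]
    · rw [hP.eq (by omega) u v hv, hQ.eq (by omega) v w (by omega)]
    · rw [hQ.eq_zero (by omega) v w (by omega), not_imp_comm.1 (hQ.rank_eq v w) (by omega),
        mul_zero, mul_zero]
  rank_eq u w h := by
    rw [Matrix.mul_apply] at h
    obtain ⟨v, -, hv⟩ := Finset.exists_ne_zero_of_sum_ne_zero h
    have h1 := hP.rank_eq u v (left_ne_zero_of_mul hv)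
    have h2 := hQ.rank_eq v w (right_ne_zero_of_mul hv)
    have := hρ w
    omega

theorem isLeadingPart_zero (A : Matrix V V (ZMod 2)) :
    IsLeadingPart ρ m A m 0 where
  mem := .inl rfl
  eq_zero h := absurd h (lt_irrefl _)
  eq h := absurd h (lt_irrefl _)
  rank_eq _ _ h := absurd rfl h

/-- The identity matrix lies at rank difference zero, strictly below the matrix unit. -/
theorem isLeadingPart_single {u v : V} (h : ρ u < ρ v) :
    IsLeadingPart ρ m (1 + Matrix.single u v 1) (ρ v - ρ u) (Matrix.single u v 1) where
  mem := single_mem_pathSemigroup ρ h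
  eq_zero _ u' w' h' := by
    have h1 : u' ≠ w' := by rintro rfl; omega
    have h2 : ¬ (u = u' ∧ v = w') := by rintro ⟨rfl, rfl⟩; omega
    rw [Matrix.add_apply, Matrix.one_apply_ne h1, Matrix.single_apply, if_neg h2, zero_add]
  eq _ u' w' h' := by
    have h1 : u' ≠ w' := by rintro rfl; omega
    rw [Matrix.add_apply, Matrix.one_apply_ne h1, zero_add]
  rank_eq u' w' h' := by
    rw [Matrix.single_apply] at h'
    have : u = u' ∧ v = w' := by
      by_contra hc; rw [if_neg hc] at h'; exact h' rfl
    obtain ⟨rfl, rfl⟩ := this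
    omega

/-- An involution: the matrix unit squares to zero and twice it is zero in characteristic two. -/
theorem isUnit_one_add_single {u v : V} (h : u ≠ v) :
    IsUnit (1 + Matrix.single u v 1 : Matrix V V (ZMod 2)) := by
  have h1 : Matrix.single u v (1 : ZMod 2) * Matrix.single u v 1 = 0 := by
    rw [Matrix.single_mul_single_of_ne]
    exact h.symm
  have h2 : (1 + Matrix.single u v 1 : Matrix V V (ZMod 2)) * (1 + Matrix.single u v 1) = 1 := by
    have h3 : Matrix.single u v (1 : ZMod 2) + Matrix.single u v 1 = 0 := by
      rw [← Matrix.single_add]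
      have : (1 : ZMod 2) + 1 = 0 := by decide
      rw [this, Matrix.single_zero]
    rw [mul_add, add_mul, add_mul, h1, one_mul, mul_one, one_mul, add_zero, add_assoc, h3,
      add_zero]
  exact ⟨⟨_, _, h2, h2⟩, rfl⟩

/-- Path semigroups are quotients of subsemigroups of products of a group and a commutative
semigroup. -/
theorem pathSemigroup_mem_of_isVariety (ρ : V → ℕ) {U : Set FinSemigroup} (hU : IsVariety U)
    (hG : groups ⊆ U) (hC : commutative ⊆ U) : FinSemigroup.mk (pathSemigroup ρ) ∈ U := by
  classical
  set m := Finset.univ.sup ρ + 1 with hm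
  have hρ : ∀ v, ρ v < m := fun v => Nat.lt_succ_of_le (Finset.le_sup (Finset.mem_univ v))
  let G : FinSemigroup := FinSemigroup.mk (Matrix V V (ZMod 2))ˣ
  let C : FinSemigroup := FinSemigroup.mk (TruncatedNat m)
  have hGU : G ∈ U := hG ⟨(Matrix V V (ZMod 2))ˣ, inferInstance, ⟨MulEquiv.refl _⟩⟩
  have hCU : C ∈ U := hC fun a b => mul_comm (G := TruncatedNat m) a b
  let T : Subsemigroup ((Matrix V V (ZMod 2))ˣ × TruncatedNat m) :=
    { carrier := {x | ∃ P, IsLeadingPart ρ m x.1.val x.2.val P}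
      mul_mem' := by
        rintro x y ⟨P, hP⟩ ⟨Q, hQ⟩
        exact ⟨P * Q, hP.mul hρ hQ⟩ }
  have hne : Nonempty T := ⟨⟨(1, .of m m), 0, by
    have := isLeadingPart_zero (ρ := ρ) (m := m) (1 : Matrix V V (ZMod 2))
    rwa [TruncatedNat.val_of, min_self]⟩⟩
  have hT := hU.prod hGU hCU T
  have hspec : ∀ x : T, IsLeadingPart ρ m x.1.1.val x.1.2.val x.2.choose :=
    fun x => x.2.choose_spec
  -- Uniqueness makes the choice of the leading part multiplicative. Zero is the image of `(1, m)`,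
  -- and the matrix unit for `u, v` that of `1 + E` with degree `ρ v - ρ u`.
  let f : T →ₙ* pathSemigroup ρ :=
    { toFun := fun x => ⟨x.2.choose, (hspec x).mem⟩
      map_mul' := fun x y =>
        Subtype.ext ((hspec (x * y)).unique hρ ((hspec x).mul hρ (hspec y))) }
  refine hU.quotient _ _ hT f ?_
  rintro ⟨P, hP⟩
  have key : ∀ (A : (Matrix V V (ZMod 2))ˣ) (d : ℕ), d ≤ m → IsLeadingPart ρ m A.val d P →
      ∃ x, f x = ⟨P, hP⟩ := by
    intro A d hd h
    have h' : IsLeadingPart ρ m A.val (TruncatedNat.of m d).val P := by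
      rwa [TruncatedNat.val_of, min_eq_left hd]
    exact ⟨⟨(A, .of m d), P, h'⟩, Subtype.ext ((hspec ⟨(A, .of m d), P, h'⟩).unique hρ h')⟩
  have hP' := hP
  rcases hP' with rfl | ⟨u, v, huv, rfl⟩
  · exact key 1 m le_rfl (isLeadingPart_zero _)
  · obtain ⟨A, hA⟩ := isUnit_one_add_single (u := u) (v := v) (by rintro rfl; omega)
    refine key A (ρ v - ρ u) (by have := hρ v; omega) ?_
    rw [hA]
    exact isLeadingPart_single huv

omit [Fintype V] in
theorem single_one_inj {u v u' v' : V}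
    (h : Matrix.single u v (1 : ZMod 2) = Matrix.single u' v' 1) : u = u' ∧ v = v' := by
  have h1 := congrFun (congrFun h u) v
  rw [Matrix.single_apply_same, Matrix.single_apply] at h1
  by_contra hc
  rw [if_neg (fun hc' => hc ⟨hc'.1.symm, hc'.2.symm⟩)] at h1
  exact one_ne_zero h1

omit [Fintype V] in
theorem single_one_ne_zero (u v : V) : Matrix.single u v (1 : ZMod 2) ≠ 0 := by
  intro h
  have := congrFun (congrFun h u) v
  rw [Matrix.single_apply_same] at this
  exact one_ne_zero this

/-- The edges of a graph, as elements of the path semigroup. -/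
def edgeSet (ρ : V → ℕ) (E : V → V → Prop) : Set (pathSemigroup ρ) :=
  {A | ∃ u v, E u v ∧ A.1 = Matrix.single u v 1}

/-- Matrix units multiply like arrows: composable edges give the path from start to end, all other
products are zero and remain so. -/
theorem single_mem_closure_iff (E : V → V → Prop) (hE : ∀ u v, E u v → ρ u < ρ v) {s t : V}
    (hst : ρ s < ρ t) :
    (⟨Matrix.single s t 1, single_mem_pathSemigroup ρ hst⟩ : pathSemigroup ρ) ∈
      Subsemigroup.closure (edgeSet ρ E) ↔ Relation.TransGen E s t := by
  constructor
  · intro h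
    have key : ∀ A ∈ Subsemigroup.closure (edgeSet ρ E), ∀ s t,
        A.1 = Matrix.single s t 1 → Relation.TransGen E s t := by
      intro A hA
      induction hA using Subsemigroup.closure_induction with
      | mem A hA =>
        obtain ⟨u, v, huv, hA⟩ := hA
        intro s t hst
        obtain ⟨rfl, rfl⟩ := single_one_inj (hA.symm.trans hst)
        exact .single huv
      | mul A B _ _ ihA ihB =>
        intro s t hst
        change A.1 * B.1 = _ at hst
        have hne := single_one_ne_zero s t
        rcases A.2 with hA | ⟨u, v, -, hA⟩
        · rw [hA, zero_mul] at hst; exact absurd hst.symm hne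
        rcases B.2 with hB | ⟨u', v', -, hB⟩
        · rw [hB, mul_zero] at hst; exact absurd hst.symm hne
        rw [hA, hB] at hst
        by_cases hv : v = u'
        · subst hv
          rw [Matrix.single_mul_single_same, one_mul] at hst
          obtain ⟨rfl, rfl⟩ := single_one_inj hst
          exact (ihA u v hA).trans (ihB v v' hB)
        · rw [Matrix.single_mul_single_of_ne] at hst
          · exact absurd hst.symm hne
          · exact hv
    exact key _ h s t rfl
  · intro h
    have hlt : ∀ {u v}, Relation.TransGen E u v → ρ u < ρ v := by
      intro u v h
      induction h with
      | single h => exact hE _ _ h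
      | tail _ h ih => exact ih.trans (hE _ _ h)
    induction h with
    | single h => exact Subsemigroup.subset_closure ⟨_, _, h, rfl⟩
    | @tail v w h1 h2 ih =>
      have h3 := mul_mem (ih (hlt h1)) (Subsemigroup.subset_closure
        (⟨v, w, h2, rfl⟩ : (⟨_, single_mem_pathSemigroup ρ (hE _ _ h2)⟩ :
          pathSemigroup ρ) ∈ edgeSet ρ E))
      convert h3 using 1
      apply Subtype.ext
      change _ = Matrix.single s v 1 * Matrix.single v w 1
      rw [Matrix.single_mul_single_same, one_mul]

end PathSemigroup

/-! ## Reductions each of whose output letters depends on at most one input letter -/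

/-- The predicate is constant or depends on one letter only. -/
def IsLocal {n : ℕ} (f : (Fin n → Bool) → Prop) : Prop :=
  (∃ p : Prop, ∀ x, f x ↔ p) ∨ ∃ j b, ∀ x, f x ↔ x j = b

theorem isLocal_const {n : ℕ} {f : (Fin n → Bool) → Prop} (p : Prop) (h : ∀ x, f x ↔ p) :
    IsLocal f := .inl ⟨p, h⟩

theorem isLocal_of_letter {n : ℕ} {f : (Fin n → Bool) → Prop} (j : Fin n) (g : Bool → Prop)
    (h : ∀ x, f x ↔ g (x j)) : IsLocal f := by
  by_cases h1 : g true <;> by_cases h2 : g false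
  · refine .inl ⟨True, fun x => ?_⟩
    rw [h]; cases x j <;> simp [h1, h2]
  · refine .inr ⟨j, true, fun x => ?_⟩
    rw [h]; cases x j <;> simp [h1, h2]
  · refine .inr ⟨j, false, fun x => ?_⟩
    rw [h]; cases x j <;> simp [h1, h2]
  · refine .inl ⟨False, fun x => ?_⟩
    rw [h]; cases x j <;> simp [h1, h2]

/-- Literals are mere wires with a flag; the only gate is an AND without wires, which supplies the
constants. -/
theorem exists_circuit_of_isLocal {n m : ℕ} (out : (Fin n → Bool) → Fin m → Bool)
    (h : ∀ i, IsLocal fun x => out x i = true) :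
    ∃ C : Circuit n m, C.depth ≤ 1 ∧ C.size ≤ 1 ∧ ∀ x, C.eval x = out x := by
  classical
  have hw : ∀ i, ∃ w : (Fin n ⊕ Unit) × Bool, ∀ x,
      (Sum.elim x (fun _ => true) w.1 ^^ w.2) = out x i := by
    intro i
    rcases h i with ⟨p, hp⟩ | ⟨j, b, hb⟩
    · refine ⟨(.inr (), !(decide p)), fun x => ?_⟩
      have : out x i = true ↔ p := hp x
      rw [Bool.eq_iff_iff, this]
      by_cases hpp : p <;> simp [hpp]
    · refine ⟨(.inl j, !b), fun x => ?_⟩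
      have : out x i = true ↔ x j = b := hb x
      rw [Bool.eq_iff_iff, this]
      cases b <;> simp
  choose w hw using hw
  let C : Circuit n m :=
    { Gate := Unit
      kind := fun _ => .and
      inputWires := fun _ => ∅
      gateWires := fun _ => ∅
      acyclic := ⟨fun _ => ⟨_, fun _ ⟨_, h⟩ => h.elim⟩⟩
      output := w }
  have hC : ∀ x, C.gateValue x = fun _ => true := by
    intro x
    funext g
    refine (C.gateValue_and x g rfl).2 ?_
    rintro ⟨i | g, b⟩ h
    · exact h.elim
    · exact h.elim
  refine ⟨C, C.depth_le_of_rank (fun _ => 1) 1 (fun _ _ _ h => h.elim) (fun _ => le_rfl)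
    fun _ => le_rfl, le_of_eq Fintype.card_unit, fun x => ?_⟩
  funext i
  rw [Circuit.eval, hC]
  exact hw i x

theorem ac0Reducible_of_isLocal {L : Language Bool} {P : PromiseProblem} (m : ℕ → ℕ)
    (c : ℕ) (hm : ∀ n, m n ≤ n ^ c + c) (word : ∀ n, (Fin n → Bool) → List Bool)
    (hlen : ∀ n x, (word n x).length = m n)
    (hlocal : ∀ n (i : ℕ), IsLocal fun x => (word n x)[i]? = some true)
    (hred : ∀ n x, (List.ofFn x ∈ L → word n x ∈ P.yes) ∧ (List.ofFn x ∉ L → word n x ∈ P.no)) :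
    AC0Reducible L P := by
  have hout : ∀ n, ∃ C : Circuit n (m n), C.depth ≤ 1 ∧ C.size ≤ 1 ∧
      ∀ x, C.eval x = fun i => (word n x)[i.val]'(by rw [hlen]; exact i.2) := by
    intro n
    refine exists_circuit_of_isLocal _ fun i => ?_
    have := hlocal n i
    have h2 : ∀ x, ((word n x)[i.val]'(by rw [hlen]; exact i.2) = true) ↔
        (word n x)[i.val]? = some true := by
      intro x
      rw [List.getElem?_eq_getElem (by rw [hlen]; exact i.2), Option.some_inj]
    simpa only [IsLocal, h2] using this
  choose C h1 h2 h3 using hout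
  refine ⟨m, C, 1, c + 1, fun n => ⟨h1 n, (h2 n).trans (by omega), ?_⟩, fun n x => ?_⟩
  · refine (hm n).trans ?_
    rcases Nat.eq_zero_or_pos n with rfl | hn
    · rcases Nat.eq_zero_or_pos c with rfl | hc
      · simp
      · rw [Nat.zero_pow hc]; omega
    · have : n ^ c ≤ n ^ (c + 1) := Nat.pow_le_pow_right hn (by omega)
      omega
  · have : List.ofFn ((C n).eval x) = word n x := by
      rw [h3]
      refine List.ext_getElem (by rw [List.length_ofFn, hlen]) fun i _ _ => ?_
      rw [List.getElem_ofFn]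
    rw [this]
    exact hred n x

/-- Table and target do not depend on the input; only the characteristic vector does. -/
theorem isLocal_encodeInstance {n : ℕ} (S : FinSemigroup) {N : ℕ} (e : S.Carrier ≃ Fin N)
    (X : (Fin n → Bool) → Set S.Carrier) (t : S.Carrier)
    (hX : ∀ s, IsLocal fun x => s ∈ X x) (i : ℕ) :
    IsLocal fun x => (encodeInstance S e (X x) t)[i]? = some true := by
  classical
  simp only [encodeInstance_eq]
  rcases Nat.lt_or_ge i (encodeTable S e).length with h | h
  · exact isLocal_const _ fun x => by rw [List.getElem?_append_left h]
  · rcases Nat.lt_or_ge (i - (encodeTable S e).length) N with h' | h'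
    · have := hX (e.symm ⟨_, h'⟩)
      have h2 : ∀ x, ((encodeTable S e ++ ((List.finRange N).map (fun i =>
          decide (e.symm i ∈ X x)) ++ encodeElement (e t)))[i]? = some true) ↔
          e.symm ⟨_, h'⟩ ∈ X x := by
        intro x
        rw [List.getElem?_append_right h, List.getElem?_append_left (by simpa using h')]
        simp [h']
      simpa only [IsLocal, h2] using this
    · refine isLocal_const ((encodeElement (e t))[i - (encodeTable S e).length - N]? =
        some true) fun x => ?_
      rw [List.getElem?_append_right h, List.getElem?_append_right (by simpa using h')]
      simp

/-! ## Layered graphs -/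

section Layered

/-- `b` can be reached from `a` in `k` steps. -/
def StepN {α : Type} (R : α → α → Prop) : ℕ → α → α → Prop
  | 0, a, b => a = b
  | k + 1, a, b => ∃ c, StepN R k a c ∧ R c b

variable {α : Type} {R : α → α → Prop}

theorem stepN_add (i j : ℕ) (a b : α) :
    StepN R (i + j) a b ↔ ∃ c, StepN R i a c ∧ StepN R j c b := by
  induction j generalizing b with
  | zero => exact ⟨fun h => ⟨b, h, rfl⟩, fun ⟨c, h, h'⟩ => h' ▸ h⟩
  | succ j ih =>
    constructor
    · rintro ⟨d, h, hd⟩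
      obtain ⟨c, h1, h2⟩ := (ih d).1 h
      exact ⟨c, h1, d, h2, hd⟩
    · rintro ⟨c, h1, d, h2, hd⟩
      exact ⟨d, (ih d).2 ⟨c, h1, h2⟩, hd⟩

theorem exists_stepN_of_reflTransGen {a b : α} (h : Relation.ReflTransGen R a b) :
    ∃ k, StepN R k a b := by
  induction h with
  | refl => exact ⟨0, rfl⟩
  | tail _ h ih =>
    obtain ⟨k, hk⟩ := ih
    exact ⟨k + 1, _, hk, h⟩

/-- A shortest walk repeats no vertex, as the part between two visits could be cut out. -/
theorem exists_stepN_le_card [Finite α] {a b : α} (h : Relation.ReflTransGen R a b) :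
    ∃ k ≤ Nat.card α, StepN R k a b := by
  classical
  have hP := exists_stepN_of_reflTransGen h
  obtain ⟨k, hk, hmin⟩ : ∃ k, StepN R k a b ∧ ∀ m < k, ¬ StepN R m a b :=
    ⟨Nat.find hP, Nat.find_spec hP, fun m h => Nat.find_min hP h⟩
  refine ⟨k, ?_, hk⟩
  by_contra! hlt
  have : ∀ i : Fin (k + 1), ∃ c, StepN R i a c ∧ StepN R (k - i) c b := by
    intro i
    rw [← stepN_add, Nat.add_sub_cancel' (by omega)]
    exact hk
  choose c hc1 hc2 using this
  have hni : ¬ Function.Injective c := by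
    intro hc
    have := Nat.card_le_card_of_injective c hc
    rw [Nat.card_fin] at this
    omega
  have key : ∀ i j : Fin (k + 1), i < j → c i ≠ c j := by
    intro i j hij heq
    refine hmin (i + (k - j)) (by have := j.2; omega) ((stepN_add _ _ _ _).2 ⟨c i, hc1 i, ?_⟩)
    rw [heq]; exact hc2 j
  apply hni
  intro i j hij
  by_contra hne
  rcases lt_or_gt_of_ne hne with h | h
  · exact key i j h hij
  · exact key j i h hij.symm

/-- The vertices: the pairs of a time and a configuration, and a target. -/
abbrev LayeredVertex (T : ℕ) (α : Type) : Type := Option (Fin (T + 1) × α)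

/-- The layer of a vertex. -/
def layer {T : ℕ} : LayeredVertex T α → ℕ
  | none => T + 1
  | some (τ, _) => τ

/-- The edges from one layer to the next and from the accepting configurations to the target. -/
def layeredEdge {T : ℕ} (R : α → α → Prop) (acc : Set α) :
    LayeredVertex T α → LayeredVertex T α → Prop
  | some (τ, a), some (τ', b) => τ'.val = τ + 1 ∧ R a b
  | some (_, a), none => a ∈ acc
  | none, _ => False

theorem layer_lt_of_layeredEdge {T : ℕ} {acc : Set α} (u v : LayeredVertex T α)
    (h : layeredEdge R acc u v) : layer u < layer v := by
  rcases u with _ | ⟨τ, a⟩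
  · exact h.elim
  · rcases v with _ | ⟨τ', b⟩
    · exact τ.2
    · exact Nat.lt_of_lt_of_eq (Nat.lt_succ_self τ.val) h.1.symm

/-- Unfolding in time makes the graph acyclic with increasing layers. As many time steps as
configurations suffice, and the separate target merges all accepting configurations. -/
theorem transGen_layeredEdge_iff [Finite α] {acc : Set α} (a : α) :
    Relation.TransGen (layeredEdge (T := Nat.card α) R acc) (some (0, a)) none ↔
      ∃ b ∈ acc, Relation.ReflTransGen R a b := by
  constructor
  · have key : ∀ v, Relation.ReflTransGen (layeredEdge (T := Nat.card α) R acc)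
        (some (0, a)) v → match v with
        | none => True
        | some (_, b) => Relation.ReflTransGen R a b := by
      intro v h
      induction h with
      | refl => exact .refl
      | @tail u v _ h ih =>
        rcases v with _ | ⟨τ', b⟩
        · trivial
        · rcases u with _ | ⟨τ, c⟩
          · exact h.elim
          · exact .tail ih h.2
    intro h
    obtain ⟨u, h1, h2⟩ := Relation.TransGen.tail'_iff.1 h
    rcases u with _ | ⟨τ, b⟩
    · exact h2.elim
    · exact ⟨b, h2, key _ h1⟩
  · rintro ⟨b, hb, h⟩
    obtain ⟨k, hk, h⟩ := exists_stepN_le_card h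
    have key : ∀ k (hk : k ≤ Nat.card α) b, StepN R k a b →
        Relation.ReflTransGen (layeredEdge (T := Nat.card α) R acc) (some (0, a))
          (some (⟨k, Nat.lt_succ_of_le hk⟩, b)) := by
      intro k
      induction k with
      | zero => rintro _ b rfl; exact .refl
      | succ k ih =>
        rintro hk b ⟨c, h1, h2⟩
        exact .tail (ih (by omega) c h1) ⟨rfl, h2⟩
    exact Relation.TransGen.tail' (key k hk b h) hb

end Layered

/-! ## Configurations of logarithmic size -/

namespace NTM

variable (M : NTM)

/-- The configurations on inputs of length `n` that use at most the work tape cells up to `B`. -/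
def boundedConfig (n B : ℕ) : Set M.Config :=
  {c | c.inputHead ≤ n + 1 ∧ (∀ i, c.head i ≤ B) ∧ ∀ i p, B < p → c.content i p = M.blank}

theorem initial_mem_boundedConfig (n B : ℕ) : M.initial ∈ M.boundedConfig n B :=
  ⟨Nat.zero_le _, fun _ => Nat.zero_le _, fun _ _ _ => rfl⟩

/-- The data determining a bounded configuration. -/
abbrev BoundedData (n B : ℕ) : Type :=
  M.State × Fin (n + 2) × (Fin M.tapes → Fin (B + 1)) × (Fin M.tapes → Fin (B + 1) → M.Symbol)

/-- The data of a bounded configuration. -/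
def toBoundedData (n B : ℕ) (c : M.boundedConfig n B) : M.BoundedData n B :=
  (c.1.state, ⟨c.1.inputHead, Nat.lt_succ_of_le c.2.1⟩,
    fun i => ⟨c.1.head i, Nat.lt_succ_of_le (c.2.2.1 i)⟩, fun i p => c.1.content i p)

theorem toBoundedData_injective (n B : ℕ) : Function.Injective (M.toBoundedData n B) := by
  rintro ⟨⟨q, p, h, t⟩, hc⟩ ⟨⟨q', p', h', t'⟩, hc'⟩ heq
  simp only [toBoundedData, Prod.mk.injEq, Fin.mk.injEq] at heq
  obtain ⟨rfl, rfl, h1, h2⟩ := heq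
  have h3 : h = h' := by
    funext i; simpa using congrFun h1 i
  subst h3
  have h4 : t = t' := by
    funext i p
    rcases Nat.lt_or_ge B p with hp | hp
    · exact (hc.2.2 i p hp).trans (hc'.2.2 i p hp).symm
    · exact congrFun (congrFun h2 i) ⟨p, Nat.lt_succ_of_le hp⟩
  subst h4
  rfl

instance (n B : ℕ) : Finite (M.boundedConfig n B) :=
  haveI := M.finiteState
  haveI := M.finiteSymbol
  Finite.of_injective _ (M.toBoundedData_injective n B)

theorem card_boundedConfig_le (k : ℕ) : ∃ a, ∀ n,
    Nat.card (M.boundedConfig n (k * Nat.log 2 n + k)) ≤ (n + 2) ^ a := by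
  have := M.finiteState
  have := M.finiteSymbol
  set q := Nat.card M.State
  set s := Nat.card M.Symbol
  refine ⟨q + (1 + ((k + 2) * M.tapes + (s * M.tapes * k + s * M.tapes * (k + 1)))),
    fun n => ?_⟩
  refine (Nat.card_le_card_of_injective _ (M.toBoundedData_injective n _)).trans ?_
  rw [Nat.card_prod, Nat.card_prod, Nat.card_prod, Nat.card_fun, Nat.card_fun, Nat.card_fun]
  simp only [Nat.card_eq_fintype_card (α := Fin _), Fintype.card_fin]
  have hself : ∀ a, a ≤ (n + 2) ^ a := fun a =>
    Nat.lt_two_pow_self.le.trans (Nat.pow_le_pow_left (by omega) _)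
  have hlog : 2 ^ Nat.log 2 n ≤ n + 2 := by
    rcases Nat.eq_zero_or_pos n with rfl | hn
    · simp
    · exact (Nat.pow_log_le_self 2 hn.ne').trans (by omega)
  have hlog' : Nat.log 2 n ≤ n := Nat.log_le_self 2 n
  have h1 : k * Nat.log 2 n + k + 1 ≤ (n + 2) ^ (k + 2) := by
    calc k * Nat.log 2 n + k + 1 ≤ (k + 2) * (n + 2) := by nlinarith
      _ ≤ 2 ^ (k + 1) * (n + 2) := Nat.mul_le_mul_right _ Nat.lt_two_pow_self
      _ ≤ (n + 2) ^ (k + 1) * (n + 2) :=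
          Nat.mul_le_mul_right _ (Nat.pow_le_pow_left (by omega) _)
      _ = _ := (pow_succ _ _).symm
  have h2 : (s ^ (k * Nat.log 2 n + k + 1)) ^ M.tapes ≤
      (n + 2) ^ (s * M.tapes * k + s * M.tapes * (k + 1)) := by
    -- Tapes of logarithmic length have polynomially many contents: with `s ≤ 2 ^ s`, the power `2 ^
    -- log n` can be replaced by `n + 2`.
    calc (s ^ (k * Nat.log 2 n + k + 1)) ^ M.tapes
        ≤ ((2 ^ s) ^ (k * Nat.log 2 n + k + 1)) ^ M.tapes := by
          gcongr; exact Nat.lt_two_pow_self.le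
      _ = (2 ^ Nat.log 2 n) ^ (s * M.tapes * k) * 2 ^ (s * M.tapes * (k + 1)) := by
          rw [← pow_mul, ← pow_mul, ← pow_mul, ← pow_add]; congr 1; ring
      _ ≤ (n + 2) ^ (s * M.tapes * k) * (n + 2) ^ (s * M.tapes * (k + 1)) := by
          gcongr; omega
      _ = _ := (pow_add _ _ _).symm
  calc _ ≤ (n + 2) ^ q * ((n + 2) ^ 1 * (((n + 2) ^ (k + 2)) ^ M.tapes *
        (n + 2) ^ (s * M.tapes * k + s * M.tapes * (k + 1)))) := by
        gcongr
        · exact hself q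
        · rw [pow_one]
    _ = _ := by rw [← pow_mul, ← pow_add, ← pow_add, ← pow_add]

/-- A step from one bounded configuration to another. -/
def boundedStep (w : List Bool) {n B : ℕ} (c c' : M.boundedConfig n B) : Prop :=
  M.Step w c.1 c'.1

/-- For two fixed configurations the head position is fixed, so only the letter under the head
matters. -/
theorem isLocal_boundedStep {n B : ℕ} (c c' : M.boundedConfig n B) :
    IsLocal fun x : Fin n → Bool => M.boundedStep (List.ofFn x) c c' := by
  let g : InputSymbol → Prop := fun s =>
    ∃ r ∈ M.trans c.1.state s (fun i => c.1.content i (c.1.head i)),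
      c'.1.state = r.1 ∧
      c'.1.inputHead = min (move r.2.1 c.1.inputHead) (n + 1) ∧
      ∀ i, c'.1.head i = move (r.2.2 i).2 (c.1.head i) ∧
        c'.1.content i = Function.update (c.1.content i) (c.1.head i) (r.2.2 i).1
  have hg : ∀ x : Fin n → Bool, M.boundedStep (List.ofFn x) c c' ↔
      g (inputSymbol (List.ofFn x) c.1.inputHead) := by
    intro x
    simp only [boundedStep, Step, List.length_ofFn, g]
  simp only [hg]
  rcases hp : c.1.inputHead with _ | p
  · exact isLocal_const (g .leftEnd) fun x => Iff.rfl
  · rcases Nat.lt_or_ge p n with h | h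
    · refine isLocal_of_letter ⟨p, h⟩ (fun b => g (.bit b)) fun x => ?_
      simp [inputSymbol, h]
    · refine isLocal_const (g .rightEnd) fun x => ?_
      simp [inputSymbol, Nat.not_lt.2 h]

theorem accepts_iff_bounded {n B : ℕ} (w : List Bool) (hw : w.length = n)
    (hB : ∀ c, M.Reaches w c → ∀ i, c.head i ≤ B) :
    M.Accepts w ↔ ∃ c ∈ {c : M.boundedConfig n B | c.1.state ∈ M.accept},
      Relation.ReflTransGen (M.boundedStep w) ⟨_, M.initial_mem_boundedConfig n B⟩ c := by
  constructor
  · rintro ⟨c, hc, hacc⟩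
    have key : ∀ c, M.Reaches w c → ∃ h : c ∈ M.boundedConfig n B,
        Relation.ReflTransGen (M.boundedStep w) ⟨_, M.initial_mem_boundedConfig n B⟩ ⟨c, h⟩ := by
      intro c hc
      induction hc with
      | refl => exact ⟨M.initial_mem_boundedConfig n B, .refl⟩
      | @tail c d h1 h2 ih =>
        obtain ⟨hc, ih⟩ := ih
        have hd : d ∈ M.boundedConfig n B := by
          have h3 := h2
          obtain ⟨r, -, -, hp, ht⟩ := h2
          refine ⟨?_, hB d (.tail h1 h3), fun i p hp => ?_⟩
          · rw [hp, hw]; exact min_le_right _ _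
          · rw [(ht i).2, Function.update_of_ne, hc.2.2 i p hp]
            have := hc.2.1 i
            omega
        exact ⟨hd, .tail ih h2⟩
    obtain ⟨h, h'⟩ := key c hc
    exact ⟨⟨c, h⟩, hacc, h'⟩
  · rintro ⟨c, hacc, hc⟩
    exact ⟨c.1, hc.lift Subtype.val fun _ _ h => h, hacc⟩

end NTM

/-! ## Hardness -/

theorem pow_add_two_le (n a : ℕ) : (n + 2) ^ a ≤ n ^ (2 * a + 3 ^ a) + (2 * a + 3 ^ a) := by
  rcases Nat.lt_or_ge n 2 with h | h
  · have : (n + 2) ^ a ≤ 3 ^ a := Nat.pow_le_pow_left (by omega) _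
    omega
  · have h1 : n + 2 ≤ n ^ 2 := by nlinarith
    calc (n + 2) ^ a ≤ (n ^ 2) ^ a := Nat.pow_le_pow_left h1 _
      _ = n ^ (2 * a) := (pow_mul _ _ _).symm
      _ ≤ n ^ (2 * a + 3 ^ a) := Nat.pow_le_pow_right (by omega) (Nat.le_add_right _ _)
      _ ≤ _ := Nat.le_add_right _ _

theorem instanceLength_le_pow {T n a : ℕ} (hT : T ≤ (n + 2) ^ a) :
    instanceLength (((T + 1) * T + 1) ^ 2 + 1) ≤ (n + 2) ^ (15 * (a + 1) + 2) := by
  set Y := (n + 2) ^ (a + 1) with hY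
  have h2 : 2 ≤ n + 2 := by omega
  have hT' : T + 1 ≤ Y := by
    have : 1 ≤ (n + 2) ^ a := Nat.one_le_pow _ _ (by omega)
    rw [hY, pow_succ]; nlinarith
  have h1 : (T + 1) * T + 1 ≤ Y ^ 2 := by nlinarith
  have hYpos : 2 ≤ Y := by
    rw [hY, pow_succ]
    have : 1 ≤ (n + 2) ^ a := Nat.one_le_pow _ _ (by omega)
    nlinarith
  have h3 : ((T + 1) * T + 1) ^ 2 + 1 ≤ Y ^ 5 := by
    have h4 : ((T + 1) * T + 1) ^ 2 ≤ (Y ^ 2) ^ 2 := Nat.pow_le_pow_left h1 2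
    have h5 : 1 ≤ Y ^ 4 := Nat.one_le_pow _ _ (by omega)
    have h6 : Y ^ 5 = Y ^ 4 * Y := pow_succ _ _
    have h7 : (Y ^ 2) ^ 2 = Y ^ 4 := by rw [← pow_mul]
    nlinarith
  refine (instanceLength_strictMono.monotone h3).trans ?_
  have hclog : Nat.clog 2 (Y ^ 5) ≤ Y ^ 5 := by
    rw [Nat.clog_le_iff_le_pow (by omega)]
    exact Nat.lt_two_pow_self.le
  unfold instanceLength
  have h8 : 1 ≤ Y ^ 5 := Nat.one_le_pow _ _ (by omega)
  have h9 : (n + 2) ^ (15 * (a + 1) + 2) = (Y ^ 5) ^ 3 * (n + 2) ^ 2 := by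
    rw [hY, ← pow_mul, ← pow_mul, ← pow_add]; congr 1; ring
  rw [h9]
  generalize Y ^ 5 = Z at *
  have h10 : Z * Z * Nat.clog 2 Z ≤ Z ^ 3 := by
    calc Z * Z * Nat.clog 2 Z ≤ Z * Z * Z := Nat.mul_le_mul_left _ hclog
      _ = Z ^ 3 := by ring
  have h11 : Z ≤ Z ^ 3 := Nat.le_self_pow (by omega) Z
  have h12 : 4 ≤ (n + 2) ^ 2 := by nlinarith
  nlinarith [Nat.mul_le_mul_left (Z ^ 3) h12]

/-- Acceptance is reachability in the layered configuration graph. The path semigroup and the target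
depend only on the input length; the input enters through the generating edges, each of which
depends on at most one letter. Logarithmic space makes the graph polynomial. -/
theorem hard_NL_of_isVariety {U : Set FinSemigroup} (hU : ∀ (V : Type) [Fintype V]
    [DecidableEq V] (ρ : V → ℕ), FinSemigroup.mk (pathSemigroup ρ) ∈ U) : Hard NL (CSM U) := by
  classical
  rintro L ⟨M, ⟨k, hk⟩, hM⟩
  obtain ⟨a, ha⟩ := M.card_boundedConfig_le k
  let conf : ℕ → Type := fun n => M.boundedConfig n (k * Nat.log 2 n + k)
  let V : ℕ → Type := fun n => LayeredVertex (Nat.card (conf n)) (conf n)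
  have hfin : ∀ n, Finite (conf n) := fun n => inferInstanceAs
    (Finite (M.boundedConfig n (k * Nat.log 2 n + k)))
  let : ∀ n, Fintype (V n) := fun n => Fintype.ofFinite _
  let S : ℕ → FinSemigroup := fun n => FinSemigroup.mk (pathSemigroup (layer : V n → ℕ))
  let e : ∀ n, (S n).Carrier ≃ Fin (Nat.card (S n).Carrier) := fun n => Finite.equivFin _
  let s : ∀ n, V n := fun n => some (0, ⟨_, M.initial_mem_boundedConfig _ _⟩)
  have hst : ∀ n, layer (s n) < layer (none : V n) := fun n => Nat.succ_pos _
  let t : ∀ n, (S n).Carrier := fun n => ⟨_, single_mem_pathSemigroup layer (hst n)⟩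
  let E : ∀ n, (Fin n → Bool) → V n → V n → Prop := fun n x =>
    layeredEdge (M.boundedStep (List.ofFn x)) {c | c.1.state ∈ M.accept}
  let X : ∀ n, (Fin n → Bool) → Set (S n).Carrier := fun n x => edgeSet layer (E n x)
  have hcorrect : ∀ n x, t n ∈ Subsemigroup.closure (X n x) ↔ List.ofFn x ∈ L := by
    intro n x
    have h1 := single_mem_closure_iff (E n x) (fun u v h => layer_lt_of_layeredEdge u v h) (hst n)
    rw [hM, M.accepts_iff_bounded (B := k * Nat.log 2 n + k) _ (List.length_ofFn (f := x))
      (fun c hc i => by simpa using hk _ c hc i), ← transGen_layeredEdge_iff]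
    exact h1
  have hE : ∀ n u v, IsLocal fun x => E n x u v := by
    intro n u v
    rcases u with _ | ⟨τ, c⟩
    · exact isLocal_const False fun x => Iff.rfl
    · rcases v with _ | ⟨τ', c'⟩
      · exact isLocal_const (c.1.state ∈ M.accept) fun x => Iff.rfl
      · by_cases hτ : τ'.val = τ + 1
        · have := M.isLocal_boundedStep c c'
          have h2 : ∀ x : Fin n → Bool, E n x (some (τ, c)) (some (τ', c')) ↔
            M.boundedStep (List.ofFn x) c c' := fun x => and_iff_right hτ
          simpa only [IsLocal, h2] using this
        · exact isLocal_const False fun x => iff_false_intro fun h => hτ h.1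
  have hX : ∀ n A, IsLocal fun x => A ∈ X n x := by
    rintro n ⟨A, hA⟩
    have hA' := hA
    rcases hA' with rfl | ⟨u, v, -, rfl⟩
    · exact isLocal_const False fun x => iff_false_intro fun ⟨u, v, _, h⟩ =>
        single_one_ne_zero u v h.symm
    · have h2 : ∀ x, (⟨Matrix.single u v 1, hA⟩ : (S n).Carrier) ∈ X n x ↔ E n x u v := by
        intro x
        refine ⟨fun ⟨u', v', h, heq⟩ => ?_, fun h => ⟨u, v, h, rfl⟩⟩
        obtain ⟨rfl, rfl⟩ := single_one_inj heq
        exact h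
      simpa only [IsLocal, h2] using hE n u v
  refine ac0Reducible_of_isLocal (fun n => instanceLength (Nat.card (S n).Carrier))
    (2 * (15 * (a + 1) + 2) + 3 ^ (15 * (a + 1) + 2)) (fun n => ?_)
    (fun n x => encodeInstance (S n) (e n) (X n x) (t n))
    (fun n x => length_encodeInstance _ _ _ _)
    (fun n i => isLocal_encodeInstance _ _ _ _ (hX n) i) fun n x => ?_
  · refine le_trans ?_ (pow_add_two_le n _)
    refine le_trans ?_ (instanceLength_le_pow (ha n))
    refine instanceLength_strictMono.monotone ?_
    refine (card_pathSemigroup_le (layer : V n → ℕ)).trans (le_of_eq ?_)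
    have hcard : Nat.card (V n) = (Nat.card (conf n) + 1) * Nat.card (conf n) + 1 := by
      rw [Finite.card_option, Nat.card_prod, Nat.card_fin]
    rw [← Nat.card_eq_fintype_card, hcard]
  · rw [← hcorrect n x]
    exact ⟨fun h => ⟨S n, hU _ _, _, e n, X n x, t n, rfl, h⟩,
      fun h => ⟨S n, hU _ _, _, e n, X n x, t n, rfl, h⟩⟩

theorem hard_NL_varietyJoin : Hard NL (CSM (varietyJoin groups commutative)) :=
  hard_NL_of_isVariety fun _ _ _ ρ => fun _ ⟨hU, hG, hC⟩ =>
    pathSemigroup_mem_of_isVariety ρ hU hG hC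

/-! ## Machines with a single work tape -/

theorem NTM.move_stay (p : ℕ) : move .stay p = p := rfl

theorem NTM.move_right (p : ℕ) : move .right p = p + 1 := rfl

theorem NTM.move_left (p : ℕ) : move .left p = p - 1 := rfl

/-- The machine with a single work tape and the given transitions. -/
def NTM.ofSingleTape (State Symbol : Type) [Finite State] [Finite Symbol] (blank : Symbol)
    (start : State) (accept : Set State)
    (δ : State → InputSymbol → Symbol → Set (State × Move × Symbol × Move)) : NTM where
  tapes := 1
  State := State
  Symbol := Symbol
  blank := blank
  start := start
  accept := accept
  trans q s f := {r | (r.1, r.2.1, (r.2.2 0).1, (r.2.2 0).2) ∈ δ q s (f 0)}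

namespace NTM.ofSingleTape

variable {State Symbol : Type} [Finite State] [Finite Symbol] {blank : Symbol}
  {start : State} {accept : Set State}
  {δ : State → InputSymbol → Symbol → Set (State × Move × Symbol × Move)}

variable (blank start accept δ) in
/-- The configuration with the given state, head positions and tape content. -/
def config (q : State) (p h : ℕ) (t : ℕ → Symbol) :
    (NTM.ofSingleTape State Symbol blank start accept δ).Config :=
  ⟨q, p, fun _ => h, fun _ => t⟩

theorem step_iff (w : List Bool) (q : State) (p h : ℕ) (t : ℕ → Symbol)
    (c : (NTM.ofSingleTape State Symbol blank start accept δ).Config) :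
    (NTM.ofSingleTape State Symbol blank start accept δ).Step w
      (config blank start accept δ q p h t) c ↔
    ∃ q' mi s mt, (q', mi, s, mt) ∈ δ q (inputSymbol w p) (t h) ∧
      c = config blank start accept δ q' (min (move mi p) (w.length + 1)) (move mt h)
        (Function.update t h s) := by
  constructor
  · rintro ⟨r, hr, h1, h2, h3⟩
    refine ⟨r.1, r.2.1, (r.2.2 (0 : Fin 1)).1, (r.2.2 (0 : Fin 1)).2, hr, ?_⟩
    obtain ⟨q', p', h', t'⟩ := c
    simp only [config] at h1 h2 h3 ⊢
    have hh : h' = fun _ => move (r.2.2 (0 : Fin 1)).2 h := by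
      funext i; obtain rfl := Subsingleton.elim (α := Fin 1) 0 i; exact (h3 (0 : Fin 1)).1
    have ht : t' = fun _ => Function.update t h (r.2.2 (0 : Fin 1)).1 := by
      funext i; obtain rfl := Subsingleton.elim (α := Fin 1) 0 i; exact (h3 (0 : Fin 1)).2
    rw [h1, h2, hh, ht]
  · rintro ⟨q', mi, s, mt, hr, rfl⟩
    exact ⟨(q', mi, fun _ => (s, mt)), hr, rfl, rfl, fun i => ⟨rfl, rfl⟩⟩

end NTM.ofSingleTape

/-! ## Binary counting -/

/-- The increment of a binary number, with the least significant bit first. -/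
def binaryInc : List Bool → List Bool
  | [] => [true]
  | false :: l => true :: l
  | true :: l => false :: binaryInc l

/-- The binary representation of a number, with the least significant bit first. -/
def binary : ℕ → List Bool
  | 0 => []
  | n + 1 => binaryInc (binary n)

/-- The value of a binary number, with the least significant bit first. -/
def binaryValue : List Bool → ℕ
  | [] => 0
  | b :: l => b.toNat + 2 * binaryValue l

theorem binaryValue_inc (l : List Bool) : binaryValue (binaryInc l) = binaryValue l + 1 := by
  induction l with
  | nil => rfl
  | cons b l ih =>
    cases b with
    | false => simp [binaryInc, binaryValue]; omega
    | true => simp only [binaryInc, binaryValue, ih, Bool.toNat_true, Bool.toNat_false]; omega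

theorem binaryValue_binary (n : ℕ) : binaryValue (binary n) = n := by
  induction n with
  | zero => rfl
  | succ n ih => rw [binary, binaryValue_inc, ih]

theorem binaryValue_lt (l : List Bool) : binaryValue l < 2 ^ l.length := by
  induction l with
  | nil => simp [binaryValue]
  | cons b l ih =>
    rw [binaryValue, List.length_cons, pow_succ]
    cases b <;> simp <;> omega

/-- The length grows only by overflow, and then the new value is a power of two; this bounds the
length by the logarithm. -/
theorem length_binaryInc (l : List Bool) : (binaryInc l).length = l.length ∨
    (binaryInc l).length = l.length + 1 ∧ binaryValue (binaryInc l) = 2 ^ l.length := by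
  induction l with
  | nil => right; simp [binaryInc, binaryValue]
  | cons b l ih =>
    cases b with
    | false => left; rfl
    | true =>
      rcases ih with h | ⟨h1, h2⟩
      · left; simp [binaryInc, h]
      · right
        simp only [binaryInc, List.length_cons, h1, binaryValue, h2, pow_succ]
        simp [mul_comm]

theorem two_pow_le_of_binary (n : ℕ) : (binary n).length = 0 ∨ 2 ^ ((binary n).length - 1) ≤ n := by
  induction n with
  | zero => left; rfl
  | succ n ih =>
    rcases length_binaryInc (binary n) with h | ⟨h1, h2⟩
    · rw [binary, h]
      exact ih.imp_right fun h => h.trans (Nat.le_succ _)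
    · right
      rw [binaryValue_inc, binaryValue_binary] at h2
      rw [binary, h1, h2, Nat.add_sub_cancel]

theorem length_binary_le (n : ℕ) : (binary n).length ≤ Nat.log 2 n + 1 := by
  rcases two_pow_le_of_binary n with h | h
  · omega
  · have := Nat.log_mono_right (b := 2) h
    rw [Nat.log_pow (by omega)] at this
    omega

theorem lt_two_pow_length_binary (n : ℕ) : n < 2 ^ (binary n).length := by
  conv_lhs => rw [← binaryValue_binary n]
  exact binaryValue_lt _

theorem binaryInc_replicate (j : ℕ) (l : List Bool) :
    binaryInc (List.replicate j true ++ l) = List.replicate j false ++ binaryInc l := by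
  induction j with
  | zero => rfl
  | succ j ih => simp [List.replicate_succ, binaryInc, ih]

/-! ## Sweeping machines -/

/-- What happens to the input head at the end of a sweep. -/
inductive Turn where
  | stay
  | right
  | reset

/-- A machine whose work tape holds a list of columns, of a fixed length, and which passes over
these columns from left to right again and again. On the way it can move the input head to the
right. At the end of a pass the input head can also return to the first letter. -/
structure SweepMachine where
  Control : Type
  Col : Type
  [finiteControl : Finite Control]
  [finiteCol : Finite Col]
  start : Control
  accept : Set Control
  step : Control → Option Bool → Col → Set (Control × Bool × Col)
  turn : Control → Option Bool → Set (Control × Turn)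

attribute [instance] SweepMachine.finiteControl SweepMachine.finiteCol

namespace SweepMachine

variable (M : SweepMachine)

/-- The movement of the input head during a sweep. -/
def advance (w : List Bool) (mv : Bool) (p : ℕ) : ℕ := if mv then min (p + 1) w.length else p

/-- The movement of the input head at the end of a sweep. -/
def applyTurn (w : List Bool) : Turn → ℕ → ℕ
  | .stay, p => p
  | .right, p => min (p + 1) w.length
  | .reset, _ => 0

/-- A pass over a list of columns. -/
inductive Sweep (w : List Bool) :
    M.Control → ℕ → List M.Col → M.Control → ℕ → List M.Col → Prop
  | nil (q : M.Control) (p : ℕ) : Sweep w q p [] q p []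
  | snoc {q₀ q q' : M.Control} {p₀ p : ℕ} {cs cs' : List M.Col} {c c' : M.Col} {mv : Bool} :
      Sweep w q₀ p₀ cs q p cs' → (q', mv, c') ∈ M.step q w[p]? c →
      Sweep w q₀ p₀ (cs ++ [c]) q' (advance w mv p) (cs' ++ [c'])

/-- A pass and the following turn. -/
def Round (w : List Bool) (x y : M.Control × ℕ × List M.Col) : Prop :=
  ∃ q p tr, M.Sweep w x.1 x.2.1 x.2.2 q p y.2.2 ∧ (y.1, tr) ∈ M.turn q w[p]? ∧
    y.2.1 = applyTurn w tr p

/-- The number of columns available on an input. -/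
def width (w : List Bool) : ℕ := (binary (w.length + 1)).length

/-- Reachable from the start with columns chosen at will. -/
def Reaches (w : List Bool) (x : M.Control × ℕ × List M.Col) : Prop :=
  ∃ cs : List M.Col, cs.length ≤ width w ∧
    Relation.ReflTransGen (M.Round w) (M.start, 0, cs) x

/-- Some computation reaches an accepting state. -/
def Accepts (w : List Bool) : Prop := ∃ x, M.Reaches w x ∧ x.1 ∈ M.accept

variable {M}

theorem Sweep.length_eq {w : List Bool} {q q' : M.Control} {p p' : ℕ} {cs cs' : List M.Col}
    (h : M.Sweep w q p cs q' p' cs') : cs'.length = cs.length := by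
  induction h with
  | nil => rfl
  | snoc _ _ ih => simp [ih]

theorem advance_le {w : List Bool} {mv : Bool} {p : ℕ} (hp : p ≤ w.length) :
    advance w mv p ≤ w.length := by
  unfold advance; split_ifs
  · exact min_le_right _ _
  · exact hp

theorem applyTurn_le {w : List Bool} {tr : Turn} {p : ℕ} (hp : p ≤ w.length) :
    applyTurn w tr p ≤ w.length := by
  cases tr
  · exact hp
  · exact min_le_right _ _
  · exact Nat.zero_le _

theorem Sweep.le {w : List Bool} {q q' : M.Control} {p p' : ℕ} {cs cs' : List M.Col}
    (h : M.Sweep w q p cs q' p' cs') (hp : p ≤ w.length) : p' ≤ w.length := by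
  induction h with
  | nil => exact hp
  | snoc _ _ ih => exact advance_le (ih hp)

theorem Reaches.invariant {w : List Bool} {x : M.Control × ℕ × List M.Col}
    (h : M.Reaches w x) : x.2.1 ≤ w.length ∧ x.2.2.length ≤ width w := by
  obtain ⟨cs, hcs, h⟩ := h
  induction h with
  | refl => exact ⟨Nat.zero_le _, hcs⟩
  | tail _ h ih =>
    obtain ⟨q, p, tr, h1, h2, h3⟩ := h
    refine ⟨?_, ?_⟩
    · rw [h3]; exact applyTurn_le (h1.le ih.1)
    · rw [h1.length_eq]; exact ih.2

theorem Reaches.round {w : List Bool} {x y : M.Control × ℕ × List M.Col}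
    (h : M.Reaches w x) (h' : M.Round w x y) : M.Reaches w y := by
  obtain ⟨cs, hcs, h⟩ := h
  exact ⟨cs, hcs, h.tail h'⟩

variable (M)

/-- The states of the Turing machine. -/
inductive State where
  | init
  | count
  | carry
  | back
  | guess
  | rewind (q : M.Control) (reset : Bool)
  | sweep (q : M.Control)

/-- The tape symbols of the Turing machine. -/
inductive Symbol where
  | blank
  | mark
  | bit (b : Bool)
  | col (c : M.Col)
  | fin

instance : Finite M.State := by
  let f : M.State → Fin 5 ⊕ (M.Control × Bool) ⊕ M.Control := fun
    | .init => .inl 0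
    | .count => .inl 1
    | .carry => .inl 2
    | .back => .inl 3
    | .guess => .inl 4
    | .rewind q b => .inr (.inl (q, b))
    | .sweep q => .inr (.inr q)
  refine Finite.of_injective f fun x y h => ?_
  cases x <;> cases y <;> simp_all [f]

instance : Finite M.Symbol := by
  let f : M.Symbol → Fin 3 ⊕ Bool ⊕ M.Col := fun
    | .blank => .inl 0
    | .mark => .inl 1
    | .fin => .inl 2
    | .bit b => .inr (.inl b)
    | .col c => .inr (.inr c)
  refine Finite.of_injective f fun x y h => ?_
  cases x <;> cases y <;> simp_all [f]

/-- The letter under the input head. -/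
def letter : InputSymbol → Option Bool
  | .bit b => some b
  | _ => none

open Classical in
/-- The transitions of the Turing machine. First the width is marked on the work tape by counting
the letters of the input in binary. Then the columns are guessed. -/
def transition : M.State → InputSymbol → M.Symbol → Set (M.State × Move × M.Symbol × Move)
  | .init, _, _ => {(.count, .stay, .mark, .stay)}
  -- The input head advances one cell per increment, from cell `0` to cell `|w| + 1`, so the final
  -- counter is `|w| + 1`.
  | .count, .rightEnd, _ => {(.guess, .stay, .mark, .right)}
  | .count, _, _ => {(.carry, .right, .mark, .right)}
  | .carry, _, .bit true => {(.carry, .stay, .bit false, .right)}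
  | .carry, _, .bit false => {(.back, .stay, .bit true, .left)}
  | .carry, _, .blank => {(.back, .stay, .bit true, .left)}
  | .back, _, .mark => {(.count, .stay, .mark, .stay)}
  | .back, _, s => {(.back, .stay, s, .left)}
  -- Guessing may stop before all marked cells are used, so every number of columns up to the width
  -- occurs.
  | .guess, _, .bit _ => {r | (∃ c, r = (.guess, .stay, .col c, .right)) ∨
      r = (.rewind M.start true, .stay, .fin, .left)}
  | .guess, _, .blank => {(.rewind M.start true, .stay, .fin, .left)}
  -- Position `p` of the word is cell `p + 1`, so a reset ends one cell to the right of the left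
  -- marker.
  | .rewind q true, .leftEnd, .mark => {(.sweep q, .right, .mark, .right)}
  | .rewind q true, _, .mark => {(.rewind q true, .left, .mark, .stay)}
  | .rewind q true, _, s => {(.rewind q true, .left, s, .left)}
  | .rewind q false, _, .mark => {(.sweep q, .stay, .mark, .right)}
  | .rewind q false, _, s => {(.rewind q false, .stay, s, .left)}
  | .sweep q, i, .col c => {r | ∃ q' mv c', (q', mv, c') ∈ M.step q (letter i) c ∧
      r = (.sweep q', if mv then .right else .stay, .col c', .right)}
  | .sweep q, i, .fin => {r | ∃ q' tr, (q', tr) ∈ M.turn q (letter i) ∧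
      r = (match tr with
        | .stay => (.rewind q' false, .stay, .fin, .left)
        | .right => (.rewind q' false, .right, .fin, .left)
        | .reset => (.rewind q' true, .stay, .fin, .left))}
  | _, _, _ => ∅

/-- The Turing machine. -/
def toNTM : NTM :=
  NTM.ofSingleTape M.State M.Symbol .blank .init {q | ∃ q' ∈ M.accept, ∃ r, q = .rewind q' r}
    M.transition

/-- The configuration with the given state, head positions and tape content. -/
def config (q : M.State) (p h : ℕ) (t : ℕ → M.Symbol) : M.toNTM.Config :=
  NTM.ofSingleTape.config _ _ _ _ q p h t

theorem step_iff (w : List Bool) (q : M.State) (p h : ℕ) (t : ℕ → M.Symbol)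
    (c : M.toNTM.Config) :
    M.toNTM.Step w (M.config q p h t) c ↔
    ∃ q' mi s mt, (q', mi, s, mt) ∈ M.transition q (NTM.inputSymbol w p) (t h) ∧
      c = M.config q' (min (NTM.move mi p) (w.length + 1)) (NTM.move mt h)
        (Function.update t h s) := NTM.ofSingleTape.step_iff w q p h t c

variable {M}

/-- The tape with a marker in cell `0`, followed by the given symbols. -/
def tapeOf (l : List M.Symbol) : ℕ → M.Symbol
  | 0 => .mark
  | i + 1 => l.getD i .blank

theorem tapeOf_append (a b : List M.Symbol) :
    tapeOf (a ++ b) (a.length + 1) = b.headD .blank := by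
  simp only [tapeOf, List.getD_eq_getElem?_getD]
  rw [List.getElem?_append_right le_rfl, Nat.sub_self]
  cases b <;> rfl

theorem update_tapeOf (a b : List M.Symbol) (s : M.Symbol) :
    Function.update (tapeOf (a ++ b)) (a.length + 1) s = tapeOf (a ++ s :: b.tail) := by
  funext i
  rcases i with _ | i
  · rfl
  · by_cases h : i = a.length
    · subst h
      rw [Function.update_self, tapeOf_append]; rfl
    · rw [Function.update_of_ne (by omega)]
      simp only [tapeOf, List.getD_eq_getElem?_getD]
      rcases Nat.lt_or_ge i a.length with h' | h'
      · rw [List.getElem?_append_left h', List.getElem?_append_left h']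
      · rw [List.getElem?_append_right h', List.getElem?_append_right h']
        obtain ⟨k, hk⟩ : ∃ k, i - a.length = k + 1 := ⟨i - a.length - 1, by omega⟩
        rw [hk, List.getElem?_cons_succ, List.getElem?_tail]

theorem update_tapeOf_self (l : List M.Symbol) (h : ℕ) :
    Function.update (tapeOf l) h (tapeOf l h) = tapeOf l := Function.update_eq_self _ _

theorem letter_inputSymbol (w : List Bool) (p : ℕ) :
    letter (NTM.inputSymbol w (p + 1)) = w[p]? := by
  simp only [NTM.inputSymbol]
  split_ifs with h
  · simp [letter, h]
  · simp [letter, Nat.le_of_not_lt h]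

theorem tapeOf_map_bit (l : List Bool) {h : ℕ} (h1 : 1 ≤ h) (h2 : h ≤ l.length) :
    ∃ b, (tapeOf (l.map .bit) h : M.Symbol) = .bit b := by
  obtain ⟨i, rfl⟩ : ∃ i, h = i + 1 := ⟨h - 1, by omega⟩
  refine ⟨l[i]'(by omega), ?_⟩
  have : i < l.length := by omega
  simp [tapeOf, this]

theorem tapeOf_map_col (cs : List M.Col) (g : List M.Symbol) {h : ℕ} (h1 : 1 ≤ h)
    (h2 : h ≤ cs.length) : ∃ c, (tapeOf (cs.map .col ++ g) h : M.Symbol) = .col c := by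
  obtain ⟨i, rfl⟩ : ∃ i, h = i + 1 := ⟨h - 1, by omega⟩
  have hi : i < cs.length := by omega
  refine ⟨cs[i], ?_⟩
  simp [tapeOf, List.getElem?_append_left, hi]

end SweepMachine

/-! ### Soundness and space bound of the Turing machine. -/

namespace SweepMachine

variable {M : SweepMachine}

/-- The configurations of the Turing machine that occur on an input. -/
inductive Occurs (w : List Bool) : M.toNTM.Config → Prop
  | init : Occurs w (M.config .init 0 0 fun _ => .blank)
  | count (n : ℕ) (hn : n ≤ w.length + 1) :
      Occurs w (M.config .count n 0 (tapeOf ((binary n).map .bit)))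
  | carry (n j : ℕ) (l : List Bool) (hn : n ≤ w.length)
      (h : binary n = List.replicate j true ++ l) :
      Occurs w (M.config .carry (n + 1) (j + 1)
        (tapeOf ((List.replicate j false ++ l).map .bit)))
  | back (n h : ℕ) (hn : n ≤ w.length + 1) (hh : h ≤ (binary n).length) :
      Occurs w (M.config .back n h (tapeOf ((binary n).map .bit)))
  | guess (cs : List M.Col) (l : List Bool) (h : cs.length + l.length = width w) :
      Occurs w (M.config .guess (w.length + 1) (cs.length + 1)
        (tapeOf (cs.map .col ++ l.map .bit)))
  | rewind (q : M.Control) (p : ℕ) (cs : List M.Col) (r : Bool) (i h : ℕ) (g : List M.Symbol)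
      (hr : M.Reaches w (q, p, cs)) (hh : h ≤ cs.length)
      (hi : if r then p = 0 ∧ i ≤ w.length + 1 else i = p + 1) :
      Occurs w (M.config (.rewind q r) i h (tapeOf (cs.map .col ++ .fin :: g)))
  | sweep (q₀ : M.Control) (p₀ : ℕ) (pre suf pre' : List M.Col) (q : M.Control) (p : ℕ)
      (g : List M.Symbol) (hr : M.Reaches w (q₀, p₀, pre ++ suf))
      (hs : M.Sweep w q₀ p₀ pre q p pre') :
      Occurs w (M.config (.sweep q) (p + 1) (pre'.length + 1)
        (tapeOf (pre'.map .col ++ (suf.map .col ++ .fin :: g))))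

/-- The list of occurring configurations is an invariant which yields both the space bound and the
fact that every run of the Turing machine comes from rounds of the sweep machine. -/
theorem occurs_step {w : List Bool} {c c' : M.toNTM.Config} (hc : Occurs w c)
    (h : M.toNTM.Step w c c') : Occurs w c' := by
  cases hc with
  | init =>
    obtain ⟨q', mi, s, mt, hr, rfl⟩ := (M.step_iff _ _ _ _ _ _).1 h
    obtain ⟨rfl, rfl, rfl, rfl⟩ : q' = .count ∧ mi = .stay ∧ s = .mark ∧ mt = .stay := by
      simpa [transition] using hr
    have : Function.update (fun _ => Symbol.blank : ℕ → M.Symbol) 0 .mark = tapeOf [] := by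
      funext i; rcases i with _ | i <;> rfl
    rw [this]
    exact .count 0 (Nat.zero_le _)
  | count n hn =>
    obtain ⟨q', mi, s, mt, hr, rfl⟩ := (M.step_iff _ _ _ _ _ _).1 h
    have hupd : Function.update (tapeOf ((binary n).map Symbol.bit) : ℕ → M.Symbol) 0 .mark =
        tapeOf ((binary n).map Symbol.bit) := update_tapeOf_self _ 0
    rcases Nat.lt_or_ge w.length n with hlt | hle
    · obtain rfl : n = w.length + 1 := by omega
      have hin : NTM.inputSymbol w (w.length + 1) = .rightEnd := by simp [NTM.inputSymbol]
      rw [hin] at hr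
      obtain ⟨rfl, rfl, rfl, rfl⟩ : q' = .guess ∧ mi = .stay ∧ s = .mark ∧ mt = .right := by
        simpa [transition] using hr
      rw [hupd, NTM.move_stay, min_self]
      have := Occurs.guess (M := M) (w := w) [] (binary (w.length + 1)) (by simp [width])
      exact this
    · have hr' : q' = .carry ∧ mi = .right ∧ s = .mark ∧ mt = .right := by
        rcases n with _ | n
        · simpa [NTM.inputSymbol, transition] using hr
        · have : n < w.length := by omega
          simpa [NTM.inputSymbol, transition, this] using hr
      obtain ⟨rfl, rfl, rfl, rfl⟩ := hr'
      rw [hupd, NTM.move_right n, min_eq_left (by omega)]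
      exact .carry n 0 (binary n) hle rfl
  | carry n j l hn hbin =>
    obtain ⟨q', mi, s, mt, hr, rfl⟩ := (M.step_iff _ _ _ _ _ _).1 h
    have hj : j + 1 = ((List.replicate j false).map (Symbol.bit : Bool → M.Symbol)).length + 1 := by
      simp
    have hsucc : binary (n + 1) = List.replicate j false ++ binaryInc l := by
      rw [binary, hbin, binaryInc_replicate]
    rw [List.map_append] at hr ⊢
    rcases l with _ | ⟨b, l⟩
    · have ht : (tapeOf ((List.replicate j false).map Symbol.bit ++ ([] : List Bool).map Symbol.bit)
          (j + 1) : M.Symbol) = .blank := by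
        rw [hj, tapeOf_append]; rfl
      rw [ht] at hr
      obtain ⟨rfl, rfl, rfl, rfl⟩ : q' = .back ∧ mi = .stay ∧ s = .bit true ∧ mt = .left := by
        simpa [transition] using hr
      nth_rewrite 2 [hj]
      rw [update_tapeOf, NTM.move_stay, min_eq_left (by omega)]
      have := Occurs.back (M := M) (w := w) (n + 1) j (by omega) (by rw [hsucc]; simp)
      rw [hsucc, List.map_append] at this
      exact this
    · have ht : (tapeOf ((List.replicate j false).map Symbol.bit ++ (b :: l).map Symbol.bit)
          (j + 1) : M.Symbol) = .bit b := by
        rw [hj, tapeOf_append]; rfl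
      rw [ht] at hr
      cases b with
      | false =>
        obtain ⟨rfl, rfl, rfl, rfl⟩ : q' = .back ∧ mi = .stay ∧ s = .bit true ∧ mt = .left := by
          simpa [transition] using hr
        nth_rewrite 2 [hj]
        rw [update_tapeOf, NTM.move_stay, min_eq_left (by omega)]
        have := Occurs.back (M := M) (w := w) (n + 1) j (by omega) (by rw [hsucc]; simp)
        rw [hsucc, List.map_append] at this
        exact this
      | true =>
        obtain ⟨rfl, rfl, rfl, rfl⟩ : q' = .carry ∧ mi = .stay ∧ s = .bit false ∧ mt = .right := by
          simpa [transition] using hr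
        nth_rewrite 2 [hj]
        rw [update_tapeOf, NTM.move_stay, min_eq_left (by omega)]
        have := Occurs.carry (M := M) (w := w) n (j + 1) l hn (by
          rw [hbin, List.replicate_succ', List.append_assoc]; rfl)
        rw [List.replicate_succ', List.append_assoc, List.map_append] at this
        exact this
  | back n k hn hk =>
    obtain ⟨q', mi, s, mt, hr, rfl⟩ := (M.step_iff _ _ _ _ _ _).1 h
    rcases k with _ | k
    · obtain ⟨rfl, rfl, rfl, rfl⟩ : q' = .count ∧ mi = .stay ∧ s = .mark ∧ mt = .stay := by
        simpa [transition, tapeOf] using hr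
      have hupd : Function.update (tapeOf ((binary n).map Symbol.bit) : ℕ → M.Symbol) 0 .mark =
        tapeOf ((binary n).map Symbol.bit) := update_tapeOf_self _ 0
      rw [hupd, NTM.move_stay, min_eq_left (by omega)]
      exact .count n hn
    · obtain ⟨b, hb⟩ := tapeOf_map_bit (M := M) (binary n) (Nat.succ_pos k) hk
      rw [hb] at hr
      obtain ⟨rfl, rfl, rfl, rfl⟩ : q' = .back ∧ mi = .stay ∧ s = .bit b ∧ mt = .left := by
        simpa [transition] using hr
      rw [← hb, update_tapeOf_self, NTM.move_stay, min_eq_left (by omega)]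
      exact .back n k hn (by omega)
  | guess cs l hl =>
    obtain ⟨q', mi, s, mt, hr, rfl⟩ := (M.step_iff _ _ _ _ _ _).1 h
    have hcs : cs.length + 1 = (cs.map (Symbol.col : M.Col → M.Symbol)).length + 1 := by simp
    have hfin : ∀ g : List M.Symbol, Occurs w (M.config (.rewind M.start true) (w.length + 1)
        cs.length (tapeOf (cs.map .col ++ .fin :: g))) := fun g =>
      .rewind M.start 0 cs true _ _ g ⟨cs, by omega, .refl⟩ le_rfl (by simp)
    rcases l with _ | ⟨b, l⟩
    · have ht : (tapeOf (cs.map Symbol.col ++ ([] : List Bool).map Symbol.bit)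
          (cs.length + 1) : M.Symbol) = .blank := by
        rw [hcs, tapeOf_append]; rfl
      rw [ht] at hr
      obtain ⟨rfl, rfl, rfl, rfl⟩ :
          q' = .rewind M.start true ∧ mi = .stay ∧ s = .fin ∧ mt = .left := by
        simpa [transition] using hr
      nth_rewrite 2 [hcs]
      rw [update_tapeOf, NTM.move_stay, min_self]
      exact hfin _
    · have ht : (tapeOf (cs.map Symbol.col ++ (b :: l).map Symbol.bit)
          (cs.length + 1) : M.Symbol) = .bit b := by
        rw [hcs, tapeOf_append]; rfl
      rw [ht] at hr
      have hr' : (∃ c : M.Col, q' = .guess ∧ mi = .stay ∧ s = .col c ∧ mt = .right) ∨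
          (q' = .rewind M.start true ∧ mi = .stay ∧ s = .fin ∧ mt = .left) := by
        simpa [transition] using hr
      rcases hr' with ⟨c, rfl, rfl, rfl, rfl⟩ | ⟨rfl, rfl, rfl, rfl⟩
      · nth_rewrite 2 [hcs]
        rw [update_tapeOf, NTM.move_stay, min_self]
        have := Occurs.guess (M := M) (w := w) (cs ++ [c]) l (by
          rw [List.length_cons] at hl; rw [List.length_append, List.length_singleton]; omega)
        rw [List.map_append, List.append_assoc, List.length_append] at this
        exact this
      · nth_rewrite 2 [hcs]
        rw [update_tapeOf, NTM.move_stay, min_self]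
        exact hfin _
  | rewind q p cs r i k g hreach hk hi =>
    obtain ⟨q', mi, s, mt, hr, rfl⟩ := (M.step_iff _ _ _ _ _ _).1 h
    have hp := hreach.invariant.1
    have hupd : Function.update (tapeOf (cs.map Symbol.col ++ .fin :: g) : ℕ → M.Symbol) 0 .mark =
        tapeOf (cs.map Symbol.col ++ .fin :: g) := update_tapeOf_self _ 0
    have hstart : Occurs w (M.config (.sweep q) (p + 1) 1
        (tapeOf (cs.map .col ++ .fin :: g))) :=
      .sweep q p [] cs [] q p g hreach (.nil q p)
    cases r with
    | false =>
      simp only [Bool.false_eq_true, if_false] at hi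
      subst hi
      rcases k with _ | k
      · obtain ⟨rfl, rfl, rfl, rfl⟩ : q' = .sweep q ∧ mi = .stay ∧ s = .mark ∧ mt = .right := by
          simpa [transition, tapeOf] using hr
        rw [hupd, NTM.move_stay, min_eq_left (by simpa using hp)]
        exact hstart
      · obtain ⟨c, hc⟩ := tapeOf_map_col (M := M) cs (.fin :: g) (Nat.succ_pos k) hk
        rw [hc] at hr
        obtain ⟨rfl, rfl, rfl, rfl⟩ :
            q' = .rewind q false ∧ mi = .stay ∧ s = .col c ∧ mt = .left := by
          simpa [transition] using hr
        rw [← hc, update_tapeOf_self, NTM.move_stay, min_eq_left (by simpa using hp)]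
        exact .rewind q p cs false _ _ g hreach (by rw [NTM.move_left]; omega) (by simp)
    | true =>
      simp only [if_true] at hi
      obtain ⟨rfl, hi⟩ := hi
      rcases k with _ | k
      · rcases i with _ | i
        · obtain ⟨rfl, rfl, rfl, rfl⟩ : q' = .sweep q ∧ mi = .right ∧ s = .mark ∧ mt = .right := by
            simpa [transition, tapeOf, NTM.inputSymbol] using hr
          rw [hupd, NTM.move_right 0, min_eq_left (by simp)]
          exact hstart
        · have hr' : q' = .rewind q true ∧ mi = .left ∧ s = .mark ∧ mt = .stay := by
            simp only [NTM.inputSymbol] at hr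
            split_ifs at hr <;> simpa [transition, tapeOf] using hr
          obtain ⟨rfl, rfl, rfl, rfl⟩ := hr'
          rw [hupd]
          exact .rewind q 0 cs true _ _ g hreach (Nat.zero_le _) (by simp)
      · obtain ⟨c, hc⟩ := tapeOf_map_col (M := M) cs (.fin :: g) (Nat.succ_pos k) hk
        rw [hc] at hr
        have hr' : q' = .rewind q true ∧ mi = .left ∧ s = .col c ∧ mt = .left := by
          rcases i with _ | i
          · simpa [transition, NTM.inputSymbol] using hr
          · simp only [NTM.inputSymbol] at hr
            split_ifs at hr <;> simpa [transition] using hr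
        obtain ⟨rfl, rfl, rfl, rfl⟩ := hr'
        rw [← hc, update_tapeOf_self]
        exact .rewind q 0 cs true _ _ g hreach (by rw [NTM.move_left]; omega) (by simp)
  | sweep q₀ p₀ pre suf pre' q p g hreach hs =>
    obtain ⟨q', mi, s, mt, hr, rfl⟩ := (M.step_iff _ _ _ _ _ _).1 h
    have hp := hs.le hreach.invariant.1
    have hpre : pre'.length + 1 = (pre'.map (Symbol.col : M.Col → M.Symbol)).length + 1 := by simp
    have hhead := tapeOf_append (M := M) (pre'.map Symbol.col) (suf.map Symbol.col ++ .fin :: g)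
    rw [← hpre] at hhead
    rw [hhead] at hr
    rcases suf with _ | ⟨c, suf⟩
    · obtain ⟨q'', tr, htr, hr'⟩ : ∃ q'' tr, (q'', tr) ∈ M.turn q (letter (NTM.inputSymbol w (p + 1)))
          ∧ (q', mi, s, mt) = (match tr with
        | .stay => (.rewind q'' false, .stay, .fin, .left)
        | .right => (.rewind q'' false, .right, .fin, .left)
        | .reset => (.rewind q'' true, .stay, .fin, .left)) := hr
      rw [letter_inputSymbol] at htr
      have hnext : M.Reaches w (q'', applyTurn w tr p, pre') :=
        hreach.round ⟨q, p, tr, by simpa using hs, htr, rfl⟩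
      have hupd : Function.update (tapeOf (pre'.map Symbol.col ++ (([] : List M.Col).map Symbol.col
          ++ .fin :: g)) : ℕ → M.Symbol) (pre'.length + 1) .fin =
          tapeOf (pre'.map Symbol.col ++ .fin :: g) := by
        rw [hpre, update_tapeOf]; rfl
      cases tr with
      | stay =>
        obtain ⟨rfl, rfl, rfl, rfl⟩ := by simpa using hr'
        rw [hupd]
        exact .rewind q'' p pre' false _ _ g hnext (by simp [NTM.move]) (by simp [NTM.move, hp])
      | right =>
        obtain ⟨rfl, rfl, rfl, rfl⟩ := by simpa using hr'
        rw [hupd]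
        exact .rewind q'' _ pre' false _ _ g hnext (by simp [NTM.move])
          (by simp [NTM.move, applyTurn])
      | reset =>
        obtain ⟨rfl, rfl, rfl, rfl⟩ := by simpa using hr'
        rw [hupd]
        exact .rewind q'' _ pre' true _ _ g hnext (by simp [NTM.move]) (by simp [applyTurn])
    · obtain ⟨q'', mv, c', hst, hr'⟩ : ∃ q'' mv c', (q'', mv, c') ∈
          M.step q (letter (NTM.inputSymbol w (p + 1))) c ∧
          (q', mi, s, mt) = (.sweep q'', if mv then .right else .stay, .col c', .right) := hr
      rw [letter_inputSymbol] at hst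
      obtain ⟨rfl, rfl, rfl, rfl⟩ := by simpa using hr'
      have hupd : Function.update (tapeOf (pre'.map Symbol.col ++ ((c :: suf).map Symbol.col
          ++ .fin :: g)) : ℕ → M.Symbol) (pre'.length + 1) (.col c') =
          tapeOf ((pre' ++ [c']).map Symbol.col ++ (suf.map Symbol.col ++ .fin :: g)) := by
        rw [hpre, update_tapeOf]; simp
      have hmove : min (NTM.move (if mv then .right else .stay) (p + 1)) (w.length + 1) =
          advance w mv p + 1 := by
        cases mv <;> simp [NTM.move, advance, hp]
      rw [hupd, hmove]
      have := Occurs.sweep (M := M) (w := w) q₀ p₀ (pre ++ [c]) suf (pre' ++ [c']) q''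
        (advance w mv p) g (by simpa using hreach) (.snoc hs hst)
      rw [List.length_append] at this
      exact this

theorem occurs_of_reaches {w : List Bool} {c : M.toNTM.Config} (hc : M.toNTM.Reaches w c) :
    Occurs w c := by
  induction hc with
  | refl => exact .init
  | tail _ h ih => exact occurs_step ih h

theorem width_le (w : List Bool) : width w ≤ Nat.log 2 w.length + 2 := by
  unfold width
  refine (length_binary_le _).trans (Nat.succ_le_succ ?_)
  rcases Nat.eq_zero_or_pos w.length with h | h
  · rw [h]; simp
  · calc Nat.log 2 (w.length + 1) ≤ Nat.log 2 (w.length * 2) := Nat.log_mono_right (by omega)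
      _ = _ := Nat.log_mul_base (by omega) h.ne'

theorem length_binary_le_width {w : List Bool} {n : ℕ} (hn : n ≤ w.length + 1) :
    (binary n).length ≤ Nat.log 2 w.length + 2 := by
  refine (length_binary_le _).trans (Nat.succ_le_succ ?_)
  rcases Nat.eq_zero_or_pos w.length with h | h
  · rw [h] at hn ⊢
    have : Nat.log 2 n ≤ Nat.log 2 1 := Nat.log_mono_right hn
    rw [Nat.log_one_right] at this
    omega
  · calc Nat.log 2 n ≤ Nat.log 2 (w.length * 2) := Nat.log_mono_right (by omega)
      _ = _ := Nat.log_mul_base (by omega) h.ne'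

theorem logSpace_toNTM : M.toNTM.LogSpace := by
  -- The head goes at most one cell beyond the width, and the width is at most `log |w| + 2`.
  refine ⟨3, fun w c hc i => ?_⟩
  cases occurs_of_reaches hc with
  | init => exact Nat.zero_le _
  | count n hn => exact Nat.zero_le _
  | carry n j l hn h =>
    have h1 := length_binary_le_width (w := w) (n := n) (by omega)
    rw [h, List.length_append, List.length_replicate] at h1
    change j + 1 ≤ _
    omega
  | back n k hn hk =>
    have h1 := length_binary_le_width hn
    change k ≤ _
    omega
  | guess cs l h =>
    have h1 := width_le w
    change cs.length + 1 ≤ _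
    omega
  | rewind q p cs r j k g hr hk =>
    have h1 := width_le w
    have h2 := hr.invariant.2
    dsimp only at h2
    change k ≤ _
    omega
  | sweep q₀ p₀ pre suf pre' q p g hr hs =>
    have h1 := width_le w
    have h2 := hr.invariant.2
    have h3 := hs.length_eq
    simp only [List.length_append] at h2
    change pre'.length + 1 ≤ _
    omega

theorem accepts_of_toNTM {w : List Bool} (h : M.toNTM.Accepts w) : M.Accepts w := by
  obtain ⟨c, hc, hacc⟩ := h
  cases occurs_of_reaches hc with
  | rewind q p cs r j k g hr hk =>
    obtain ⟨q', hq', r', heq⟩ := hacc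
    obtain ⟨rfl, rfl⟩ := State.rewind.inj heq
    exact ⟨_, hr, hq'⟩
  | init => obtain ⟨_, _, _, h⟩ := hacc; cases h
  | count => obtain ⟨_, _, _, h⟩ := hacc; cases h
  | carry => obtain ⟨_, _, _, h⟩ := hacc; cases h
  | back => obtain ⟨_, _, _, h⟩ := hacc; cases h
  | guess => obtain ⟨_, _, _, h⟩ := hacc; cases h
  | sweep => obtain ⟨_, _, _, h⟩ := hacc; cases h

end SweepMachine

/-! ### The Turing machine realises every run of the sweep machine. -/

namespace SweepMachine

variable {M : SweepMachine} {w : List Bool}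

theorem step_of_mem {q : M.State} {p h : ℕ} {t : ℕ → M.Symbol} {q' : M.State} {mi : Move}
    {s : M.Symbol} {mt : Move}
    (hr : (q', mi, s, mt) ∈ M.transition q (NTM.inputSymbol w p) (t h)) :
    M.toNTM.Step w (M.config q p h t)
      (M.config q' (min (NTM.move mi p) (w.length + 1)) (NTM.move mt h)
        (Function.update t h s)) :=
  (M.step_iff _ _ _ _ _ _).2 ⟨_, _, _, _, hr, rfl⟩

theorem reaches_back {p : ℕ} (hp : p ≤ w.length + 1) (l : List Bool) (k : ℕ) (hk : k ≤ l.length) :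
    Relation.ReflTransGen (M.toNTM.Step w) (M.config .back p k (tapeOf (l.map .bit)))
      (M.config .count p 0 (tapeOf (l.map .bit))) := by
  induction k with
  | zero =>
    refine .single ?_
    have := step_of_mem (M := M) (w := w) (q := .back) (p := p) (h := 0)
      (t := tapeOf (l.map .bit)) (q' := .count) (mi := .stay) (s := .mark) (mt := .stay)
      (by simp [transition, tapeOf])
    rwa [NTM.move_stay, min_eq_left hp, show (.mark : M.Symbol) = tapeOf (l.map .bit) 0 from rfl,
      update_tapeOf_self] at this
  | succ k ih =>
    refine .head ?_ (ih (by omega))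
    obtain ⟨b, hb⟩ := tapeOf_map_bit (M := M) l (Nat.succ_pos k) hk
    have := step_of_mem (M := M) (w := w) (q := .back) (p := p) (h := k + 1)
      (t := tapeOf (l.map .bit)) (q' := .back) (mi := .stay) (s := .bit b) (mt := .left)
      (by rw [hb]; simp [transition])
    rwa [NTM.move_stay, min_eq_left hp, ← hb, update_tapeOf_self] at this

/-- The list `pre` collects the bits already passed; each carry moves one more zero into it. -/
theorem reaches_carry {p : ℕ} (hp : p ≤ w.length + 1) (l pre : List Bool) :
    Relation.ReflTransGen (M.toNTM.Step w)
      (M.config .carry p (pre.length + 1) (tapeOf ((pre ++ l).map .bit)))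
      (M.config .count p 0 (tapeOf ((pre ++ binaryInc l).map .bit))) := by
  have hpre : ∀ pre : List Bool, pre.length + 1 =
      (pre.map (Symbol.bit : Bool → M.Symbol)).length + 1 := by simp
  have hlast : ∀ l pre l' : List Bool,
      (tapeOf ((pre ++ l).map .bit) (pre.length + 1) : M.Symbol) = .blank ∨
      (tapeOf ((pre ++ l).map .bit) (pre.length + 1) : M.Symbol) = .bit false →
      l.tail = l' → Relation.ReflTransGen (M.toNTM.Step w)
      (M.config .carry p (pre.length + 1) (tapeOf ((pre ++ l).map .bit)))
      (M.config .count p 0 (tapeOf ((pre ++ true :: l').map .bit))) := by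
    rintro l pre l' h rfl
    refine .head ?_ (reaches_back hp _ pre.length (by simp))
    have := step_of_mem (M := M) (w := w) (q := .carry) (p := p) (h := pre.length + 1)
      (t := tapeOf ((pre ++ l).map .bit)) (q' := .back) (mi := .stay) (s := .bit true)
      (mt := .left) (by rcases h with h | h <;> rw [h] <;> simp [transition])
    rw [NTM.move_stay, min_eq_left hp, List.map_append] at this
    nth_rewrite 3 [hpre] at this
    rw [update_tapeOf] at this
    rw [List.map_append, List.map_append, List.map_cons, List.map_tail]
    exact this
  induction l generalizing pre with
  | nil =>
    refine hlast [] pre [] (.inl ?_) rfl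
    rw [List.map_append, hpre, tapeOf_append]; rfl
  | cons b l ih =>
    cases b with
    | false =>
      refine hlast (false :: l) pre l (.inr ?_) rfl
      rw [List.map_append, hpre, tapeOf_append]; rfl
    | true =>
      refine .head ?_ (by simpa [binaryInc] using ih (pre ++ [false]))
      have := step_of_mem (M := M) (w := w) (q := .carry) (p := p) (h := pre.length + 1)
        (t := tapeOf ((pre ++ true :: l).map .bit)) (q' := .carry) (mi := .stay)
        (s := .bit false) (mt := .right) (by
          rw [List.map_append, hpre, tapeOf_append]; simp [transition])
      rw [NTM.move_stay, min_eq_left hp, List.map_append] at this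
      nth_rewrite 3 [hpre] at this
      rw [update_tapeOf] at this
      simpa [NTM.move_right] using this

theorem reaches_count (n : ℕ) (hn : n ≤ w.length + 1) :
    M.toNTM.Reaches w (M.config .count n 0 (tapeOf ((binary n).map .bit))) := by
  induction n with
  | zero =>
    refine .single ?_
    have := step_of_mem (M := M) (w := w) (q := .init) (p := 0) (h := 0)
      (t := fun _ => .blank) (q' := .count) (mi := .stay) (s := .mark) (mt := .stay)
      (by simp [transition])
    have h2 : Function.update (fun _ => Symbol.blank : ℕ → M.Symbol) 0 .mark = tapeOf [] := by
      funext i; rcases i with _ | i <;> rfl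
    rw [h2] at this
    exact this
  | succ n ih =>
    refine .trans (ih (by omega)) (.head ?_ (reaches_carry hn (binary n) []))
    have := step_of_mem (M := M) (w := w) (q := .count) (p := n) (h := 0)
      (t := tapeOf ((binary n).map .bit)) (q' := .carry) (mi := .right) (s := .mark)
      (mt := .right) (by
        rcases n with _ | n
        · simp [NTM.inputSymbol, transition]
        · have : n < w.length := by omega
          simp [NTM.inputSymbol, transition, this])
    rwa [NTM.move_right n, min_eq_left hn,
      show (.mark : M.Symbol) = tapeOf ((binary n).map .bit) 0 from rfl,
      update_tapeOf_self] at this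

theorem reaches_guess (cs pre : List M.Col) (l : List Bool) (h : cs.length ≤ l.length) :
    ∃ l' : List Bool, Relation.ReflTransGen (M.toNTM.Step w)
      (M.config .guess (w.length + 1) (pre.length + 1) (tapeOf (pre.map .col ++ l.map .bit)))
      (M.config .guess (w.length + 1) ((pre ++ cs).length + 1)
        (tapeOf ((pre ++ cs).map .col ++ l'.map .bit))) := by
  induction cs generalizing pre l with
  | nil => exact ⟨l, by rw [List.append_nil]⟩
  | cons c cs ih =>
    rcases l with _ | ⟨b, l⟩
    · simp at h
    · obtain ⟨l', hl'⟩ := ih (pre ++ [c]) l (by simpa using h)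
      refine ⟨l', .head ?_ (by simpa using hl')⟩
      have hpre : pre.length + 1 = (pre.map (Symbol.col : M.Col → M.Symbol)).length + 1 := by simp
      have := step_of_mem (M := M) (w := w) (q := .guess) (p := w.length + 1)
        (h := pre.length + 1) (t := tapeOf (pre.map .col ++ (b :: l).map .bit)) (q' := .guess)
        (mi := .stay) (s := .col c) (mt := .right) (by
          rw [hpre, tapeOf_append]; simp [transition])
      rw [NTM.move_stay, min_self] at this
      nth_rewrite 3 [hpre] at this
      rw [update_tapeOf] at this
      simpa [NTM.move_right] using this

theorem reaches_rewind_start (cs : List M.Col) (hcs : cs.length ≤ width w) :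
    ∃ g, M.toNTM.Reaches w (M.config (.rewind M.start true) (w.length + 1) cs.length
      (tapeOf (cs.map .col ++ .fin :: g))) := by
  obtain ⟨l', hl'⟩ := reaches_guess (M := M) (w := w) cs [] (binary (w.length + 1)) hcs
  refine ⟨(l'.map .bit).tail, .trans (reaches_count (w.length + 1) le_rfl)
    (.head ?_ (.tail hl' ?_))⟩
  · have := step_of_mem (M := M) (w := w) (q := .count) (p := w.length + 1) (h := 0)
      (t := tapeOf ((binary (w.length + 1)).map .bit)) (q' := .guess) (mi := .stay) (s := .mark)
      (mt := .right) (by simp [NTM.inputSymbol, transition])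
    rwa [NTM.move_stay, min_self,
      show (.mark : M.Symbol) = tapeOf ((binary (w.length + 1)).map .bit) 0 from rfl,
      update_tapeOf_self] at this
  · rw [List.nil_append]
    have hpre : cs.length + 1 = (cs.map (Symbol.col : M.Col → M.Symbol)).length + 1 := by simp
    have := step_of_mem (M := M) (w := w) (q := .guess) (p := w.length + 1)
      (h := cs.length + 1) (t := tapeOf (cs.map .col ++ l'.map .bit))
      (q' := .rewind M.start true) (mi := .stay) (s := .fin) (mt := .left) (by
        rw [hpre, tapeOf_append]
        cases l' <;> simp [transition])
    rw [NTM.move_stay, min_self] at this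
    nth_rewrite 3 [hpre] at this
    rwa [update_tapeOf] at this

theorem reaches_sweep_of_rewind_false (q : M.Control) (p : ℕ) (hp : p ≤ w.length)
    (cs : List M.Col) (g : List M.Symbol) (h : ℕ) (hh : h ≤ cs.length) :
    Relation.ReflTransGen (M.toNTM.Step w)
      (M.config (.rewind q false) (p + 1) h (tapeOf (cs.map .col ++ .fin :: g)))
      (M.config (.sweep q) (p + 1) 1 (tapeOf (cs.map .col ++ .fin :: g))) := by
  induction h with
  | zero =>
    refine .single ?_
    have := step_of_mem (M := M) (w := w) (q := .rewind q false) (p := p + 1) (h := 0)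
      (t := tapeOf (cs.map .col ++ .fin :: g)) (q' := .sweep q) (mi := .stay) (s := .mark)
      (mt := .right) (by simp [transition, tapeOf])
    rwa [NTM.move_stay, min_eq_left (by omega),
      show (.mark : M.Symbol) = tapeOf (cs.map .col ++ .fin :: g) 0 from rfl,
      update_tapeOf_self] at this
  | succ k ih =>
    refine .head ?_ (ih (by omega))
    obtain ⟨c, hc⟩ := tapeOf_map_col (M := M) cs (.fin :: g) (Nat.succ_pos k) hh
    have := step_of_mem (M := M) (w := w) (q := .rewind q false) (p := p + 1) (h := k + 1)
      (t := tapeOf (cs.map .col ++ .fin :: g)) (q' := .rewind q false) (mi := .stay) (s := .col c)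
      (mt := .left) (by rw [hc]; simp [transition])
    rwa [NTM.move_stay, min_eq_left (by omega), ← hc, update_tapeOf_self] at this

theorem reaches_sweep_of_rewind_true (q : M.Control) (i : ℕ) (hi : i ≤ w.length + 1)
    (cs : List M.Col) (g : List M.Symbol) (h : ℕ) (hh : h ≤ cs.length) :
    Relation.ReflTransGen (M.toNTM.Step w)
      (M.config (.rewind q true) i h (tapeOf (cs.map .col ++ .fin :: g)))
      (M.config (.sweep q) 1 1 (tapeOf (cs.map .col ++ .fin :: g))) := by
  induction h generalizing i with
  | zero =>
    induction i with
    | zero =>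
      refine .single ?_
      have := step_of_mem (M := M) (w := w) (q := .rewind q true) (p := 0) (h := 0)
        (t := tapeOf (cs.map .col ++ .fin :: g)) (q' := .sweep q) (mi := .right) (s := .mark)
        (mt := .right) (by simp [transition, tapeOf, NTM.inputSymbol])
      rwa [NTM.move_right 0, min_eq_left (by omega),
        show (.mark : M.Symbol) = tapeOf (cs.map .col ++ .fin :: g) 0 from rfl,
        update_tapeOf_self] at this
    | succ i ih =>
      refine .head ?_ (ih (by omega))
      have := step_of_mem (M := M) (w := w) (q := .rewind q true) (p := i + 1) (h := 0)
        (t := tapeOf (cs.map .col ++ .fin :: g)) (q' := .rewind q true) (mi := .left) (s := .mark)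
        (mt := .stay) (by
          simp only [NTM.inputSymbol]
          split_ifs <;> simp [transition, tapeOf])
      rwa [NTM.move_left, min_eq_left (by omega),
        show (.mark : M.Symbol) = tapeOf (cs.map .col ++ .fin :: g) 0 from rfl,
        update_tapeOf_self] at this
  | succ k ih =>
    refine .head ?_ (ih (i - 1) (by omega) (by omega))
    obtain ⟨c, hc⟩ := tapeOf_map_col (M := M) cs (.fin :: g) (Nat.succ_pos k) hh
    have := step_of_mem (M := M) (w := w) (q := .rewind q true) (p := i) (h := k + 1)
      (t := tapeOf (cs.map .col ++ .fin :: g)) (q' := .rewind q true) (mi := .left) (s := .col c)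
      (mt := .left) (by
        rw [hc]
        rcases i with _ | i
        · simp [transition, NTM.inputSymbol]
        · simp only [NTM.inputSymbol]
          split_ifs <;> simp [transition])
    rwa [NTM.move_left i, min_eq_left (by omega), ← hc, update_tapeOf_self] at this

theorem reaches_sweep {q₀ q : M.Control} {p₀ p : ℕ} {pre pre' : List M.Col}
    (hs : M.Sweep w q₀ p₀ pre q p pre') (hp₀ : p₀ ≤ w.length) (suf : List M.Col)
    (g : List M.Symbol) :
    Relation.ReflTransGen (M.toNTM.Step w)
      (M.config (.sweep q₀) (p₀ + 1) 1 (tapeOf ((pre ++ suf).map .col ++ .fin :: g)))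
      (M.config (.sweep q) (p + 1) (pre'.length + 1)
        (tapeOf (pre'.map .col ++ (suf.map .col ++ .fin :: g)))) := by
  induction hs generalizing suf with
  | nil p => exact .refl
  | @snoc q q' p₀ p cs cs' c c' mv hs hst ih =>
    have h1 := ih hp₀ (c :: suf)
    rw [List.append_assoc, List.singleton_append]
    refine .tail h1 ?_
    have hp := hs.le hp₀
    have hpre : cs'.length + 1 = (cs'.map (Symbol.col : M.Col → M.Symbol)).length + 1 := by simp
    have := step_of_mem (M := M) (w := w) (q := .sweep q) (p := p + 1) (h := cs'.length + 1)
      (t := tapeOf (cs'.map .col ++ ((c :: suf).map .col ++ .fin :: g))) (q' := .sweep q')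
      (mi := if mv then .right else .stay) (s := .col c') (mt := .right) (by
        rw [hpre, tapeOf_append]
        refine ⟨q', mv, c', ?_, rfl⟩
        rwa [letter_inputSymbol])
    have hmove : min (NTM.move (if mv then .right else .stay) (p + 1)) (w.length + 1) =
        advance w mv p + 1 := by
      cases mv <;> simp [NTM.move, advance, hp]
    rw [hmove] at this
    nth_rewrite 3 [hpre] at this
    rw [update_tapeOf] at this
    simpa [NTM.move_right] using this

/-- The Turing machine is about to begin a sweep. -/
def Ready (w : List Bool) (x : M.Control × ℕ × List M.Col) : Prop :=
  ∃ g r i h, h ≤ x.2.2.length ∧ (if r then x.2.1 = 0 ∧ i ≤ w.length + 1 else i = x.2.1 + 1) ∧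
    M.toNTM.Reaches w (M.config (.rewind x.1 r) i h (tapeOf (x.2.2.map .col ++ .fin :: g)))

theorem Ready.round {x y : M.Control × ℕ × List M.Col} (hx : Ready w x)
    (hp : x.2.1 ≤ w.length) (h : M.Round w x y) : Ready w y := by
  obtain ⟨g, r, i, k, hk, hi, hreach⟩ := hx
  obtain ⟨q₀, p₀, cs⟩ := x
  obtain ⟨q', p', cs'⟩ := y
  obtain ⟨q, p, tr, hs, htr, hp'⟩ := h
  dsimp only at *
  have h1 : M.toNTM.Reaches w (M.config (.sweep q₀) (p₀ + 1) 1
      (tapeOf (cs.map .col ++ .fin :: g))) := by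
    refine .trans hreach ?_
    cases r with
    | true =>
      simp only [if_true] at hi
      obtain ⟨rfl, hi⟩ := hi
      exact reaches_sweep_of_rewind_true q₀ i hi cs g k hk
    | false =>
      simp only [Bool.false_eq_true, if_false] at hi
      subst hi
      exact reaches_sweep_of_rewind_false q₀ p₀ hp cs g k hk
  have h2 := reaches_sweep hs hp [] g
  rw [List.append_nil] at h2
  have h3 := h1.trans h2
  have hple := hs.le hp
  have hpre : cs'.length + 1 = (cs'.map (Symbol.col : M.Col → M.Symbol)).length + 1 := by simp
  have hupd : Function.update (tapeOf (cs'.map Symbol.col ++ (([] : List M.Col).map Symbol.col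
      ++ .fin :: g)) : ℕ → M.Symbol) (cs'.length + 1) .fin =
      tapeOf (cs'.map Symbol.col ++ .fin :: g) := by
    rw [hpre, update_tapeOf]; rfl
  have hstep : ∀ r mi, ((State.rewind q' r, mi, Symbol.fin, Move.left) : _ × _ × M.Symbol × _) =
      (match tr with
        | .stay => (.rewind q' false, .stay, .fin, .left)
        | .right => (.rewind q' false, .right, .fin, .left)
        | .reset => (.rewind q' true, .stay, .fin, .left)) →
      M.toNTM.Reaches w (M.config (.rewind q' r) (min (NTM.move mi (p + 1)) (w.length + 1))
        cs'.length (tapeOf (cs'.map .col ++ .fin :: g))) := by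
    intro r mi heq
    refine .tail h3 ?_
    have := step_of_mem (M := M) (w := w) (q := .sweep q) (p := p + 1) (h := cs'.length + 1)
      (t := tapeOf (cs'.map .col ++ (([] : List M.Col).map .col ++ .fin :: g)))
      (q' := .rewind q' r) (mi := mi) (s := .fin) (mt := .left) (by
        rw [hpre, tapeOf_append]
        refine ⟨q', tr, ?_, heq⟩
        rwa [letter_inputSymbol])
    rw [hupd] at this
    exact this
  cases tr with
  | stay =>
    exact ⟨g, false, _, cs'.length, le_rfl, by simp [hp', applyTurn, NTM.move, hple],
      hstep false .stay rfl⟩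
  | right =>
    exact ⟨g, false, _, cs'.length, le_rfl, by simp [hp', applyTurn, NTM.move],
      hstep false .right rfl⟩
  | reset =>
    exact ⟨g, true, _, cs'.length, le_rfl, by simp [hp', applyTurn], hstep true .stay rfl⟩

theorem accepts_toNTM_iff : M.toNTM.Accepts w ↔ M.Accepts w := by
  refine ⟨accepts_of_toNTM, ?_⟩
  rintro ⟨x, ⟨cs, hcs, h⟩, hacc⟩
  have key : Ready w x := by
    clear hacc
    induction h with
    | refl =>
      obtain ⟨g, hg⟩ := reaches_rewind_start (M := M) cs hcs
      exact ⟨g, true, _, _, le_rfl, by simp, hg⟩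
    | @tail y z h1 h2 ih =>
      exact Ready.round ih (Reaches.invariant ⟨cs, hcs, h1⟩).1 h2
  obtain ⟨g, r, i, k, -, -, h⟩ := key
  exact ⟨_, h, x.1, hacc, r, rfl⟩

theorem language_mem_NL (M : SweepMachine) : {w | M.Accepts w} ∈ NL :=
  ⟨M.toNTM, logSpace_toNTM, fun _ => accepts_toNTM_iff.symm⟩

end SweepMachine

theorem SweepMachine.sweep_nil_iff {M : SweepMachine} {w : List Bool} {q₀ q' : M.Control}
    {p₀ p' : ℕ} : M.Sweep w q₀ p₀ [] q' p' [] ↔ q' = q₀ ∧ p' = p₀ := by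
  constructor
  · have : ∀ x y, M.Sweep w q₀ p₀ x q' p' y → x = [] → q' = q₀ ∧ p' = p₀ := by
      intro x y h hx
      cases h with
      | nil => exact ⟨rfl, rfl⟩
      | snoc => simp at hx
    exact fun h => this _ _ h rfl
  · rintro ⟨rfl, rfl⟩
    exact .nil _ _

theorem SweepMachine.sweep_snoc_iff {M : SweepMachine} {w : List Bool} {q₀ q' : M.Control}
    {p₀ p' : ℕ} {cs cs' : List M.Col} {c c' : M.Col} :
    M.Sweep w q₀ p₀ (cs ++ [c]) q' p' (cs' ++ [c']) ↔ ∃ q p mv, M.Sweep w q₀ p₀ cs q p cs' ∧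
      (q', mv, c') ∈ M.step q w[p]? c ∧ p' = advance w mv p := by
  constructor
  · intro h
    generalize hx : cs ++ [c] = x at h
    generalize hy : cs' ++ [c'] = y at h
    cases h with
    | nil => simp at hx
    | snoc h1 h2 =>
      obtain ⟨rfl, hc⟩ := List.append_inj' hx rfl
      obtain ⟨rfl, hc'⟩ := List.append_inj' hy rfl
      rw [List.singleton_inj] at hc hc'
      subst hc hc'
      exact ⟨_, _, _, h1, h2, rfl⟩
  · rintro ⟨q, p, mv, h1, h2, rfl⟩
    exact .snoc h1 h2

/-! ### Register machines on top of sweep machines. -/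

/-- What is written to a register. -/
inductive Source (R : Type) where
  | zero
  | reg (z : R)
  | succ (z : R)
  | guess
  | input

/-- Nondeterministic machines whose registers hold numbers with a common number of bits, and which
read the input from left to right. An instruction tests the equality of registers, and overwrites
all registers at the same time. -/
structure RegisterMachine where
  Label : Type
  Reg : Type
  [finiteLabel : Finite Label]
  [finiteReg : Finite Reg]
  start : Label
  accept : Set Label
  test : Label → Set (Reg × Reg)
  update : Label → Reg → Source Reg
  /-- does the instruction consume as many letters of the input as there are bits? -/
  reads : Label → Bool
  reads_of_input : ∀ l u, update l u = .input → reads l = true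
  /-- the registers whose most significant bit has to be one -/
  full : Label → Set Reg
  next : Label → Option Bool → Set (Label × Turn)

attribute [instance] RegisterMachine.finiteLabel RegisterMachine.finiteReg

namespace RegisterMachine

variable (M : RegisterMachine)

/-- The states in which a sweep starts: a carry for every register that is going to be
incremented, and no most significant bit so far. -/
def control (l : M.Label) : M.Label × (M.Reg → Bool) × (M.Reg → Bool) :=
  (l, fun u => match M.update l u with
    | .succ _ => true
    -- With no bits at all the only number is `0`, and `2 ^ 0 ≤ 2 * 0 + 1` holds; hence this flag
    -- starts as true.
    | _ => false, fun _ => true)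

/-- The registers are stored on the tape bit by bit. -/
def toSweepMachine : SweepMachine where
  Control := M.Label × (M.Reg → Bool) × (M.Reg → Bool)
  Col := M.Reg → Bool
  start := M.control M.start
  accept := {q | q.1 ∈ M.accept}
  step q i c := {y | y.1 = (q.1, fun u => match M.update q.1 u with
      | .succ z => c z && q.2.1 u
      | _ => false, y.2.2) ∧
    y.2.1 = M.reads q.1 ∧ (M.reads q.1 = true → i.isSome) ∧ (∀ z ∈ M.test q.1, c z.1 = c z.2) ∧
    ∀ u, match M.update q.1 u with
      | .zero => y.2.2 u = false
      | .reg z => y.2.2 u = c z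
      | .succ z => y.2.2 u = (c z ^^ q.2.1 u)
      | .guess => True
      | .input => i = some (y.2.2 u)}
  -- A carry left over at the end is an overflow and blocks the run.
  turn q i := {y | (∀ u, q.2.1 u = false) ∧ (∀ u ∈ M.full q.1, q.2.2 u = true) ∧
    ∃ l, y.1 = M.control l ∧ (l, y.2) ∈ M.next q.1 i}

/-- One step, with `b` bits in every register. -/
def Step (b : ℕ) (w : List Bool) (x y : M.Label × ℕ × (M.Reg → ℕ)) : Prop :=
  (∀ z ∈ M.test x.1, x.2.2 z.1 = x.2.2 z.2) ∧
  (∀ u, match M.update x.1 u with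
    | .zero => y.2.2 u = 0
    | .reg z => y.2.2 u = x.2.2 z
    | .succ z => y.2.2 u = x.2.2 z + 1
    | .guess => True
    | .input => ∀ i < b, w[x.2.1 + i]? = some ((y.2.2 u).testBit i)) ∧
  (∀ u, y.2.2 u < 2 ^ b) ∧
  (∀ u ∈ M.full x.1, 2 ^ b ≤ 2 * y.2.2 u + 1) ∧
  (M.reads x.1 = true → x.2.1 + b ≤ w.length) ∧
  ∃ tr, (y.1, tr) ∈ M.next x.1 w[x.2.1 + if M.reads x.1 then b else 0]? ∧
    y.2.1 = SweepMachine.applyTurn w tr (x.2.1 + if M.reads x.1 then b else 0)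

/-- The columns that hold the given numbers. -/
def cols (j : ℕ) (v : M.Reg → ℕ) : List (M.Reg → Bool) :=
  (List.range j).map fun i u => (v u).testBit i

variable {M}

@[simp] theorem length_cols (j : ℕ) (v : M.Reg → ℕ) : (M.cols j v).length = j := by simp [cols]

theorem cols_succ (j : ℕ) (v : M.Reg → ℕ) :
    M.cols (j + 1) v = M.cols j v ++ [fun u => (v u).testBit j] := by
  simp [cols, List.range_succ]

theorem exists_cols {j : ℕ} (cs : List (M.Reg → Bool)) (h : cs.length = j) :
    ∃ v : M.Reg → ℕ, (∀ u, v u < 2 ^ j) ∧ cs = M.cols j v := by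
  subst h
  refine ⟨fun u => Nat.ofBits fun i : Fin cs.length => cs[i] u, fun u => Nat.ofBits_lt_two_pow _,
    ?_⟩
  unfold cols
  refine List.ext_getElem (by simp) fun i h1 h2 => funext fun u => ?_
  simp [Nat.testBit_ofBits_lt _ _ h1]

/-- Adding one flips bit `j` exactly when all lower bits are ones. -/
theorem testBit_succ_eq_xor (n j : ℕ) :
    (n + 1).testBit j = (n.testBit j ^^ decide (n % 2 ^ j + 1 = 2 ^ j)) := by
  have hdvd : 2 ^ j ∣ n + 1 ↔ n % 2 ^ j + 1 = 2 ^ j := by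
    have h1 := Nat.mod_add_div n (2 ^ j)
    have h2 := Nat.mod_lt n (Nat.two_pow_pos j)
    constructor
    · intro h
      have h3 : 2 ^ j ∣ n % 2 ^ j + 1 :=
        (Nat.dvd_add_left (Nat.dvd_mul_right (2 ^ j) (n / 2 ^ j))).1 (by
          rwa [show n % 2 ^ j + 1 + 2 ^ j * (n / 2 ^ j) = n + 1 by omega])
      have := Nat.le_of_dvd (by omega) h3
      omega
    · intro h
      exact ⟨n / 2 ^ j + 1, by rw [mul_add]; omega⟩
  rw [Nat.testBit_eq_decide_div_mod_eq, Nat.testBit_eq_decide_div_mod_eq, Nat.succ_div]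
  by_cases h : n % 2 ^ j + 1 = 2 ^ j
  · rw [if_pos (hdvd.2 h)]
    rcases Nat.mod_two_eq_zero_or_one (n / 2 ^ j) with h' | h' <;>
      simp [h, h', Nat.add_mod]
  · rw [if_neg (mt hdvd.1 h)]
    simp [h]

theorem decide_mod_two_pow_succ (n j : ℕ) :
    decide (n % 2 ^ (j + 1) + 1 = 2 ^ (j + 1)) =
      (n.testBit j && decide (n % 2 ^ j + 1 = 2 ^ j)) := by
  have h2 := Nat.mod_lt n (Nat.two_pow_pos j)
  rw [Nat.mod_pow_succ, Nat.testBit_eq_decide_div_mod_eq, ← Bool.decide_and, decide_eq_decide,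
    pow_succ]
  rcases Nat.mod_two_eq_zero_or_one (n / 2 ^ j) with h | h <;> rw [h] <;> omega

/-- The state after the `j` lowest bits: the carry says that these bits of the incremented register
are all ones, and the last component remembers the most recent bit written. -/
theorem sweep_cols_iff (w : List Bool) (l : M.Label) (p : ℕ) (hp : p ≤ w.length) (j : ℕ)
    (v v' : M.Reg → ℕ) (q : M.toSweepMachine.Control) (p' : ℕ) :
    M.toSweepMachine.Sweep w (M.control l) p (M.cols j v) q p' (M.cols j v') ↔
      q = (l, fun u => match M.update l u with
        | .succ z => decide (v z % 2 ^ j + 1 = 2 ^ j)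
        | _ => false, fun u => decide (j = 0) || (v' u).testBit (j - 1)) ∧
      p' = p + (if M.reads l then j else 0) ∧
      (M.reads l = true → p + j ≤ w.length) ∧
      ∀ i < j, (∀ z ∈ M.test l, (v z.1).testBit i = (v z.2).testBit i) ∧
        ∀ u, match M.update l u with
          | .zero => (v' u).testBit i = false
          | .reg z => (v' u).testBit i = (v z).testBit i
          | .succ z => (v' u).testBit i = (v z + 1).testBit i
          | .guess => True
          | .input => w[p + i]? = some ((v' u).testBit i) := by
  induction j generalizing q p' with
  | zero =>
    refine SweepMachine.sweep_nil_iff.trans ?_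
    have : (M.control l) = (l, fun u => match M.update l u with
        | .succ z => decide (v z % 2 ^ 0 + 1 = 2 ^ 0)
        | _ => false, fun u => decide (0 = 0) || (v' u).testBit (0 - 1)) := by
      unfold control
      simp [Nat.mod_one]
    rw [← this]
    simp [hp]
  | succ j ih =>
    rw [cols_succ, cols_succ]
    refine SweepMachine.sweep_snoc_iff.trans ⟨?_, ?_⟩
    · rintro ⟨q1, p1, mv, h1, h2, rfl⟩
      obtain ⟨rfl, rfl, h3, h4⟩ := (ih _ _).1 h1
      obtain ⟨h5, rfl, h6, h7, h8⟩ := h2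
      dsimp only at *
      subst h5
      refine ⟨?_, ?_, ?_, ?_⟩
      · congr 1
        congr 1
        · funext u
          cases M.update l u <;> simp only
          rw [decide_mod_two_pow_succ]
      · unfold SweepMachine.advance
        split_ifs with h
        · have := h3 h
          have := h6 h
          simp only [h, if_true, isSome_getElem?] at this
          rw [min_eq_left (by omega)]
          omega
        · rfl
      · intro h
        have := h6 h
        rw [if_pos h] at this
        simp at this
        omega
      · intro i hi
        rcases Nat.lt_succ_iff_lt_or_eq.1 hi with hi | rfl
        · exact h4 i hi
        · refine ⟨h7, fun u => ?_⟩
          have := h8 u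
          revert this
          cases h : M.update l u <;> simp only <;> intro h'
          · exact h'
          · exact h'
          · rw [h', testBit_succ_eq_xor]
          · trivial
          · rwa [if_pos (M.reads_of_input _ _ h)] at h'
    · rintro ⟨rfl, rfl, h3, h4⟩
      have hle : p + (if M.reads l then j else 0) ≤ w.length := by
        split_ifs with h
        · have := h3 h; omega
        · exact hp
      refine ⟨_, _, M.reads l, (ih _ _).2 ⟨rfl, rfl, fun h => ?_, fun i hi => h4 i (by omega)⟩,
        ⟨?_, rfl, ?_, (h4 j (by omega)).1, ?_⟩, ?_⟩
      · have := h3 h; omega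
      · dsimp only
        congr 1
        congr 1
        · funext u
          cases M.update l u <;> simp only
          rw [decide_mod_two_pow_succ]
      · intro h
        have := h3 h
        simp [h]; omega
      · intro u
        have := (h4 j (by omega)).2 u
        revert this
        dsimp only
        cases h : M.update l u <;> simp only <;> intro h'
        · exact h'
        · exact h'
        · rw [h', testBit_succ_eq_xor]
        · trivial
        · rwa [if_pos (M.reads_of_input _ _ h)]
      · unfold SweepMachine.advance
        split_ifs with h
        · have := h3 h
          rw [min_eq_left (by omega)]; omega
        · rfl

theorem testBit_eq_iff_of_lt {b n m : ℕ} (hn : n < 2 ^ b) (hm : m < 2 ^ b) :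
    (∀ i < b, n.testBit i = m.testBit i) ↔ n = m := by
  refine ⟨fun h => Nat.eq_of_testBit_eq fun i => ?_, fun h i _ => by rw [h]⟩
  rcases lt_or_ge i b with hi | hi
  · exact h i hi
  · have := Nat.pow_le_pow_right (n := 2) (by norm_num) hi
    rw [Nat.testBit_lt_two_pow (by omega), Nat.testBit_lt_two_pow (by omega)]

/-- This inequality expresses that the top bit is one, in a form that is also right for `b = 0`. -/
theorem two_pow_le_two_mul_add_one_iff {b n : ℕ} (hn : n < 2 ^ b) :
    2 ^ b ≤ 2 * n + 1 ↔ (decide (b = 0) || n.testBit (b - 1)) = true := by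
  rcases b with _ | k
  · simp
  · rw [Nat.add_sub_cancel, Nat.testBit_eq_decide_div_mod_eq]
    rw [pow_succ] at hn ⊢
    have h2 : n / 2 ^ k < 2 := Nat.div_lt_of_lt_mul hn
    have h3 : 1 ≤ n / 2 ^ k ↔ 2 ^ k ≤ n := by
      rw [Nat.le_div_iff_mul_le (Nat.two_pow_pos k), one_mul]
    simp only [Nat.add_eq_zero_iff, one_ne_zero, and_false, decide_false, Bool.false_or,
      decide_eq_true_eq]
    rcases Nat.lt_or_ge n (2 ^ k) with h | h
    · rw [Nat.div_eq_of_lt h]; omega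
    · have := h3.2 h; omega

theorem round_iff (b : ℕ) (w : List Bool) (x y : M.Label × ℕ × (M.Reg → ℕ))
    (hx : ∀ u, x.2.2 u < 2 ^ b) (hp : x.2.1 ≤ w.length) (hy : ∀ u, y.2.2 u < 2 ^ b) :
    M.toSweepMachine.Round w (M.control x.1, x.2.1, M.cols b x.2.2)
      (M.control y.1, y.2.1, M.cols b y.2.2) ↔ M.Step b w x y := by
  obtain ⟨l, p, v⟩ := x
  obtain ⟨l', p', v'⟩ := y
  dsimp only at hx hp hy
  constructor
  · rintro ⟨q, p1, tr, h1, ⟨h2, h3, l1, h4, h5⟩, h6⟩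
    obtain ⟨rfl, rfl, h7, h8⟩ := (sweep_cols_iff w l p hp b v v' q p1).1 h1
    dsimp only at *
    obtain rfl : l' = l1 := congrArg Prod.fst h4
    refine ⟨fun z hz => (testBit_eq_iff_of_lt (hx _) (hx _)).1 fun i hi => (h8 i hi).1 z hz,
      fun u => ?_, hy, fun u hu => (two_pow_le_two_mul_add_one_iff (hy u)).2 (h3 u hu), h7, tr, h5,
      h6⟩
    have h9 := fun i hi => (h8 i hi).2 u
    have h10 := h2 u
    revert h9 h10
    dsimp only
    cases M.update l u <;> simp only [decide_eq_false_iff_not] <;> intro h9 h10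
    · exact (testBit_eq_iff_of_lt (hy u) (Nat.two_pow_pos b)).1 fun i hi => by
        rw [h9 i hi, Nat.zero_testBit]
    · exact (testBit_eq_iff_of_lt (hy u) (hx _)).1 h9
    · rename_i z
      have := hx z
      rw [Nat.mod_eq_of_lt this] at h10
      exact (testBit_eq_iff_of_lt (hy u) (by omega)).1 h9
    · trivial
    · exact h9
  · rintro ⟨h1, h2, -, h4, h5, tr, h6, h7⟩
    dsimp only at *
    refine ⟨_, _, tr, (sweep_cols_iff w l p hp b v v' _ _).2 ⟨rfl, rfl, h5, fun i hi =>
      ⟨fun z hz => by rw [h1 z hz], fun u => ?_⟩⟩, ⟨fun u => ?_, fun u hu => ?_, l', rfl, h6⟩, h7⟩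
    · have := h2 u
      revert this
      cases M.update l u <;> simp only <;> intro h
      · rw [h, Nat.zero_testBit]
      · rw [h]
      · rw [h]
      · trivial
      · exact h i hi
    · have := h2 u
      revert this
      dsimp only
      rcases M.update l u with _ | _ | z | _ | _ <;> simp only [decide_eq_false_iff_not] <;>
        intro h <;> try trivial
      have := hx z
      rw [Nat.mod_eq_of_lt this]
      have := hy u
      omega
    · exact (two_pow_le_two_mul_add_one_iff (hy u)).1 (h4 u hu)

/-- Reachable from the start with numbers chosen at will. -/
def Reaches (b : ℕ) (w : List Bool) (x : M.Label × ℕ × (M.Reg → ℕ)) : Prop :=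
  ∃ v : M.Reg → ℕ, (∀ u, v u < 2 ^ b) ∧ Relation.ReflTransGen (M.Step b w) (M.start, 0, v) x

theorem Step.le {b : ℕ} {w : List Bool} {x y : M.Label × ℕ × (M.Reg → ℕ)}
    (h : M.Step b w x y) (hx : x.2.1 ≤ w.length) : y.2.1 ≤ w.length := by
  obtain ⟨-, -, -, -, h, tr, -, h'⟩ := h
  rw [h']
  refine SweepMachine.applyTurn_le ?_
  split_ifs with hr
  · exact h hr
  · exact hx

/-- The number of bits is the number of guessed columns and hence arbitrary up to the width. -/
theorem accepts_iff (w : List Bool) : M.toSweepMachine.Accepts w ↔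
    ∃ b ≤ SweepMachine.width w, ∃ x, M.Reaches b w x ∧ x.1 ∈ M.accept := by
  constructor
  · rintro ⟨y, ⟨cs, hcs, h⟩, hacc⟩
    obtain ⟨v₀, hv₀, hcs₀⟩ := exists_cols (M := M) cs rfl
    refine ⟨cs.length, hcs, ?_⟩
    have key : ∃ l p v, y = (M.control l, p, M.cols cs.length v) ∧ (∀ u, v u < 2 ^ cs.length) ∧
        p ≤ w.length ∧ M.Reaches cs.length w (l, p, v) := by
      clear hacc
      induction h with
      | refl => exact ⟨M.start, 0, v₀, congrArg (Prod.mk _ <| Prod.mk _ ·) hcs₀, hv₀, Nat.zero_le _, v₀, hv₀, .refl⟩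
      | @tail y z _ h ih =>
        obtain ⟨l, p, v, rfl, hv, hp, v₁, hv₁, hr⟩ := ih
        obtain ⟨l', hl'⟩ : ∃ l', z.1 = M.control l' := by
          obtain ⟨q, p1, tr, -, ⟨-, -, l', h, -⟩, -⟩ := h
          exact ⟨l', h⟩
        have hlen : z.2.2.length = cs.length := by
          obtain ⟨q, p1, tr, h, -, -⟩ := h
          exact h.length_eq.trans (length_cols _ _)
        obtain ⟨v', hv', hz⟩ := exists_cols (M := M) z.2.2 hlen
        have hz' : z = (M.control l', z.2.1, M.cols cs.length v') :=
          Prod.ext hl' (Prod.ext rfl hz)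
        rw [hz'] at h
        have hs := (round_iff cs.length w (l, p, v) (l', z.2.1, v') hv hp hv').1 h
        exact ⟨l', z.2.1, v', hz', hv', hs.le hp, v₁, hv₁, hr.tail hs⟩
    obtain ⟨l, p, v, rfl, -, -, hr⟩ := key
    exact ⟨_, hr, hacc⟩
  · rintro ⟨b, hb, y, ⟨v₀, hv₀, h⟩, hacc⟩
    refine ⟨(M.control y.1, y.2.1, M.cols b y.2.2), ⟨M.cols b v₀, (length_cols b v₀).trans_le hb, ?_⟩,
      hacc⟩
    have key : (∀ u, y.2.2 u < 2 ^ b) ∧ y.2.1 ≤ w.length ∧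
        Relation.ReflTransGen (M.toSweepMachine.Round w)
          (M.toSweepMachine.start, 0, M.cols b v₀) (M.control y.1, y.2.1, M.cols b y.2.2) := by
      clear hacc
      induction h with
      | refl => exact ⟨hv₀, Nat.zero_le _, .refl⟩
      | @tail y z _ h ih =>
        obtain ⟨h1, h2, h3⟩ := ih
        exact ⟨h.2.2.1, h.le h2, h3.tail ((round_iff b w y z h1 h2 h.2.2.1).2 h)⟩
    exact key.2.2

theorem language_mem_NL (M : RegisterMachine) :
    {w | ∃ b ≤ SweepMachine.width w, ∃ x, M.Reaches b w x ∧ x.1 ∈ M.accept} ∈ NL := by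
  convert SweepMachine.language_mem_NL M.toSweepMachine using 1
  exact Set.ext fun w => (accepts_iff w).symm

end RegisterMachine

/-! ### The machine for Cayley semigroup membership. -/

/-- The registers of the machine for Cayley semigroup membership: the last element of the
semigroup, a product of generators, a generator, the product of the two, and the row and column of
the current entry of the table. -/
inductive MembershipReg where
  | last
  | left
  | gen
  | prod
  | row
  | col

/-- How to continue after an entry of the table. -/
inductive Advance where
  | inc
  | wrap
  | fin

/-- The labels of the machine for Cayley semigroup membership. In a pass over the table the flags
tell if the product of `left` and `gen` has been found, and if the current entry is used for this.
In the following pass over the characteristic vector the flags tell if `gen` has been verified,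
if the current entry is used for this, and if it is the last one. -/
inductive MembershipLabel where
  | init
  | restart
  | entry (done use : Bool) (adv : Advance)
  | char (done use fin : Bool)
  | target
  | found
  | accept

instance : Finite MembershipReg := by
  let f : MembershipReg → Fin 6 := fun
    | .last => 0
    | .left => 1
    | .gen => 2
    | .prod => 3
    | .row => 4
    | .col => 5
  refine Finite.of_injective f fun x y h => ?_
  cases x <;> cases y <;> first | rfl | exact absurd h (by decide)

instance : Finite Advance := by
  let f : Advance → Fin 3 := fun
    | .inc => 0
    | .wrap => 1
    | .fin => 2
  refine Finite.of_injective f fun x y h => ?_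
  cases x <;> cases y <;> first | rfl | exact absurd h (by decide)

instance : Finite MembershipLabel := by
  let f : MembershipLabel → Fin 5 ⊕ (Bool × Bool × Advance) ⊕ Bool × Bool × Bool := fun
    | .init => .inl 0
    | .restart => .inl 1
    | .target => .inl 2
    | .found => .inl 3
    | .accept => .inl 4
    | .entry d u a => .inr (.inl (d, u, a))
    | .char d u g => .inr (.inr (d, u, g))
  refine Finite.of_injective f fun x y h => ?_
  cases x <;> cases y <;> simp_all [f]

/-- The registers whose equality is tested. -/
def membershipTest : MembershipLabel → Set (MembershipReg × MembershipReg)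
  | .entry _ u a => {z | u = true ∧ (z = (.row, .left) ∨ z = (.col, .gen)) ∨
      a ≠ .inc ∧ z = (.col, .last) ∨ a = .fin ∧ z = (.row, .last)}
  | .char _ u f => {z | u = true ∧ z = (.col, .gen) ∨ f = true ∧ z = (.col, .last)}
  | .found => {(.left, .prod)}
  | _ => ∅

/-- What is written to the registers. -/
def membershipUpdate : MembershipLabel → MembershipReg → Source MembershipReg
  | .init, .prod => .reg .gen
  | .init, .row => .zero
  | .init, .col => .zero
  | .restart, .left => .reg .prod
  | .restart, .gen => .guess
  | .restart, .row => .zero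
  | .restart, .col => .zero
  | .entry _ true _, .prod => .input
  | .entry _ _ .inc, .col => .succ .col
  | .entry _ _ .wrap, .col => .zero
  | .entry _ _ .wrap, .row => .succ .row
  | .entry _ _ .fin, .col => .zero
  | .char _ _ false, .col => .succ .col
  -- After the table has been read, `left` is free and receives the target.
  | .target, .left => .input
  | _, z => .reg z

/-- The next label. -/
def membershipNext : MembershipLabel → Option Bool → Set (MembershipLabel × Turn)
  -- The first product is the first generator itself, so no table entry is used in the first pass.
  | .init, _ => {y | y.2 = .stay ∧ ∃ a, y.1 = .entry true false a}
  | .restart, _ => {y | y.2 = .stay ∧ ∃ u a, y.1 = .entry false u a}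
  | .entry d u .fin, _ => {y | (d || u) = true ∧ y.2 = .stay ∧ ∃ u' f, y.1 = .char false u' f}
  | .entry d u _, _ => {y | y.2 = .stay ∧
      ∃ u' a, y.1 = .entry (d || u) u' a ∧ ((d || u) = true → u' = false)}
  | .char d u true, some i => {y | (u = true → i = true) ∧ y.2 = .right ∧
      (d || u) = true ∧ y.1 = .target}
  | .char d u false, some i => {y | (u = true → i = true) ∧ y.2 = .right ∧
      ∃ u' f, y.1 = .char (d || u) u' f}
  -- The input must end exactly here, which confirms the guessed number of elements. Then the
  -- product is compared with the target or multiplied once more.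
  | .target, none => {(.found, .stay), (.restart, .reset)}
  | .found, _ => {(.accept, .stay)}
  | _, _ => ∅

/-- A machine for Cayley semigroup membership. The product of generators in the register `prod` is
multiplied with one generator after another, where each multiplication takes a pass over the
input. -/
def membershipMachine : RegisterMachine where
  Label := MembershipLabel
  Reg := MembershipReg
  start := .init
  accept := {.accept}
  test := membershipTest
  update := membershipUpdate
  reads
    | .entry _ _ _ => true
    | .target => true
    | _ => false
  reads_of_input l u h := by
    rcases l with _ | _ | ⟨_, _ | _, _ | _ | _⟩ | ⟨_, _, _ | _⟩ | _ | _ | _ <;> cases u <;>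
      first | rfl | exact absurd h (by simp [membershipUpdate])
  full
    | .init => {.last}
    | _ => ∅
  next := membershipNext

/-- With the top bit of `last` equal to one, the register width is the length of an encoded element
of a semigroup with `last + 1` elements. -/
theorem clog_two_succ_of_two_pow_le {b n : ℕ} (h : 2 ^ b ≤ 2 * n + 1) (h' : n < 2 ^ b) :
    Nat.clog 2 (n + 1) = b := by
  refine le_antisymm (Nat.clog_le_of_le_pow h') ?_
  by_contra! hlt
  have h1 := Nat.le_pow_clog (b := 2) (by norm_num) (n + 1)
  have h2 : 2 ^ (Nat.clog 2 (n + 1) + 1) ≤ 2 ^ b := Nat.pow_le_pow_right (by norm_num) hlt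
  rw [pow_succ] at h2
  omega

/-! ### Soundness of the machine. -/

section Soundness

variable (S : FinSemigroup) {N : ℕ} (e : S.Carrier ≃ Fin N) (X : Set S.Carrier) (t : S.Carrier)

/-- The number of an element of the given set. -/
def IsNumberOf (A : Set S.Carrier) (n : ℕ) : Prop := ∃ h : n < N, e.symm ⟨n, h⟩ ∈ A

/-- The contents of the registers, and the position in the input, at every label. -/
def MembershipInvariant (b : ℕ) : MembershipLabel → ℕ → (MembershipReg → ℕ) → Prop
  | .init, p, _ => p = 0
  | .restart, p, v => p = 0 ∧ 2 ^ b ≤ 2 * v .last + 1 ∧ v .last + 1 = N ∧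
      IsNumberOf S e (Subsemigroup.closure X) (v .prod)
  -- The guess of `last` is confirmed only at the end of a pass, so until then the semantic claims
  -- are conditional on it. Likewise `gen` is verified only after its use in the table.
  | .entry d u _, p, v => 2 ^ b ≤ 2 * v .last + 1 ∧ p = (v .row * (v .last + 1) + v .col) * b ∧
      (d = true → u = false) ∧
      (v .last + 1 = N → (d = true → IsNumberOf S e X (v .gen) →
        IsNumberOf S e (Subsemigroup.closure X) (v .prod)) ∧
        (d = false → IsNumberOf S e (Subsemigroup.closure X) (v .left)))
  | .char d _ _, p, v => 2 ^ b ≤ 2 * v .last + 1 ∧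
      p = (v .last + 1) * (v .last + 1) * b + v .col ∧
      (v .last + 1 = N → IsNumberOf S e X (v .gen) →
        IsNumberOf S e (Subsemigroup.closure X) (v .prod)) ∧
      -- Without the bound on `col`, the pass might have run past the characteristic vector.
      (v .last + 1 = N → v .col ≤ v .last + 1 → d = true → IsNumberOf S e X (v .gen))
  | .target, p, v => 2 ^ b ≤ 2 * v .last + 1 ∧
      p = (v .last + 1) * (v .last + 1) * b + (v .last + 1) ∧
      (v .last + 1 = N → IsNumberOf S e (Subsemigroup.closure X) (v .prod))
  | .found, _, v => v .left = e t ∧ IsNumberOf S e (Subsemigroup.closure X) (v .prod)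
  | .accept, _, _ => t ∈ Subsemigroup.closure X

variable {S e X t}

theorem isNumberOf_of_eq {A : Set S.Carrier} {m : ℕ} {z : S.Carrier} (h : m = e z) (hz : z ∈ A) :
    IsNumberOf S e A m := by
  subst h
  exact ⟨(e z).2, by simpa using hz⟩

theorem eq_of_testBit_eq_letter {w : List Bool} {p m : ℕ} {z : Fin N}
    (hm : m < 2 ^ Nat.clog 2 N) (h : ∀ i < Nat.clog 2 N, w[p + i]? = some (m.testBit i))
    (h' : ∀ i < Nat.clog 2 N, w[p + i]? = some (z.val.testBit i)) : m = z := by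
  refine (RegisterMachine.testBit_eq_iff_of_lt hm (z.2.trans_le (Nat.le_pow_clog (by norm_num) N))).1 fun i hi => ?_
  have := (h i hi).symm.trans (h' i hi)
  simpa using this

/-- The invariant for the product, after an entry of the table. -/
theorem isNumberOf_prod_of_entry {d u : Bool} {v v' : MembershipReg → ℕ} {p b : ℕ}
    (hb : Nat.clog 2 (v .last + 1) = b) (hp : p = (v .row * (v .last + 1) + v .col) * b)
    (hdu : d = true → u = false)
    (hv : v .last + 1 = N → (d = true → IsNumberOf S e X (v .gen) →
      IsNumberOf S e (Subsemigroup.closure X) (v .prod)) ∧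
      (d = false → IsNumberOf S e (Subsemigroup.closure X) (v .left)))
    (hrow : u = true → v .row = v .left) (hcol : u = true → v .col = v .gen)
    (hin : u = true → ∀ i < b, (encodeInstance S e X t)[p + i]? = some ((v' .prod).testBit i))
    (hprod : u = false → v' .prod = v .prod) (hlt : v' .prod < 2 ^ b)
    (hgen : v' .gen = v .gen) (hleft : v' .left = v .left) (hN : v .last + 1 = N) :
    (((d || u) = true) → IsNumberOf S e X (v' .gen) →
      IsNumberOf S e (Subsemigroup.closure X) (v' .prod)) ∧
      ((d || u) = false → IsNumberOf S e (Subsemigroup.closure X) (v' .left)) := by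
  rw [hgen, hleft]
  obtain ⟨hv1, hv2⟩ := hv hN
  cases u with
  | false =>
    rw [Bool.or_false, hprod rfl]
    exact ⟨hv1, hv2⟩
  | true =>
    rw [Bool.or_true]
    refine ⟨fun _ hg => ?_, fun h => absurd h (by simp)⟩
    have hd : d = false := by
      cases d
      · rfl
      · exact absurd (hdu rfl) (by simp)
    obtain ⟨hl1, hl2⟩ := hv2 hd
    obtain ⟨hg1, hg2⟩ := hg
    rw [hN] at hb hp
    subst hb
    refine isNumberOf_of_eq (z := e.symm ⟨_, hl1⟩ * e.symm ⟨_, hg1⟩) ?_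
      (mul_mem hl2 (Subsemigroup.subset_closure hg2))
    refine eq_of_testBit_eq_letter hlt (hin rfl) fun i hi => ?_
    rw [hp, hrow rfl, hcol rfl]
    exact getElem?_encodeInstance_table S e X t ⟨_, hl1⟩ ⟨_, hg1⟩ hi

theorem MembershipInvariant.step {b p p' : ℕ} {l l' : MembershipLabel} {v v' : MembershipReg → ℕ}
    (h : membershipMachine.Step b (encodeInstance S e X t) (l, p, v) (l', p', v'))
    (hx : MembershipInvariant S e X t b l p v) (hv : ∀ u, v u < 2 ^ b) :
    MembershipInvariant S e X t b l' p' v' := by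
  obtain ⟨h1, h2, h3, h4, h5, tr, h6, h7⟩ := h
  dsimp only at *
  cases l with
  | init =>
    obtain ⟨rfl : tr = _, a, rfl : l' = _⟩ := h6
    have e1 : v' .gen = v .gen := h2 .gen
    have e2 : v' .prod = v .gen := h2 .prod
    have e3 : v' .row = 0 := h2 .row
    have e4 : v' .col = 0 := h2 .col
    have e5 : 2 ^ b ≤ 2 * v' .last + 1 := h4 .last rfl
    obtain rfl : p = 0 := hx
    obtain rfl : p' = 0 := h7
    refine ⟨e5, by simp [e3, e4], fun _ => rfl, fun _ => ⟨fun _ h => ?_, fun h => absurd h (by simp)⟩⟩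
    rw [e1] at h
    rw [e2]
    obtain ⟨h, h'⟩ := h
    exact ⟨h, Subsemigroup.subset_closure h'⟩
  | restart =>
    obtain ⟨rfl : tr = _, u, a, rfl : l' = _⟩ := h6
    have e1 : v' .left = v .prod := h2 .left
    have e2 : v' .last = v .last := h2 .last
    have e3 : v' .row = 0 := h2 .row
    have e4 : v' .col = 0 := h2 .col
    obtain ⟨rfl, g1, g2, g3⟩ := hx
    obtain rfl : p' = 0 := h7
    refine ⟨by rwa [e2], by simp [e3, e4], fun h => absurd h (by simp),
      fun _ => ⟨fun h => absurd h (by simp), fun _ => by rwa [e1]⟩⟩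
  | entry d u a =>
    obtain ⟨g1, g2, g3, g4⟩ := hx
    have e1 : v' .last = v .last := by
      have := h2 .last
      cases u <;> cases a <;> exact this
    have key := isNumberOf_prod_of_entry (v' := v') (clog_two_succ_of_two_pow_le g1 (hv _)) g2 g3 g4
      (fun hu => h1 (.row, .left) (.inl ⟨hu, .inl rfl⟩))
      (fun hu => h1 (.col, .gen) (.inl ⟨hu, .inr rfl⟩))
      (fun hu => by subst hu; exact h2 .prod)
      (fun hu => by subst hu; have := h2 .prod; cases a <;> exact this)
      (h3 _)
      (by have := h2 .gen; cases u <;> cases a <;> exact this)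
      (by have := h2 .left; cases u <;> cases a <;> exact this)
    have h7' : p' = SweepMachine.applyTurn (encodeInstance S e X t) tr (p + b) := h7
    cases a with
    | inc =>
      obtain ⟨rfl : tr = _, u', a, rfl : l' = _, h8⟩ := h6
      have e2 : v' .row = v .row := by have := h2 .row; cases u <;> exact this
      have e3 : v' .col = v .col + 1 := by have := h2 .col; cases u <;> exact this
      refine ⟨by rwa [e1], ?_, h8, fun h => key (by rwa [← e1])⟩
      rw [h7', e1, e2, e3, g2]
      change _ + b = _
      ring
    | wrap =>
      obtain ⟨rfl : tr = _, u', a, rfl : l' = _, h8⟩ := h6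
      have e2 : v' .row = v .row + 1 := by have := h2 .row; cases u <;> exact this
      have e3 : v' .col = 0 := by have := h2 .col; cases u <;> exact this
      have e4 : v .col = v .last := h1 (.col, .last) (.inr (.inl ⟨by simp, rfl⟩))
      refine ⟨by rwa [e1], ?_, h8, fun h => key (by rwa [← e1])⟩
      rw [h7', e1, e2, e3, g2, e4]
      change _ + b = _
      ring
    | fin =>
      obtain ⟨hd, rfl : tr = _, u', f, rfl : l' = _⟩ := h6
      have e3 : v' .col = 0 := by have := h2 .col; cases u <;> exact this
      have e4 : v .col = v .last := h1 (.col, .last) (.inr (.inl ⟨by simp, rfl⟩))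
      have e5 : v .row = v .last := h1 (.row, .last) (.inr (.inr ⟨rfl, rfl⟩))
      refine ⟨by rwa [e1], ?_, fun h => (key (by rwa [← e1])).1 hd, fun _ _ h => absurd h (by simp)⟩
      rw [h7', e1, e3, g2, e4, e5]
      change _ + b = _
      ring
  | char d u f =>
    obtain ⟨g1, g2, g3, g4⟩ := hx
    have e1 : v' .last = v .last := by have := h2 .last; cases f <;> exact this
    have e2 : v' .gen = v .gen := by have := h2 .gen; cases f <;> exact this
    have e3 : v' .prod = v .prod := by have := h2 .prod; cases f <;> exact this
    have h6' : (l', tr) ∈ membershipNext (.char d u f) (encodeInstance S e X t)[p]? := h6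
    have h7' : p' = SweepMachine.applyTurn (encodeInstance S e X t) tr p := h7
    have hgen : (u = true → (encodeInstance S e X t)[p]? = some true) →
        v .last + 1 = N → v .col < v .last + 1 → (d || u) = true → IsNumberOf S e X (v .gen) := by
      intro hu hN hcol hdu
      cases u with
      | false => exact g4 hN hcol.le (by simpa using hdu)
      | true =>
        have hcg : v .col = v .gen := h1 (.col, .gen) (.inl ⟨rfl, rfl⟩)
        rw [hcg, hN] at hcol
        have hb := clog_two_succ_of_two_pow_le g1 (hv _)
        rw [hN] at hb g2
        have : (encodeInstance S e X t)[N * N * Nat.clog 2 N + v .gen]? = _ :=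
          getElem?_encodeInstance_gen S e X t ⟨_, hcol⟩
        rw [hcg] at g2
        rw [hb, ← g2, hu rfl] at this
        exact ⟨hcol, by simpa using this⟩
    cases hc : (encodeInstance S e X t)[p]? with
    | none => rw [hc] at h6'; cases f <;> exact h6'.elim
    | some i =>
      rw [hc] at h6' hgen
      have hlt : p < (encodeInstance S e X t).length := (List.getElem?_eq_some_iff.1 hc).1
      cases f with
      | false =>
        obtain ⟨hu, rfl : tr = _, u', f, rfl : l' = _⟩ := h6'
        have e4 : v' .col = v .col + 1 := h2 .col
        refine ⟨by rwa [e1], ?_, ?_, ?_⟩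
        · rw [h7', e1, e4, SweepMachine.applyTurn, min_eq_left hlt, g2]
          ring
        · rwa [e1, e2, e3]
        · rw [e1, e2, e4]
          exact fun hN hcol => hgen (fun h => by rw [hu h]) hN hcol
      | true =>
        obtain ⟨hu, rfl : tr = _, hdu, rfl : l' = _⟩ := h6'
        have e4 : v .col = v .last := h1 (.col, .last) (.inr ⟨rfl, rfl⟩)
        refine ⟨by rwa [e1], ?_, ?_⟩
        · rw [h7', e1, SweepMachine.applyTurn, min_eq_left hlt, g2, e4]
          ring
        · rw [e1, e3]
          exact fun hN => g3 hN (hgen (fun h => by rw [hu h]) hN (by omega) hdu)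
  | target =>
    obtain ⟨g1, g2, g3⟩ := hx
    have e1 : v' .last = v .last := h2 .last
    have e2 : v' .prod = v .prod := h2 .prod
    have e3 : ∀ i < b, (encodeInstance S e X t)[p + i]? = some ((v' .left).testBit i) := h2 .left
    have h5' := h5 rfl
    have h6' : (l', tr) ∈ membershipNext .target (encodeInstance S e X t)[p + b]? := h6
    have h7' : p' = SweepMachine.applyTurn (encodeInstance S e X t) tr (p + b) := h7
    have hb := clog_two_succ_of_two_pow_le g1 (hv _)
    cases hc : (encodeInstance S e X t)[p + b]? with
    | some i => rw [hc] at h6'; exact h6'.elim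
    | none =>
      rw [hc] at h6'
      rw [List.getElem?_eq_none_iff] at hc
      -- The input was consumed exactly, so its length is that of an instance with `last + 1`
      -- elements, and lengths determine sizes.
      have hN : v .last + 1 = N := by
        refine instanceLength_strictMono.injective ?_
        rw [← length_encodeInstance S e X t, le_antisymm hc h5', g2, instanceLength, hb]
      rcases h6' with h6' | h6' <;> obtain ⟨rfl, rfl⟩ := Prod.mk.inj h6'
      · refine ⟨?_, by rw [e2]; exact g3 hN⟩
        rw [hN] at hb g2
        subst hb
        refine eq_of_testBit_eq_letter (h3 _) e3 fun i hi => ?_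
        rw [g2]
        exact getElem?_encodeInstance_target S e X t hi
      · exact ⟨h7', by rwa [e1], by rw [e1]; exact hN, by rw [e2]; exact g3 hN⟩
  | found =>
    obtain ⟨g1, g2, g3⟩ := hx
    obtain ⟨rfl, rfl⟩ := Prod.mk.inj (show (l', tr) = _ from h6)
    have h8 : v .left = v .prod := h1 (.left, .prod) rfl
    have : (⟨v .prod, g2⟩ : Fin N) = e t := Fin.ext (h8.symm.trans g1)
    rw [this, Equiv.symm_apply_apply] at g3
    exact g3
  | accept => exact h6.elim

/-- The machine accepts no instance that has to be rejected. -/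
theorem mem_closure_of_reaches {b : ℕ} {x : MembershipLabel × ℕ × (MembershipReg → ℕ)}
    (h : membershipMachine.Reaches b (encodeInstance S e X t) x) (hx : x.1 = .accept) :
    t ∈ Subsemigroup.closure X := by
  obtain ⟨v, hv, h⟩ := h
  have key : MembershipInvariant S e X t b x.1 x.2.1 x.2.2 ∧ ∀ u, x.2.2 u < 2 ^ b := by
    clear hx
    induction h with
    | refl => exact ⟨rfl, hv⟩
    | tail _ h ih => exact ⟨ih.1.step h ih.2, h.2.2.1⟩
  obtain ⟨l, p, v⟩ := x
  subst hx
  exact key.1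

end Soundness

/-- The contents of the registers. -/
def membershipRegs (last left gen prod row col : ℕ) : MembershipReg → ℕ
  | .last => last
  | .left => left
  | .gen => gen
  | .prod => prod
  | .row => row
  | .col => col

/-! ### Single steps of the machine. -/

section Steps

variable {b p : ℕ} {w : List Bool} {v v' : MembershipReg → ℕ}

theorem membershipMachine_step_init (a : Advance) (hlt : ∀ z, v' z < 2 ^ b)
    (hfull : 2 ^ b ≤ 2 * v' .last + 1) (h1 : v' .last = v .last) (h2 : v' .left = v .left)
    (h3 : v' .gen = v .gen) (h4 : v' .prod = v .gen) (h5 : v' .row = 0) (h6 : v' .col = 0) :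
    membershipMachine.Step b w (.init, 0, v) (.entry true false a, 0, v') := by
  refine ⟨fun z hz => hz.elim, fun z => by cases z <;> assumption, hlt, ?_, nofun,
    .stay, ⟨rfl, a, rfl⟩, rfl⟩
  rintro _ rfl
  exact hfull

theorem membershipMachine_step_restart (u : Bool) (a : Advance) (hlt : ∀ z, v' z < 2 ^ b)
    (h1 : v' .last = v .last) (h2 : v' .left = v .prod)
    (h4 : v' .prod = v .prod) (h5 : v' .row = 0) (h6 : v' .col = 0) :
    membershipMachine.Step b w (.restart, 0, v) (.entry false u a, 0, v') := by
  refine ⟨fun z hz => hz.elim, fun z => ?_, hlt, fun z hz => hz.elim, nofun, .stay,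
    ⟨rfl, u, a, rfl⟩, rfl⟩
  cases z <;> first | assumption | trivial

theorem membershipMachine_step_entry {d u : Bool} {a : Advance} {l : MembershipLabel}
    (hlt : ∀ z, v' z < 2 ^ b) (hp : p + b ≤ w.length)
    (h1 : v' .last = v .last) (h2 : v' .left = v .left) (h3 : v' .gen = v .gen)
    (h4 : u = true → v .row = v .left ∧ v .col = v .gen ∧
      ∀ i < b, w[p + i]? = some ((v' .prod).testBit i))
    (h5 : u = false → v' .prod = v .prod)
    (h6 : match a with
      | .inc => v' .row = v .row ∧ v' .col = v .col + 1
      | .wrap => v .col = v .last ∧ v' .row = v .row + 1 ∧ v' .col = 0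
      | .fin => v .col = v .last ∧ v .row = v .last ∧ v' .row = v .row ∧ v' .col = 0)
    (hl : (l, Turn.stay) ∈ membershipNext (.entry d u a) w[p + b]?) :
    membershipMachine.Step b w (.entry d u a, p, v) (l, p + b, v') := by
  refine ⟨?_, fun z => ?_, hlt, fun z hz => hz.elim, fun _ => hp, .stay, hl, rfl⟩
  · rintro z (⟨hu, rfl | rfl⟩ | ⟨ha, rfl⟩ | ⟨rfl, rfl⟩)
    · exact (h4 hu).1
    · exact (h4 hu).2.1
    · cases a
      · exact absurd rfl ha
      · exact h6.1
      · exact h6.1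
    · exact h6.2.1
  · cases z with
    | last => cases u <;> cases a <;> exact h1
    | left => cases u <;> cases a <;> exact h2
    | gen => cases u <;> cases a <;> exact h3
    | prod =>
      cases u with
      | false => cases a <;> exact h5 rfl
      | true => exact (h4 rfl).2.2
    | row =>
      cases a with
      | inc => cases u <;> exact h6.1
      | wrap => cases u <;> exact h6.2.1
      | fin => cases u <;> exact h6.2.2.1
    | col =>
      cases a with
      | inc => cases u <;> exact h6.2
      | wrap => cases u <;> exact h6.2.2
      | fin => cases u <;> exact h6.2.2.2

theorem membershipMachine_step_char {d u f i : Bool} {l : MembershipLabel}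
    (hlt : ∀ z, v' z < 2 ^ b) (hp : w[p]? = some i)
    (h1 : v' .last = v .last) (h2 : v' .left = v .left) (h3 : v' .gen = v .gen)
    (h4 : v' .prod = v .prod) (h5 : v' .row = v .row)
    (h6 : v' .col = if f then v .col else v .col + 1) (hu : u = true → v .col = v .gen)
    (hf : f = true → v .col = v .last)
    (hl : (l, Turn.right) ∈ membershipNext (.char d u f) (some i)) :
    membershipMachine.Step b w (.char d u f, p, v) (l, p + 1, v') := by
  refine ⟨?_, fun z => ?_, hlt, fun z hz => hz.elim, nofun, .right, by rw [← hp] at hl; exact hl,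
    (min_eq_left (List.getElem?_eq_some_iff.1 hp).1).symm⟩
  · rintro z (⟨hu', rfl⟩ | ⟨hf', rfl⟩)
    · exact hu hu'
    · exact hf hf'
  · cases f <;> cases z <;> assumption

theorem membershipMachine_step_target {l : MembershipLabel} {tr : Turn}
    (hlt : ∀ z, v' z < 2 ^ b) (hp : p + b = w.length)
    (h1 : v' .last = v .last) (h2 : ∀ i < b, w[p + i]? = some ((v' .left).testBit i))
    (h3 : v' .gen = v .gen) (h4 : v' .prod = v .prod) (h5 : v' .row = v .row)
    (h6 : v' .col = v .col) (hl : (l, tr) ∈ membershipNext .target none) :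
    membershipMachine.Step b w (.target, p, v) (l, SweepMachine.applyTurn w tr w.length, v') := by
  refine ⟨fun z hz => hz.elim, fun z => by cases z <;> assumption, hlt, fun z hz => hz.elim,
    fun _ => hp.le, tr, ?_, by rw [← hp]; rfl⟩
  rw [← List.getElem?_eq_none_iff.2 hp.ge] at hl
  exact hl

theorem membershipMachine_step_found (hlt : ∀ z, v z < 2 ^ b) (h : v .left = v .prod) :
    membershipMachine.Step b w (.found, p, v) (.accept, p, v) := by
  refine ⟨?_, fun z => by cases z <;> rfl, hlt, fun z hz => hz.elim, nofun, .stay, rfl, rfl⟩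
  rintro z rfl
  exact h

end Steps

/-! ### Completeness of the machine. -/

section Completeness

variable {S : FinSemigroup} {n : ℕ} {e : S.Carrier ≃ Fin (n + 1)} {X : Set S.Carrier}
  {t : S.Carrier}

theorem membershipRegs_lt {n s x r a c b : ℕ} (hb : n < 2 ^ b) (hs : s ≤ n) (hx : x ≤ n)
    (hr : r ≤ n) (ha : a ≤ n) (hc : c ≤ n) (z : MembershipReg) :
    membershipRegs n s x r a c z < 2 ^ b := by
  cases z <;> simp only [membershipRegs] <;> omega

/-- How to continue after the given entry of the table. -/
def advanceAt (n k : ℕ) : Advance :=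
  if k % (n + 1) < n then .inc else if k / (n + 1) < n then .wrap else .fin

theorem succ_div_mod_of_mod_lt {n k : ℕ} (h : k % (n + 1) < n) :
    (k + 1) / (n + 1) = k / (n + 1) ∧ (k + 1) % (n + 1) = k % (n + 1) + 1 := by
  rw [Nat.div_mod_unique n.add_one_pos]
  have := Nat.mod_add_div k (n + 1)
  omega

theorem succ_div_mod_of_mod_eq {n k : ℕ} (h : k % (n + 1) = n) :
    (k + 1) / (n + 1) = k / (n + 1) + 1 ∧ (k + 1) % (n + 1) = 0 := by
  rw [Nat.div_mod_unique n.add_one_pos, mul_add]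
  have := Nat.mod_add_div k (n + 1)
  omega

/-- Entry `k` lies in row `k / (n + 1)` and column `k % (n + 1)`. The sequences `d`, `u`, `r`
prescribe the flags and the register `prod` over time, which covers passes with and without a
multiplication. -/
theorem reaches_entry {d u : ℕ → Bool} {r : ℕ → ℕ} {s x : ℕ} (hs : s ≤ n) (hx : x ≤ n)
    (hr : ∀ k, r k ≤ n) (hd : ∀ k, d (k + 1) = (d k || u k))
    (hu : ∀ k, d k = true → u k = false)
    (huse : ∀ k, u k = true → k / (n + 1) = s ∧ k % (n + 1) = x ∧
      ∀ i < Nat.clog 2 (n + 1), (encodeInstance S e X t)[k * Nat.clog 2 (n + 1) + i]? =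
        some ((r (k + 1)).testBit i))
    (hskip : ∀ k, u k = false → r (k + 1) = r k)
    (h0 : membershipMachine.Reaches (Nat.clog 2 (n + 1)) (encodeInstance S e X t)
      (.entry (d 0) (u 0) (advanceAt n 0), 0, membershipRegs n s x (r 0) 0 0))
    (k : ℕ) (hk : k < (n + 1) * (n + 1)) :
    membershipMachine.Reaches (Nat.clog 2 (n + 1)) (encodeInstance S e X t)
      (.entry (d k) (u k) (advanceAt n k), k * Nat.clog 2 (n + 1),
        membershipRegs n s x (r k) (k / (n + 1)) (k % (n + 1))) := by
  have hb : n < 2 ^ Nat.clog 2 (n + 1) := Nat.le_pow_clog (by norm_num) (n + 1)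
  induction k with
  | zero => simpa using h0
  | succ k ih =>
    obtain ⟨v, hv, h⟩ := ih (by omega)
    refine ⟨v, hv, h.tail ?_⟩
    have hlt : (k + 1) / (n + 1) ≤ n := Nat.lt_succ_iff.1 (Nat.div_lt_of_lt_mul hk)
    have hmod := Nat.mod_lt (k + 1) (Nat.succ_pos n)
    rw [Nat.succ_mul k]
    refine membershipMachine_step_entry
      (membershipRegs_lt hb hs hx (hr _) hlt (Nat.lt_succ_iff.1 hmod)) ?_ rfl rfl rfl
      (fun h => huse k h) (fun h => hskip k h) ?_ ?_
    · rw [length_encodeInstance, instanceLength]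
      have := Nat.mul_le_mul_right (Nat.clog 2 (n + 1)) hk.le
      rw [Nat.succ_mul] at this
      omega
    · unfold advanceAt
      rcases Nat.lt_or_ge (k % (n + 1)) n with h | h
      · rw [if_pos h]
        exact succ_div_mod_of_mod_lt h
      · have h' : k % (n + 1) = n :=
          le_antisymm (Nat.lt_succ_iff.1 (Nat.mod_lt k (Nat.succ_pos n))) h
        obtain ⟨h1, h2⟩ := succ_div_mod_of_mod_eq h'
        rw [if_neg (by omega), if_pos (by omega)]
        exact ⟨h', h1, h2⟩
    · have hdu : (Turn.stay = Turn.stay ∧ ∃ u' a, MembershipLabel.entry (d (k + 1)) (u (k + 1))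
          (advanceAt n (k + 1)) = .entry (d k || u k) u' a ∧ ((d k || u k) = true → u' = false)) :=
        ⟨rfl, u (k + 1), advanceAt n (k + 1), by rw [hd], fun h => hu _ (by rw [hd, h])⟩
      unfold advanceAt
      rcases Nat.lt_or_ge (k % (n + 1)) n with h | h
      · rw [if_pos h]
        exact hdu
      · have h' : k % (n + 1) = n :=
          le_antisymm (Nat.lt_succ_iff.1 (Nat.mod_lt k (Nat.succ_pos n))) h
        obtain ⟨h1, h2⟩ := succ_div_mod_of_mod_eq h'
        rw [if_neg (by omega), if_pos (by omega)]
        exact hdu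

theorem reaches_char_zero {d u : ℕ → Bool} {r : ℕ → ℕ} {s x : ℕ} (hs : s ≤ n) (hx : x ≤ n)
    (hr : ∀ k, r k ≤ n) (hd : ∀ k, d (k + 1) = (d k || u k))
    (hu : ∀ k, d k = true → u k = false)
    (huse : ∀ k, u k = true → k / (n + 1) = s ∧ k % (n + 1) = x ∧
      ∀ i < Nat.clog 2 (n + 1), (encodeInstance S e X t)[k * Nat.clog 2 (n + 1) + i]? =
        some ((r (k + 1)).testBit i))
    (hskip : ∀ k, u k = false → r (k + 1) = r k)
    (h0 : membershipMachine.Reaches (Nat.clog 2 (n + 1)) (encodeInstance S e X t)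
      (.entry (d 0) (u 0) (advanceAt n 0), 0, membershipRegs n s x (r 0) 0 0))
    (hlast : d ((n + 1) * (n + 1)) = true) (u' f : Bool) :
    membershipMachine.Reaches (Nat.clog 2 (n + 1)) (encodeInstance S e X t)
      (.char false u' f, (n + 1) * (n + 1) * Nat.clog 2 (n + 1),
        membershipRegs n s x (r ((n + 1) * (n + 1))) n 0) := by
  have hb : n < 2 ^ Nat.clog 2 (n + 1) := Nat.le_pow_clog (by norm_num) (n + 1)
  obtain ⟨k, hk⟩ : ∃ k, (n + 1) * (n + 1) = k + 1 := ⟨n * n + 2 * n, by ring⟩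
  obtain ⟨v, hv, h⟩ := reaches_entry hs hx hr hd hu huse hskip h0 k (by omega)
  refine ⟨v, hv, h.tail ?_⟩
  have hkn : k / (n + 1) = n ∧ k % (n + 1) = n := by
    rw [Nat.div_mod_unique n.add_one_pos]
    have : n * (n + 1) + (n + 1) = (n + 1) * (n + 1) := by ring
    constructor
    · rw [mul_comm]; omega
    · omega
  have hadv : advanceAt n k = .fin := by
    rw [advanceAt, if_neg (by omega), if_neg (by omega)]
  rw [hk, Nat.succ_mul k, hadv, hkn.1, hkn.2]
  rw [hk] at hlast
  refine membershipMachine_step_entry (membershipRegs_lt hb hs hx (hr _) le_rfl (Nat.zero_le n)) ?_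
    rfl rfl rfl (fun h => ?_) (fun h => hskip k h) ⟨rfl, rfl, rfl, rfl⟩ ?_
  · rw [length_encodeInstance, instanceLength, hk, Nat.succ_mul]
    omega
  · have := huse k h
    rwa [hkn.1, hkn.2] at this
  · exact ⟨by rw [← hd, hlast], rfl, u', f, rfl⟩

-- The generator is verified at position `x` of the characteristic vector; the flag for this is
-- guessed one entry ahead.
open Classical in
theorem reaches_target {s x r : ℕ} (hs : s ≤ n) (hx : x < n + 1)
    (hX : e.symm ⟨x, hx⟩ ∈ X) (hr : r ≤ n)
    (h0 : ∀ u' f, membershipMachine.Reaches (Nat.clog 2 (n + 1)) (encodeInstance S e X t)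
      (.char false u' f, (n + 1) * (n + 1) * Nat.clog 2 (n + 1), membershipRegs n s x r n 0)) :
    membershipMachine.Reaches (Nat.clog 2 (n + 1)) (encodeInstance S e X t)
      (.target, (n + 1) * (n + 1) * Nat.clog 2 (n + 1) + (n + 1), membershipRegs n s x r n n) := by
  have hb : n < 2 ^ Nat.clog 2 (n + 1) := Nat.le_pow_clog (by norm_num) (n + 1)
  have hgen : ∀ k (h : k < n + 1), (encodeInstance S e X t)[(n + 1) * (n + 1) *
      Nat.clog 2 (n + 1) + k]? = some (decide (e.symm ⟨k, h⟩ ∈ X)) := fun k h =>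
    getElem?_encodeInstance_gen S e X t ⟨k, h⟩
  have hx' : ∀ k (h : k < n + 1), decide (k = x) = true → decide (e.symm ⟨k, h⟩ ∈ X) = true := by
    intro k h hk
    obtain rfl := of_decide_eq_true hk
    exact decide_eq_true hX
  have key : ∀ k ≤ n, membershipMachine.Reaches (Nat.clog 2 (n + 1)) (encodeInstance S e X t)
      (.char (decide (x < k)) (decide (k = x)) (decide (k = n)),
        (n + 1) * (n + 1) * Nat.clog 2 (n + 1) + k, membershipRegs n s x r n k) := by
    intro k hk
    induction k with
    | zero => simpa using h0 _ _
    | succ k ih =>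
      obtain ⟨v, hv, h⟩ := ih (by omega)
      refine ⟨v, hv, h.tail ?_⟩
      have hf : decide (k = n) = false := decide_eq_false (by omega)
      rw [hf, ← add_assoc]
      refine membershipMachine_step_char
        (membershipRegs_lt hb hs (Nat.lt_succ_iff.1 hx) hr le_rfl hk) (hgen k (by omega))
        rfl rfl rfl rfl rfl rfl (fun h => of_decide_eq_true h) nofun
        ⟨hx' k (by omega), rfl, decide (k + 1 = x), decide (k + 1 = n),
          congrArg (fun d => MembershipLabel.char d _ _) ?_⟩
      rw [← Bool.decide_or, decide_eq_decide]
      omega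
  obtain ⟨v, hv, h⟩ := key n le_rfl
  refine ⟨v, hv, h.tail ?_⟩
  rw [decide_eq_true (rfl : n = n), ← add_assoc]
  refine membershipMachine_step_char
    (membershipRegs_lt hb hs (Nat.lt_succ_iff.1 hx) hr le_rfl le_rfl) (hgen n (by omega))
    rfl rfl rfl rfl rfl rfl (fun h => of_decide_eq_true h) (fun _ => rfl)
    ⟨hx' n (by omega), rfl, ?_, rfl⟩
  rw [← Bool.decide_or]
  exact decide_eq_true (by omega)

theorem two_pow_clog_two_succ_le (n : ℕ) : 2 ^ Nat.clog 2 (n + 1) ≤ 2 * n + 1 := by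
  rcases Nat.eq_zero_or_pos n with rfl | hn
  · simp
  · have h1 := Nat.pow_pred_clog_lt_self (b := 2) (x := n + 1) (by norm_num) (by omega)
    have h2 := Nat.clog_pos (b := 2) (n := n + 1) (by norm_num) (by omega)
    obtain ⟨c, hc⟩ := Nat.exists_eq_succ_of_ne_zero h2.ne'
    rw [hc, Nat.pred_succ] at h1
    rw [hc, pow_succ]
    omega

/-- The machine can compute the given product. -/
def CanReach (e : S.Carrier ≃ Fin (n + 1)) (X : Set S.Carrier) (t z : S.Carrier) : Prop :=
  ∃ s ≤ n, ∃ x ≤ n, membershipMachine.Reaches (Nat.clog 2 (n + 1)) (encodeInstance S e X t)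
    (.target, (n + 1) * (n + 1) * Nat.clog 2 (n + 1) + (n + 1), membershipRegs n s x (e z) n n)

theorem canReach_of_mem {z : S.Carrier} (hz : z ∈ X) : CanReach e X t z := by
  have hb : n < 2 ^ Nat.clog 2 (n + 1) := Nat.le_pow_clog (by norm_num) (n + 1)
  have hzn := Nat.lt_succ_iff.1 (e z).2
  refine ⟨0, Nat.zero_le n, e z, hzn, reaches_target (Nat.zero_le n) (e z).2 (by simpa using hz) hzn
    fun u' f => reaches_char_zero (d := fun _ => true) (u := fun _ => false) (r := fun _ => e z)
    (Nat.zero_le n) hzn (fun _ => hzn) (fun _ => rfl) (fun _ _ => rfl) nofun (fun _ _ => rfl) ?_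
    rfl u' f⟩
  refine ⟨membershipRegs n 0 (e z) 0 0 0, membershipRegs_lt hb (Nat.zero_le n) hzn (Nat.zero_le n)
    (Nat.zero_le n) (Nat.zero_le n), .single (membershipMachine_step_init _
    (membershipRegs_lt hb (Nat.zero_le n) hzn hzn (Nat.zero_le n) (Nat.zero_le n)) ?_
    rfl rfl rfl rfl rfl rfl)⟩
  exact two_pow_clog_two_succ_le n

theorem CanReach.mul {y z : S.Carrier} (hy : CanReach e X t y) (hz : z ∈ X) :
    CanReach e X t (y * z) := by
  have hb : n < 2 ^ Nat.clog 2 (n + 1) := Nat.le_pow_clog (by norm_num) (n + 1)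
  have hlt : ∀ z, (e z).val ≤ n := fun z => Nat.lt_succ_iff.1 (e z).2
  obtain ⟨s, hs, x, hx, v, hv, h⟩ := hy
  -- The number of the table entry that holds `y * z`; the register `prod` changes there.
  set k₀ := (e y).val * (n + 1) + (e z).val with hk₀
  have hk₀' : k₀ < (n + 1) * (n + 1) := by
    have := Nat.mul_le_mul_right (n + 1) (e y).2
    rw [Nat.succ_mul] at this
    omega
  refine ⟨e y, hlt y, e z, hlt z, reaches_target (hlt y) (e z).2 (by simpa using hz) (hlt _)
    fun u' f => ?_⟩
  have := reaches_char_zero (S := S) (e := e) (X := X) (t := t) (s := e y) (x := e z)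
    (d := fun k => decide (k₀ < k)) (u := fun k => decide (k = k₀))
    (r := fun k => if k₀ < k then (e (y * z)).val else (e y).val) (hlt y) (hlt z)
    (fun k => by split_ifs <;> exact hlt _)
    (fun k => by rw [← Bool.decide_or, decide_eq_decide]; omega)
    (fun k => by simp only [decide_eq_true_eq, decide_eq_false_iff_not]; omega)
    (fun k hk => ?_) (fun k hk => ?_) ?_ (decide_eq_true hk₀') u' f
  · rwa [if_pos hk₀'] at this
  · obtain rfl : k = k₀ := of_decide_eq_true hk
    have h1 : k₀ / (n + 1) = e y ∧ k₀ % (n + 1) = e z := by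
      rw [Nat.div_mod_unique n.add_one_pos]
      refine ⟨?_, (e z).2⟩
      rw [hk₀]; ring
    refine ⟨h1.1, h1.2, fun i hi => ?_⟩
    rw [if_pos (Nat.lt_succ_self _)]
    simpa using getElem?_encodeInstance_table S e X t (e y) (e z) hi
  · have : k ≠ k₀ := of_decide_eq_false hk
    by_cases h : k₀ < k
    · rw [if_pos h, if_pos (by omega)]
    · rw [if_neg h, if_neg (by omega)]
  · have hlen : (n + 1) * (n + 1) * Nat.clog 2 (n + 1) + (n + 1) + Nat.clog 2 (n + 1) =
        (encodeInstance S e X t).length := (length_encodeInstance S e X t).symm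
    have h1 : membershipMachine.Reaches (Nat.clog 2 (n + 1)) (encodeInstance S e X t)
        (.restart, 0, membershipRegs n (e t) x (e y) n n) :=
      ⟨v, hv, h.tail (membershipMachine_step_target (v := membershipRegs n s x (e y) n n)
        (membershipRegs_lt hb (hlt t) hx (hlt y) le_rfl le_rfl) hlen rfl
        (fun i hi => getElem?_encodeInstance_target S e X t hi) rfl rfl rfl rfl (.inr rfl))⟩
    obtain ⟨v, hv, h⟩ := h1
    have h0 : (if k₀ < 0 then (e (y * z)).val else (e y).val) = e y := if_neg (Nat.not_lt_zero _)
    refine ⟨v, hv, h.tail ?_⟩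
    simp only [Nat.not_lt_zero, decide_false, if_false]
    exact membershipMachine_step_restart _ _
      (membershipRegs_lt hb (hlt y) (hlt z) (hlt y) (Nat.zero_le n) (Nat.zero_le n))
      rfl rfl rfl rfl rfl

/-- The machine multiplies only by generators on the right, whereas the closure is built from
arbitrary products. The induction therefore carries along that right multiplication by `z` preserves
what can be reached. -/
theorem canReach_of_mem_closure {z : S.Carrier} (hz : z ∈ Subsemigroup.closure X) :
    CanReach e X t z := by
  have key : CanReach e X t z ∧ ∀ y, CanReach e X t y → CanReach e X t (y * z) := by
    induction hz using Subsemigroup.closure_induction with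
    | mem z hz => exact ⟨canReach_of_mem hz, fun y hy => hy.mul hz⟩
    | mul a c _ _ ha hc =>
      refine ⟨hc.2 a ha.1, fun y hy => ?_⟩
      rw [← mul_assoc]
      exact hc.2 _ (ha.2 y hy)
  exact key.1

/-- The machine accepts every instance that has to be accepted. -/
theorem reaches_accept_of_mem_closure (ht : t ∈ Subsemigroup.closure X) :
    ∃ x, membershipMachine.Reaches (Nat.clog 2 (n + 1)) (encodeInstance S e X t) x ∧
      x.1 = .accept := by
  have hb : n < 2 ^ Nat.clog 2 (n + 1) := Nat.le_pow_clog (by norm_num) (n + 1)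
  have hlt : ∀ z, (e z).val ≤ n := fun z => Nat.lt_succ_iff.1 (e z).2
  obtain ⟨s, hs, x, hx, v, hv, h⟩ := canReach_of_mem_closure (e := e) (t := t) ht
  have hlen : (n + 1) * (n + 1) * Nat.clog 2 (n + 1) + (n + 1) + Nat.clog 2 (n + 1) =
      (encodeInstance S e X t).length := (length_encodeInstance S e X t).symm
  have hlt' := membershipRegs_lt hb (hlt t) hx (hlt t) le_rfl le_rfl
  exact ⟨_, ⟨v, hv, (h.tail (membershipMachine_step_target (v' := membershipRegs n (e t) x (e t) n n)
    hlt' hlen rfl (fun i hi => getElem?_encodeInstance_target S e X t hi) rfl rfl rfl rfl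
    (.inl rfl))).tail (membershipMachine_step_found hlt' rfl)⟩, rfl⟩

end Completeness

theorem clog_le_width {w : List Bool} {N : ℕ} (h : N ≤ w.length) :
    Nat.clog 2 N ≤ SweepMachine.width w :=
  Nat.clog_le_of_le_pow (h.trans ((Nat.le_succ _).trans (lt_two_pow_length_binary _).le))

theorem memClass_NL (V : Set FinSemigroup) : (CSM V).MemClass NL := by
  refine ⟨_, membershipMachine.language_mem_NL, ?_, ?_⟩
  · rintro w ⟨S, -, N, e, X, t, rfl, ht⟩
    obtain ⟨n, rfl⟩ : ∃ n, N = n + 1 :=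
      Nat.exists_eq_succ_of_ne_zero (Nat.pos_of_ne_zero fun h => by subst h; exact (e t).elim0).ne'
    refine ⟨Nat.clog 2 (n + 1), clog_le_width ?_, reaches_accept_of_mem_closure ht⟩
    rw [length_encodeInstance]
    exact le_instanceLength _
  · rintro w ⟨S, -, N, e, X, t, rfl, ht⟩ ⟨b, -, x, hx, hacc⟩
    exact ht (mem_closure_of_reaches hx hacc)

/-! ### Parity in NL, and the consequences. -/

/-- A machine for the parity of the number of ones. -/
def parityMachine : RegisterMachine where
  Label := Option Bool
  Reg := Empty
  start := some false
  accept := {none}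
  test _ := ∅
  update _ := nofun
  reads _ := false
  reads_of_input _ u := u.elim
  full _ := ∅
  next
    | some d, some i => {(some (d ^^ i), .right)}
    | some true, none => {(none, .stay)}
    | _, _ => ∅

theorem decide_odd_count_take_succ {w : List Bool} {p : ℕ} {i : Bool} (h : w[p]? = some i) :
    decide (Odd ((w.take (p + 1)).count true)) = (decide (Odd ((w.take p).count true)) ^^ i) := by
  rw [List.take_add_one, h, List.count_append]
  cases i <;> simp [Nat.odd_add_one, -Nat.not_odd_iff_even]

/-- A finite automaton suffices: there are no registers, and zero columns are enough. -/
theorem parity_mem_NL : parity ∈ NL := by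
  suffices h : ∀ w, w ∈ parity ↔ ∃ b ≤ SweepMachine.width w, ∃ x,
      parityMachine.Reaches b w x ∧ x.1 ∈ parityMachine.accept by
    rw [show parity = {w | _} from Set.ext h]
    exact parityMachine.language_mem_NL
  intro w
  constructor
  · intro hw
    have key : ∀ p ≤ w.length, parityMachine.Reaches 0 w
        (some (decide (Odd ((w.take p).count true))), p, nofun) := by
      intro p hp
      induction p with
      | zero => exact ⟨nofun, nofun, by simp; exact .refl⟩
      | succ p ih =>
        obtain ⟨v, hv, h⟩ := ih (by omega)
        have hi : w[p]? = some w[p] := List.getElem?_eq_getElem hp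
        refine ⟨v, hv, h.tail ⟨nofun, nofun, nofun, nofun, nofun, .right, ?_,
          (min_eq_left hp).symm⟩⟩
        change _ ∈ parityMachine.next _ w[p]?
        rw [hi, decide_odd_count_take_succ hi]
        rfl
    obtain ⟨v, hv, h⟩ := key w.length le_rfl
    refine ⟨0, Nat.zero_le _, (none, w.length, nofun), ⟨v, hv, h.tail
      ⟨nofun, nofun, nofun, nofun, nofun, .stay, ?_, rfl⟩⟩, rfl⟩
    rw [List.take_length, decide_eq_true (show Odd (w.count true) from hw)]
    change _ ∈ parityMachine.next _ w[w.length]?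
    rw [List.getElem?_eq_none le_rfl]
    rfl
  · rintro ⟨b, -, x, ⟨v, hv, h⟩, hacc⟩
    have key : match x.1 with
        | some d => d = decide (Odd ((w.take x.2.1).count true))
        | none => w ∈ parity := by
      clear hacc
      induction h with
      | refl => simp [parityMachine]
      | @tail y z _ h ih =>
        obtain ⟨l, p, v⟩ := y
        obtain ⟨l', p', v'⟩ := z
        obtain ⟨-, -, -, -, -, tr, h6, h7⟩ := h
        have h6' : (l', tr) ∈ parityMachine.next l w[p]? := h6
        have h7' : p' = SweepMachine.applyTurn w tr p := h7
        cases l with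
        | none => exact h6'.elim
        | some d =>
          dsimp only at ih
          cases hi : w[p]? with
          | some i =>
            rw [hi] at h6'
            obtain ⟨rfl, rfl⟩ := Prod.mk.inj (show (l', tr) = (some (d ^^ i), .right) by
              cases d <;> exact h6')
            have hp := (List.getElem?_eq_some_iff.1 hi).1
            dsimp only
            rw [h7', SweepMachine.applyTurn, min_eq_left hp, decide_odd_count_take_succ hi, ih]
          | none =>
            rw [hi] at h6'
            cases d with
            | false => exact h6'.elim
            | true =>
              obtain ⟨rfl, rfl⟩ := Prod.mk.inj (show (l', tr) = _ from h6')
              rw [List.take_of_length_le (List.getElem?_eq_none_iff.1 hi)] at ih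
              exact of_decide_eq_true (p := Odd (w.count true)) ih.symm
    obtain ⟨l, p, v⟩ := x
    obtain rfl : l = none := hacc
    exact key

theorem PromiseProblem.MemClass.antitone {U V : Set FinSemigroup} (h : U ⊆ V)
    {K : Set (Language Bool)} (hV : (CSM V).MemClass K) : (CSM U).MemClass K := by
  obtain ⟨L, hL, h1, h2⟩ := hV
  refine ⟨L, hL, fun w hw => h1 w ?_, fun w hw => h2 w ?_⟩
  · obtain ⟨S, hS, hw⟩ := hw
    exact ⟨S, h hS, hw⟩
  · obtain ⟨S, hS, hw⟩ := hw
    exact ⟨S, h hS, hw⟩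

/-- A variety containing both classes contains their join, whose problem is NL-hard and would make
Parity reducible to a problem in qAC⁰. -/
theorem not_isVariety_of_memClass_qAC0 {U : Set FinSemigroup} (hU : (CSM U).MemClass qAC0)
    (hG : groups ⊆ U) (hC : commutative ⊆ U) : ¬ IsVariety U := by
  intro h
  have hsub : varietyJoin groups commutative ⊆ U := fun _ hS => hS U ⟨h, hG, hC⟩
  exact not_ac0Reducible_parity _ (hU.antitone hsub) (hard_NL_varietyJoin _ parity_mem_NL)

end CayleyMembership

theorem mainTheorem5 :
    IsVariety groups ∧ IsVariety commutative ∧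
    (CSM groups).MemClass qAC0 ∧ (CSM commutative).MemClass qAC0 ∧
    (∀ K : Set (Language Bool), parity ∈ K →
      ¬ Hard K (CSM groups) ∧ ¬ Hard K (CSM commutative)) ∧
    NLComplete (CSM (varietyJoin groups commutative)) ∧
    (∀ U : Set FinSemigroup, (CSM U).MemClass qAC0 → groups ⊆ U → commutative ⊆ U →
      ¬ IsVariety U) ∧
    (∀ U : Set FinSemigroup, Maximal (fun V => (CSM V).MemClass qAC0) U → ¬ IsVariety U) := by
  have hG : (CSM groups).MemClass qAC0 := memClass_qAC0_of_subset Set.subset_union_left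
  have hC : (CSM commutative).MemClass qAC0 := memClass_qAC0_of_subset Set.subset_union_right
  refine ⟨isVariety_groups, isVariety_commutative, hG, hC, fun K hK =>
    ⟨fun h => not_ac0Reducible_parity _ hG (h _ hK),
      fun h => not_ac0Reducible_parity _ hC (h _ hK)⟩,
    ⟨memClass_NL _, hard_NL_varietyJoin⟩, fun U h1 h2 h3 =>
    not_isVariety_of_memClass_qAC0 h1 h2 h3, fun U hU =>
    not_isVariety_of_memClass_qAC0 hU.prop ?_ ?_⟩
  -- Adding the groups stays in qAC⁰, so a maximal class already contains them; the same holds for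
  -- the commutative semigroups.
  · exact Set.subset_union_right.trans
      (hU.le_of_ge (memClass_qAC0_union_groups hU.prop) Set.subset_union_left)
  · exact Set.subset_union_right.trans
      (hU.le_of_ge (memClass_qAC0_union_commutative hU.prop) Set.subset_union_left)
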